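/- Let $M,L,N\ge 1$ be integers, $c_N=ML/N$, and let $R$ be an $M\times M$ Hermitian positive definite complex matrix, with distinct eigenvalues $\overline\lambda_1>\dots>\overline\lambda_{\overline M}>0$. For each $z\in\mathbb C^+$ there is a unique $t(z)\in\mathbb C^+$ with $z\,t(z)\in\mathbb C^+$ and $$t(z)=\frac1M\mathrm{Tr}\,R\,T(z),\qquad T(z)=\Big(-zI-\frac{z c_N t(z)}{1-z c_N^2 t(z)^2}R\Big)^{-1},$$ and there are unique finite positive measures $\mu_N,\nu_N$ carried by $[0,\infty)$ with $\int\frac{d\mu_N(\lambda)}{\lambda-z}=t(z)$ and $\int\frac{d\nu_N(\lambda)}{\lambda-z}=\frac1M\mathrm{Tr}\,T(z)$ for $z\in\mathbb C^+$. For real $w$ that is not an eigenvalue of $R$ put $m(w)=\frac1M\mathrm{Tr}\,R(R-wI)^{-1}$ and $\phi_N(w)=c_Nw^2\,m(w)\,(c_Nm(w)-1)$. Then: (i) $\phi_N'$ has exactly one zero $w_{+,N}$ in $(\overline\lambda_1,\infty)$, and it is a local minimum of $\phi_N$; put $x_{+,N}=\phi_N(w_{+,N})$. (ii) If $c_N>1$,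 the smallest root $\omega_{1,N}$ of $m(w)=1/c_N$ is negative, $\phi_N'$ has exactly one zero $w_{-,N}$ in $(\omega_{1,N},0)$, and it is a local maximum of $\phi_N$; put $x_{-,N}=\phi_N(w_{-,N})$, which is positive. If $c_N\le 1$, put $x_{-,N}=0$. (iii) The number of points $w<\overline\lambda_1$ with $m(w)<0$ at which $\phi_N$ has a local extremum is even, equal to $2(q-1)$ with $1\le q\le\overline M$. Write these points as $w_{1,N}^+<w_{2,N}^-<w_{2,N}^+<\dots<w_{q-1,N}^+<w_{q,N}^-$, and put $x_{k,N}^\pm=\phi_N(w_{k,N}^\pm)$. (iv) $x_{-,N}<x_{1,N}^+<x_{2,N}^-<x_{2,N}^+<\dots<x_{q,N}^-<x_{+,N}$, and $\mu_N$ and $\nu_N$ have the same support $$\mathcal S_N=\{0\}\mathbb 1_{c_N>1}\cup[x_{-,N},x_{1,N}^+]\cup[x_{2,N}^-,x_{2,N}^+]\cup\dots\cup[x_{q,N}^-,x_{+,N}],$$ where $\{0\}\mathbb 1_{c_N>1}$ is $\{0\}$ if $c_N>1$ and empty otherwise, and the union is the single interval $[x_{-,N},x_{+,N}]$ if $q=1$.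 -/

import Mathlib

open MeasureTheory
open scoped ComplexOrder

noncomputable section

namespace AutocovarianceSupport

/-- The Stieltjes transform `z ↦ ∫ dμ(x) / (x - z)` of a measure on the real line. -/
def stieltjes (μ : Measure ℝ) (z : ℂ) : ℂ :=
  resolventTransform μ z

theorem stieltjes_eq (μ : Measure ℝ) (z : ℂ) :
    stieltjes μ z = ∫ x : ℝ, ((x : ℂ) - z)⁻¹ ∂μ := by
  simp [stieltjes, resolventTransform, resolvent]

/-- The matrix `(-z I - (z c t / (1 - z c² t²)) R)⁻¹`. -/
def resolventT {M : ℕ} (R : Matrix (Fin M) (Fin M) ℂ) (c : ℝ) (z t : ℂ) :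
    Matrix (Fin M) (Fin M) ℂ :=
  (-(z • (1 : Matrix (Fin M) (Fin M) ℂ)) - ((z * c * t) / (1 - z * c ^ 2 * t ^ 2)) • R)⁻¹

/-- `t` is a solution of the canonical equation at `z` such that `t` and `z t` lie in the upper
half-plane. If `1 - z c² t² = 0` or if the matrix to be inverted is singular, the conventions
`x / 0 = 0` and `A⁻¹ = 0` make the right-hand side a real multiple of `1 / z`, hence `z t` real:
such a `t` is excluded by the last condition. -/
structure IsCanonicalSolution {M : ℕ} (R : Matrix (Fin M) (Fin M) ℂ) (c : ℝ) (z t : ℂ) :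
    Prop where
  eqn : t = (1 / (M : ℂ)) * (R * resolventT R c z t).trace
  im_pos : 0 < t.im
  im_mul_pos : 0 < (z * t).im

/-- `μ` is the finite positive measure carried by `[0, ∞)` whose Stieltjes transform at each point
`z` of the upper half-plane is the solution of the canonical equation. -/
structure IsMu {M : ℕ} (R : Matrix (Fin M) (Fin M) ℂ) (c : ℝ) (μ : Measure ℝ) : Prop where
  finite : IsFiniteMeasure μ
  carried : μ (Set.Iio 0) = 0
  transform : ∀ z : ℂ, 0 < z.im → IsCanonicalSolution R c z (stieltjes μ z)

/-- `ν` is the finite positive measure carried by `[0, ∞)` whose Stieltjes transform at each point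
`z` of the upper half-plane is `(1/M) Tr T(z)`, where
`T(z) = (-z I - (z c t / (1 - z c² t²)) R)⁻¹` and `t` is the solution of the canonical equation
at `z`. -/
structure IsNu {M : ℕ} (R : Matrix (Fin M) (Fin M) ℂ) (c : ℝ) (ν : Measure ℝ) : Prop where
  finite : IsFiniteMeasure ν
  carried : ν (Set.Iio 0) = 0
  transform : ∀ z t : ℂ, 0 < z.im → IsCanonicalSolution R c z t →
    stieltjes ν z = (1 / (M : ℂ)) * (resolventT R c z t).trace

/-- `m(w) = (1/M) Tr R (R - w I)⁻¹` for real `w` (the trace is real for Hermitian `R`).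
If `w` is an eigenvalue of `R` this is `0` by convention. -/
def mFun {M : ℕ} (R : Matrix (Fin M) (Fin M) ℂ) (w : ℝ) : ℝ :=
  (R * (R - (w : ℂ) • (1 : Matrix (Fin M) (Fin M) ℂ))⁻¹).trace.re / M

/-- `φ(w) = c w² m(w) (c m(w) - 1)`. -/
def phi {M : ℕ} (R : Matrix (Fin M) (Fin M) ℂ) (c w : ℝ) : ℝ :=
  c * w ^ 2 * mFun R w * (c * mFun R w - 1)

/-- The points below the largest eigenvalue of `R` where `m < 0` and `φ` has a local extremum. -/
def innerExtrema {M : ℕ} (R : Matrix (Fin M) (Fin M) ℂ) (c : ℝ) : Set ℝ :=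
  {w | (∃ l ∈ spectrum ℝ R, w < l) ∧ mFun R w < 0 ∧ IsLocalExtr (phi R c) w}

/-- The critical points of `φ` above the largest eigenvalue of `R`. -/
def upperCritical {M : ℕ} (R : Matrix (Fin M) (Fin M) ℂ) (c : ℝ) : Set ℝ :=
  {w | (∀ l ∈ spectrum ℝ R, l < w) ∧ deriv (phi R c) w = 0}

/-- The critical points of `φ` between the smallest root `ω₁` of `m(w) = 1 / c` and `0`. -/
def lowerCritical {M : ℕ} (R : Matrix (Fin M) (Fin M) ℂ) (c : ℝ) : Set ℝ :=
  {w | ∃ ω₁ : ℝ, IsLeast {v | mFun R v = 1 / c} ω₁ ∧ ω₁ < w ∧ w < 0 ∧ deriv (phi R c) w = 0}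

/-- The labelling of the arguments of the edges:
`wp 1 < wm 2 < wp 2 < ⋯ < wp (q-1) < wm q` are exactly the inner local extrema of `φ` (so that
there are `2 (q - 1)` of them), `wp q` is `w₊` and, if `c > 1`, `wm 1` is `w₋`.
The other values of `wm` and `wp` are irrelevant. -/
structure IsEdgeLabelling {M : ℕ} (R : Matrix (Fin M) (Fin M) ℂ) (c : ℝ) (q : ℕ)
    (wm wp : ℕ → ℝ) : Prop where
  one_le : 1 ≤ q
  le_card : q ≤ (spectrum ℝ R).ncard
  wp_lt_wm : ∀ k, 1 ≤ k → k < q → wp k < wm (k + 1)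
  wm_lt_wp : ∀ k, 2 ≤ k → k < q → wm k < wp k
  inner : innerExtrema R c = wp '' Set.Ico 1 q ∪ wm '' Set.Ioc 1 q
  upper : upperCritical R c = {wp q}
  upper_min : IsLocalMin (phi R c) (wp q)
  lower : 1 < c → lowerCritical R c = {wm 1}
  lower_max : 1 < c → IsLocalMax (phi R c) (wm 1)

/-- The left endpoints: `φ (wm k)`, except that the first one is `0` if `c ≤ 1`. -/
def leftEdge {M : ℕ} (R : Matrix (Fin M) (Fin M) ℂ) (c : ℝ) (wm : ℕ → ℝ) (k : ℕ) : ℝ :=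
  if k = 1 ∧ c ≤ 1 then 0 else phi R c (wm k)

/-- The right endpoints `φ (wp k)`. -/
def rightEdge {M : ℕ} (R : Matrix (Fin M) (Fin M) ℂ) (c : ℝ) (wp : ℕ → ℝ) (k : ℕ) : ℝ :=
  phi R c (wp k)

/-- The set `{0} 𝟙_{c > 1} ∪ ⋃_{k = 1}^{q} [x_k⁻, x_k⁺]`. -/
def bandSet (c : ℝ) (q : ℕ) (xm xp : ℕ → ℝ) : Set ℝ :=
  {x | 1 < c ∧ x = 0} ∪ ⋃ k ∈ Set.Icc 1 q, Set.Icc (xm k) (xp k)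

end AutocovarianceSupport

end

/-! Let aᵢ be the eigenvalues of R, u = c w m(w) and v = w - u, so that φ = -uv. The substitution u
= c z t, v = -1/(c t), w = u + v turns the canonical equation into φ(w) = z, with T = (w/z)(R -
w)⁻¹. With s = (c/M) ∑ aᵢ²/|aᵢ - w|² one has Im u = s Im w and Im v = (1 - s) Im w, so the
conditions that t and zt lie in the upper half-plane become Im w > 0 and s < 1. Canonical solutions
at z are thus the points of `omegaSet` over z.

One inequality carries the rest: s(|u| + |v|) < |u| on `omegaSet` (`sFun_mul_lt`), that is, s(1 +
|z|/|u|²) < 1. Since w = u - z/u, two distinct points over the same z satisfy p(1 + z/(u₁u₂)) = 1,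
where p is the divided difference of u and |p|² ≤ s₁s₂. Two Cauchy–Schwarz inequalities forbid this,
even if one of the points satisfies only the non-strict inequality (`eq_of_phiC_eq`). The same
inequality gives φ' ≠ 0. With a compactness argument, φ is a bijection of `omegaSet` onto the upper
half-plane, with holomorphic inverse `wOf`. The transforms of μ and ν are w m(w)/z and (m(w) - 1)/z
along this inverse; the measures exist by the Herglotz representation and are unique by inversion of
the transform.

For the support, let z tend to a real x. Limit points of w(z) satisfy the non-strict inequalities.
At a real point with u < 0 < v (`Good`) the strict inequality says φ' > 0. So if x = φ(w) for such a
point (x in `gapSet`), then w(z) tends to w, the transforms become real, and x is outside the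
support. Conversely, if x > 0 is outside the support of μ, then w(z) extends differentiably to x
with a real value; its derivative has nonnegative real part because Im w(z) > 0 above, so φ' > 0,
and the limiting inequality rules out u > 0 > v. For ν, a real m(w) forces a real w. On (0, ∞) both
supports are therefore the complement of `gapSet`.

Its shape follows from the real form of the two-point identity: φ is strictly increasing on the
whole set of good points with φ' ≥ 0, even across poles (`phiR_lt_phiR`). This orders the critical
values and shows that a gap between eigenvalues with a local extremum contains exactly one minimum
followed by one maximum. The origin is treated apart: it carries an atom if c > 1 and is a limit of
the first band if c ≤ 1. -/

noncomputable section
namespace AutocovarianceSupport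

open Filter Topology

/-! ### Algebra of u, v and φ; the basic inequality and injectivity. -/

section Algebra

variable {M : ℕ} (a : Fin M → ℝ) (c : ℝ)

/-- `u(w) = c w m(w)`, for the eigenvalues `a`. -/
def uC (w : ℂ) : ℂ := (c / M : ℂ) * ∑ i, a i * w / (a i - w)

/-- `v(w) = w - u(w)`. -/
def vC (w : ℂ) : ℂ := w - uC a c w

/-- The complex version of `φ`, as `-u v`. -/
def phiC (w : ℂ) : ℂ := -(uC a c w * vC a c w)

/-- `(c/M) ∑ aᵢ² / |aᵢ - w|²`. -/
def sFun (w : ℂ) : ℝ := (c / M) * ∑ i, a i ^ 2 / Complex.normSq (a i - w)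

/-- `(c/M) |w|² ∑ aᵢ / |aᵢ - w|²`. -/
def bFun (w : ℂ) : ℝ := (c / M) * ∑ i, Complex.normSq w * a i / Complex.normSq (a i - w)

/-- `(c/M) ∑ aᵢ² / ((aᵢ - w₁) (aᵢ - w₂))`. -/
def pFun (w₁ w₂ : ℂ) : ℂ := (c / M : ℂ) * ∑ i, (a i : ℂ) ^ 2 / ((a i - w₁) * (a i - w₂))

/-- The points of the upper half-plane which parametrize the canonical solutions. -/
def omegaSet : Set ℂ := {w | 0 < w.im ∧ sFun a c w < 1 ∧ 0 < (phiC a c w).im}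

variable {a c}

/-- Multiplying each fraction by the conjugate of its denominator writes u as a real multiple of w
minus a real number, whence the imaginary parts of u and v. -/
theorem uC_eq (w : ℂ) : uC a c w = sFun a c w * w - bFun a c w := by
  have h : ∀ i, (a i : ℂ) * w / (a i - w) =
      ((a i ^ 2 / Complex.normSq (a i - w) : ℝ) : ℂ) * w -
        ((Complex.normSq w * a i / Complex.normSq (a i - w) : ℝ) : ℂ) := by
    intro i
    by_cases hw : (a i : ℂ) - w = 0
    · simp [hw]
    have hw' : (starRingEnd ℂ) ((a i : ℂ) - w) ≠ 0 := by
      rwa [Ne, map_eq_zero]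
    push_cast
    rw [← Complex.mul_conj, ← Complex.mul_conj]
    rw [map_sub, Complex.conj_ofReal] at *
    field_simp
  unfold uC sFun bFun
  simp_rw [h]
  push_cast
  rw [Finset.sum_sub_distrib, ← Finset.sum_mul]
  ring

theorem vC_eq (w : ℂ) : vC a c w = (1 - sFun a c w) * w + bFun a c w := by
  rw [vC, uC_eq]; ring

theorem uC_add_vC (w : ℂ) : uC a c w + vC a c w = w := by
  rw [vC]; ring

theorem uC_im (w : ℂ) : (uC a c w).im = sFun a c w * w.im := by
  rw [uC_eq]; simp

theorem vC_im (w : ℂ) : (vC a c w).im = (1 - sFun a c w) * w.im := by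
  rw [vC, Complex.sub_im, uC_im]; ring

theorem sFun_pos (hM : 0 < M) (ha : ∀ i, 0 < a i) (hc : 0 < c) {w : ℂ}
    (hw : ∀ i, w ≠ a i) : 0 < sFun a c w := by
  have : Nonempty (Fin M) := ⟨⟨0, hM⟩⟩
  unfold sFun
  refine mul_pos (by positivity) (Finset.sum_pos (fun i _ => ?_) Finset.univ_nonempty)
  have := ha i
  have h2 : 0 < Complex.normSq (a i - w) := Complex.normSq_pos.2 (sub_ne_zero.2 (hw i).symm)
  positivity

theorem bFun_pos (hM : 0 < M) (ha : ∀ i, 0 < a i) (hc : 0 < c) {w : ℂ}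
    (hw : ∀ i, w ≠ a i) (h0 : w ≠ 0) : 0 < bFun a c w := by
  have : Nonempty (Fin M) := ⟨⟨0, hM⟩⟩
  unfold bFun
  refine mul_pos (by positivity) (Finset.sum_pos (fun i _ => ?_) Finset.univ_nonempty)
  have := ha i
  have h2 : 0 < Complex.normSq (a i - w) := Complex.normSq_pos.2 (sub_ne_zero.2 (hw i).symm)
  have h3 : 0 < Complex.normSq w := Complex.normSq_pos.2 h0
  positivity

theorem ne_ofReal_of_im_pos {w : ℂ} (hw : 0 < w.im) (x : ℝ) : w ≠ x := by
  rintro rfl; simp at hw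

/-- On the parametrizing set, `s (|u| + |v|) < |u|`. -/
theorem sFun_mul_lt (hM : 0 < M) (ha : ∀ i, 0 < a i) (hc : 0 < c) {w : ℂ}
    (hw : w ∈ omegaSet a c) :
    sFun a c w * (‖uC a c w‖ + ‖vC a c w‖) < ‖uC a c w‖ := by
  obtain ⟨hy, hs1, hz⟩ := hw
  have hns : ∀ i, w ≠ a i := fun i => ne_ofReal_of_im_pos hy _
  have hs := sFun_pos hM ha hc hns
  have hB := bFun_pos hM ha hc hns (by rintro rfl; simp at hy)
  set s := sFun a c w
  set b := bFun a c w
  -- The bracket -2s(1 - s) Re w + (1 - 2s)b occurs twice: times Im w it is Im φ, and times b it is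
  -- (1 - s)²|u|² - s²|v|².
  have key : (s * ‖vC a c w‖) ^ 2 < ((1 - s) * ‖uC a c w‖) ^ 2 := by
    rw [mul_pow, mul_pow, ← Complex.normSq_eq_norm_sq, ← Complex.normSq_eq_norm_sq]
    rw [phiC, uC_eq, vC_eq] at hz
    rw [uC_eq, vC_eq]
    simp only [Complex.normSq_apply, Complex.sub_re, Complex.sub_im, Complex.add_re,
      Complex.add_im, Complex.mul_re, Complex.mul_im, Complex.ofReal_re, Complex.ofReal_im,
      Complex.one_re, Complex.one_im, Complex.neg_im] at hz ⊢
    have h2 : 0 < b * (-2 * s * (1 - s) * w.re + (1 - 2 * s) * b) := by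
      refine mul_pos hB ?_
      refine pos_of_mul_pos_left (b := w.im) ?_ hy.le
      refine lt_of_lt_of_eq hz ?_
      ring
    change 0 < _ at h2
    nlinarith [h2]
  have h := lt_of_pow_lt_pow_left₀ 2 (by have := norm_nonneg (uC a c w); nlinarith) key
  linarith

theorem uC_sub_uC {w₁ w₂ : ℂ} (h₁ : ∀ i, w₁ ≠ a i) (h₂ : ∀ i, w₂ ≠ a i) :
    uC a c w₁ - uC a c w₂ = pFun a c w₁ w₂ * (w₁ - w₂) := by
  unfold uC pFun
  rw [← mul_sub, ← Finset.sum_sub_distrib, mul_assoc, Finset.sum_mul]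
  congr 1
  refine Finset.sum_congr rfl fun i _ => ?_
  have e1 : (a i : ℂ) - w₁ ≠ 0 := sub_ne_zero.2 (h₁ i).symm
  have e2 : (a i : ℂ) - w₂ ≠ 0 := sub_ne_zero.2 (h₂ i).symm
  field_simp
  ring

/-- Cauchy–Schwarz for the vectors aᵢ/|aᵢ - w₁| and aᵢ/|aᵢ - w₂|. -/
theorem norm_pFun_sq_le (hc : 0 < c) (w₁ w₂ : ℂ) :
    ‖pFun a c w₁ w₂‖ ^ 2 ≤ sFun a c w₁ * sFun a c w₂ := by
  have h1 : ‖pFun a c w₁ w₂‖ ≤ (c / M) * ∑ i, (|a i| / ‖(a i : ℂ) - w₁‖) * (|a i| / ‖(a i : ℂ) - w₂‖) := by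
    unfold pFun
    rw [norm_mul]
    have : ‖(c / M : ℂ)‖ = c / M := by
      rw [norm_div, Complex.norm_real, Complex.norm_natCast, Real.norm_of_nonneg hc.le]
    rw [this]
    gcongr
    refine (norm_sum_le _ _).trans (Finset.sum_le_sum fun i _ => le_of_eq ?_)
    rw [norm_div, norm_mul, norm_pow, Complex.norm_real, Real.norm_eq_abs]
    ring
  have h2 := Finset.sum_mul_sq_le_sq_mul_sq Finset.univ
    (fun i => |a i| / ‖(a i : ℂ) - w₁‖) (fun i => |a i| / ‖(a i : ℂ) - w₂‖)
  have h3 : ∀ w : ℂ, sFun a c w = (c / M) * ∑ i, (|a i| / ‖(a i : ℂ) - w‖) ^ 2 := by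
    intro w
    unfold sFun
    congr 1
    refine Finset.sum_congr rfl fun i _ => ?_
    rw [div_pow, sq_abs, Complex.normSq_eq_norm_sq]
  rw [h3, h3]
  refine (pow_le_pow_left₀ (norm_nonneg _) h1 2).trans ?_
  have h4 : (0 : ℝ) ≤ (c / M) ^ 2 := by positivity
  calc _ = (c / M) ^ 2 * (∑ i, (|a i| / ‖(a i : ℂ) - w₁‖) * (|a i| / ‖(a i : ℂ) - w₂‖)) ^ 2 := by
        rw [mul_pow]
    _ ≤ (c / M) ^ 2 * _ := mul_le_mul_of_nonneg_left h2 h4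
    _ = _ := by ring

/-- Cauchy–Schwarz for (1, r₁) and (1, r₂). It is used with r = √|φ|/|u|. The two variants below
locate the strictness: in one of the hypotheses, or in r₁ ≠ r₂. -/
theorem mul_one_add_mul_le {p s₁ s₂ r₁ r₂ : ℝ} (hs₁ : 0 ≤ s₁) (hs₂ : 0 ≤ s₂)
    (h₁ : s₁ * (1 + r₁ ^ 2) ≤ 1) (h₂ : s₂ * (1 + r₂ ^ 2) ≤ 1) (hp : p ^ 2 ≤ s₁ * s₂) :
    p * (1 + r₁ * r₂) ≤ 1 := by
  refine (abs_le_one_iff_mul_self_le_one.2 ?_ |> le_of_abs_le)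
  have e1 : (1 + r₁ * r₂) ^ 2 ≤ (1 + r₁ ^ 2) * (1 + r₂ ^ 2) := by nlinarith [sq_nonneg (r₁ - r₂)]
  calc _ = p ^ 2 * (1 + r₁ * r₂) ^ 2 := by ring
    _ ≤ (s₁ * s₂) * ((1 + r₁ ^ 2) * (1 + r₂ ^ 2)) := by gcongr
    _ = (s₁ * (1 + r₁ ^ 2)) * (s₂ * (1 + r₂ ^ 2)) := by ring
    _ ≤ 1 := mul_le_one₀ h₁ (by positivity) h₂

theorem mul_one_add_mul_lt_of_lt {p s₁ s₂ r₁ r₂ : ℝ} (hs₁ : 0 ≤ s₁) (hs₂ : 0 ≤ s₂)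
    (h₁ : s₁ * (1 + r₁ ^ 2) ≤ 1) (h₂ : s₂ * (1 + r₂ ^ 2) < 1) (hp : p ^ 2 ≤ s₁ * s₂) :
    p * (1 + r₁ * r₂) < 1 := by
  refine lt_of_abs_lt (abs_lt_of_sq_lt_sq (by
    have e1 : (1 + r₁ * r₂) ^ 2 ≤ (1 + r₁ ^ 2) * (1 + r₂ ^ 2) := by
      nlinarith [sq_nonneg (r₁ - r₂)]
    calc _ = p ^ 2 * (1 + r₁ * r₂) ^ 2 := by ring
      _ ≤ (s₁ * s₂) * ((1 + r₁ ^ 2) * (1 + r₂ ^ 2)) := by gcongr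
      _ = (s₁ * (1 + r₁ ^ 2)) * (s₂ * (1 + r₂ ^ 2)) := by ring
      _ ≤ 1 * (s₂ * (1 + r₂ ^ 2)) := by gcongr
      _ < 1 ^ 2 := by simpa using h₂) zero_le_one)

theorem mul_one_add_mul_lt_of_ne {p s₁ s₂ r₁ r₂ : ℝ} (hs₁ : 0 < s₁) (hs₂ : 0 < s₂)
    (h₁ : s₁ * (1 + r₁ ^ 2) ≤ 1) (h₂ : s₂ * (1 + r₂ ^ 2) ≤ 1) (hp : p ^ 2 ≤ s₁ * s₂)
    (hr : r₁ ≠ r₂) : p * (1 + r₁ * r₂) < 1 := by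
  refine lt_of_abs_lt (abs_lt_of_sq_lt_sq (by
    have e1 : (1 + r₁ * r₂) ^ 2 < (1 + r₁ ^ 2) * (1 + r₂ ^ 2) := by
      nlinarith [sq_pos_of_ne_zero (sub_ne_zero.2 hr)]
    calc _ = p ^ 2 * (1 + r₁ * r₂) ^ 2 := by ring
      _ ≤ (s₁ * s₂) * (1 + r₁ * r₂) ^ 2 := by gcongr
      _ < (s₁ * s₂) * ((1 + r₁ ^ 2) * (1 + r₂ ^ 2)) := by gcongr
      _ = (s₁ * (1 + r₁ ^ 2)) * (s₂ * (1 + r₂ ^ 2)) := by ring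
      _ ≤ 1 ^ 2 := by simpa using mul_le_one₀ h₁ (by positivity) h₂) zero_le_one)

theorem sFun_nonneg (hc : 0 < c) (w : ℂ) : 0 ≤ sFun a c w := by
  unfold sFun
  have := fun i => Complex.normSq_nonneg (a i - w)
  exact mul_nonneg (by positivity)
    (Finset.sum_nonneg fun i _ => div_nonneg (sq_nonneg _) (this i))

theorem uC_ne_zero_of_phiC_ne_zero {w : ℂ} (h : phiC a c w ≠ 0) : uC a c w ≠ 0 := by
  rintro h'; simp [phiC, h'] at h

/-- For a fixed value of φ the point w is a function of u alone, so equality of u forces equality of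
w. -/
theorem eq_sub_phiC_div {w : ℂ} (h : phiC a c w ≠ 0) :
    w = uC a c w - phiC a c w / uC a c w := by
  have := uC_ne_zero_of_phiC_ne_zero h
  rw [phiC, vC]
  field_simp
  ring

/-- Since |φ| = |u||v|, the ratio |v|/|u| is |φ|/|u|²; this brings the basic inequality to the form
s(1 + r²) ≤ 1. -/
theorem sFun_mul_one_add {w : ℂ} (hz : phiC a c w ≠ 0) :
    sFun a c w * (1 + (√‖phiC a c w‖ / ‖uC a c w‖) ^ 2) =
      sFun a c w * (‖uC a c w‖ + ‖vC a c w‖) / ‖uC a c w‖ := by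
  have hu := norm_ne_zero_iff.2 (uC_ne_zero_of_phiC_ne_zero hz)
  rw [div_pow, Real.sq_sqrt (norm_nonneg _), phiC, norm_neg, norm_mul]
  field_simp

/-- Two points of the closure of the parametrizing set with the same nonzero image under `φ`
coincide, if one of them satisfies the strict inequality. -/
theorem eq_of_phiC_eq (hc : 0 < c) {w₁ w₂ : ℂ} (h₁ : ∀ i, w₁ ≠ a i) (h₂ : ∀ i, w₂ ≠ a i)
    (hz : phiC a c w₂ ≠ 0) (h : phiC a c w₁ = phiC a c w₂)
    (hk₁ : sFun a c w₁ * (‖uC a c w₁‖ + ‖vC a c w₁‖) ≤ ‖uC a c w₁‖)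
    (hk₂ : sFun a c w₂ * (‖uC a c w₂‖ + ‖vC a c w₂‖) < ‖uC a c w₂‖) : w₁ = w₂ := by
  have hz₁ : phiC a c w₁ ≠ 0 := h ▸ hz
  have hu₁ := uC_ne_zero_of_phiC_ne_zero hz₁
  have hu₂ := uC_ne_zero_of_phiC_ne_zero hz
  have e₁ := eq_sub_phiC_div hz₁
  have e₂ := eq_sub_phiC_div hz
  by_contra hne
  have hune : uC a c w₁ - uC a c w₂ ≠ 0 := by
    intro h0
    rw [sub_eq_zero] at h0
    apply hne
    rw [e₁, e₂, h, h0]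
  have hP := uC_sub_uC (c := c) h₁ h₂
  -- Subtracting w = u - z/u at the two points gives w₁ - w₂ = (u₁ - u₂)(1 + z/(u₁u₂)), while u₁ -
  -- u₂ = p(w₁ - w₂).
  have hone : pFun a c w₁ w₂ * (1 + phiC a c w₂ / (uC a c w₁ * uC a c w₂)) = 1 := by
    have hw : w₁ - w₂ = (uC a c w₁ - uC a c w₂) *
        (1 + phiC a c w₂ / (uC a c w₁ * uC a c w₂)) := by
      conv_lhs => rw [e₁, e₂, h]
      field_simp
      ring
    rw [hw] at hP
    apply mul_left_cancel₀ hune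
    rw [mul_one]
    conv_rhs => rw [hP]
    ring
  have hn := congrArg norm hone
  rw [norm_mul, norm_one] at hn
  have h1 := mul_one_add_mul_lt_of_lt (r₁ := √‖phiC a c w₁‖ / ‖uC a c w₁‖)
    (r₂ := √‖phiC a c w₂‖ / ‖uC a c w₂‖) (sFun_nonneg hc w₁) (sFun_nonneg hc w₂)
    (by rw [sFun_mul_one_add hz₁]; exact div_le_one_of_le₀ hk₁ (norm_nonneg _))
    (by rw [sFun_mul_one_add hz]; exact (div_lt_one (norm_pos_iff.2 hu₂)).2 hk₂)
    (norm_pFun_sq_le hc w₁ w₂)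
  have h2 : ‖1 + phiC a c w₂ / (uC a c w₁ * uC a c w₂)‖ ≤
      1 + √‖phiC a c w₁‖ / ‖uC a c w₁‖ * (√‖phiC a c w₂‖ / ‖uC a c w₂‖) := by
    refine (norm_add_le _ _).trans (le_of_eq ?_)
    rw [norm_one, norm_div, norm_mul, h, div_mul_div_comm, Real.mul_self_sqrt (norm_nonneg _)]
  have h3 := mul_le_mul_of_nonneg_left h2 (norm_nonneg (pFun a c w₁ w₂))
  linarith

/-- The derivative of `u`. -/
theorem hasStrictDerivAt_uC {w : ℂ} (hw : ∀ i, w ≠ a i) :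
    HasStrictDerivAt (uC a c) (pFun a c w w) w := by
  unfold uC pFun
  refine HasStrictDerivAt.const_mul _ (HasStrictDerivAt.fun_sum fun i _ => ?_)
  have e1 : (a i : ℂ) - w ≠ 0 := sub_ne_zero.2 (hw i).symm
  have h := ((hasStrictDerivAt_id w).const_mul (a i : ℂ)).div
    ((hasStrictDerivAt_id w).const_sub (a i : ℂ)) e1
  refine h.congr_deriv ?_
  simp only [id]
  field_simp
  ring

theorem hasStrictDerivAt_phiC {w : ℂ} (hw : ∀ i, w ≠ a i) :
    HasStrictDerivAt (phiC a c)
      (pFun a c w w * (uC a c w - vC a c w) - uC a c w) w := by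
  have h := hasStrictDerivAt_uC (c := c) hw
  refine ((h.mul ((hasStrictDerivAt_id w).sub h)).neg).congr_deriv ?_
  simp only [vC, id, Pi.sub_apply]
  ring

theorem norm_pFun_self_le (hc : 0 < c) (w : ℂ) : ‖pFun a c w w‖ ≤ sFun a c w := by
  have h := norm_pFun_sq_le (a := a) hc w w
  rw [← sq] at h
  exact le_of_sq_le_sq h (sFun_nonneg hc w)

/-- A zero would give |u| = |p||u - v| ≤ s(|u| + |v|). -/
theorem deriv_phiC_ne_zero (hc : 0 < c) {w : ℂ}
    (hk : sFun a c w * (‖uC a c w‖ + ‖vC a c w‖) < ‖uC a c w‖) :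
    pFun a c w w * (uC a c w - vC a c w) - uC a c w ≠ 0 := by
  intro h
  rw [sub_eq_zero] at h
  have h1 := congrArg norm h
  rw [norm_mul] at h1
  have h2 := mul_le_mul (norm_pFun_self_le (a := a) hc w) (norm_sub_le (uC a c w) (vC a c w))
    (norm_nonneg _) (sFun_nonneg hc w)
  linarith

end Algebra

/-! ### The inverse of φ on the upper half-plane, and its limit points at the boundary. -/

section Param

variable {M : ℕ} {a : Fin M → ℝ} {c : ℝ}

/-- The properties which pass to the limit from points `w` of the parametrizing set such that
`φ(w)` tends to `z`. -/
structure IsLimitPoint (a : Fin M → ℝ) (c : ℝ) (z w : ℂ) : Prop where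
  ne : ∀ i, w ≠ a i
  im_nonneg : 0 ≤ w.im
  sFun_le : sFun a c w ≤ 1
  phiC_eq : phiC a c w = z
  mul_le : sFun a c w * (‖uC a c w‖ + ‖vC a c w‖) ≤ ‖uC a c w‖

theorem continuousAt_uC {w : ℂ} (hw : ∀ i, w ≠ a i) : ContinuousAt (uC a c) w :=
  (hasStrictDerivAt_uC hw).hasDerivAt.continuousAt

theorem continuousAt_vC {w : ℂ} (hw : ∀ i, w ≠ a i) : ContinuousAt (vC a c) w :=
  continuousAt_id.sub (continuousAt_uC hw)

theorem continuousAt_phiC {w : ℂ} (hw : ∀ i, w ≠ a i) : ContinuousAt (phiC a c) w :=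
  (hasStrictDerivAt_phiC hw).hasDerivAt.continuousAt

theorem continuousAt_sFun {w : ℂ} (hw : ∀ i, w ≠ a i) : ContinuousAt (sFun a c) w := by
  unfold sFun
  refine continuousAt_const.mul (tendsto_finsetSum _ fun i _ => ?_)
  refine ContinuousAt.div continuousAt_const ?_ ?_
  · exact (Complex.continuous_normSq.comp (continuous_const.sub continuous_id)).continuousAt
  · exact (Complex.normSq_pos.2 (sub_ne_zero.2 (hw i).symm)).ne'

/-- Each term of s is below 1, which keeps w at a definite distance from every pole; no limit point
can be an eigenvalue. -/
theorem normSq_sub_gt_of_sFun_lt_one (hc : 0 < c) {w : ℂ}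
    (hw : ∀ i, w ≠ a i) (h : sFun a c w < 1) (i : Fin M) :
    c / M * a i ^ 2 < Complex.normSq (a i - w) := by
  have hp : ∀ j, 0 < Complex.normSq (a j - w) := fun j =>
    Complex.normSq_pos.2 (sub_ne_zero.2 (hw j).symm)
  have h1 : a i ^ 2 / Complex.normSq (a i - w) ≤
      ∑ j, a j ^ 2 / Complex.normSq (a j - w) :=
    Finset.single_le_sum (f := fun j => a j ^ 2 / Complex.normSq (a j - w))
      (fun j _ => div_nonneg (sq_nonneg _) (hp j).le) (Finset.mem_univ i)
  have h2 : c / M * (a i ^ 2 / Complex.normSq (a i - w)) < 1 :=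
    (mul_le_mul_of_nonneg_left h1 (by positivity)).trans_lt h
  rwa [← mul_div_assoc, div_lt_one (hp i)] at h2

theorem uC_add_const {w : ℂ} (hw : ∀ i, w ≠ a i) :
    uC a c w + (c / M : ℂ) * ∑ i, (a i : ℂ) = (c / M : ℂ) * ∑ i, (a i : ℂ) ^ 2 / (a i - w) := by
  unfold uC
  rw [← mul_add, ← Finset.sum_add_distrib]
  congr 1
  refine Finset.sum_congr rfl fun i _ => ?_
  have e1 : (a i : ℂ) - w ≠ 0 := sub_ne_zero.2 (hw i).symm
  field_simp
  ring

/-- Properness of φ. For large w, u is close to the nonzero constant -(c/M) ∑ aᵢ, so |φ| = |u||v|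
bounds v = w - u, hence w. -/
theorem norm_le_of_phiC (hM : 0 < M) (ha : ∀ i, 0 < a i) (hc : 0 < c) {w : ℂ} :
    ‖w‖ ≤ 4 * ∑ i, a i + 3 / 2 * (c / M * ∑ i, a i) +
      2 * ‖phiC a c w‖ / (c / M * ∑ i, a i) := by
  have : Nonempty (Fin M) := ⟨⟨0, hM⟩⟩
  have hσ : 0 < ∑ i, a i := Finset.sum_pos (fun i _ => ha i) Finset.univ_nonempty
  set σ := ∑ i, a i with hσdef
  have hk : 0 < c / M * σ := by positivity
  set k := c / M * σ with hkdef
  have hai : ∀ i, a i ≤ σ := fun i =>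
    Finset.single_le_sum (fun j _ => (ha j).le) (Finset.mem_univ i)
  by_cases hw : ‖w‖ ≤ 4 * σ
  · have : 0 ≤ 2 * ‖phiC a c w‖ / k := by positivity
    linarith
  push Not at hw
  have hw0 : 0 < ‖w‖ := by linarith
  have hns : ∀ i, w ≠ a i := by
    rintro i rfl
    rw [Complex.norm_real, Real.norm_of_nonneg (ha i).le] at hw
    linarith [hai i]
  have hlow : ∀ i, ‖w‖ / 2 ≤ ‖(a i : ℂ) - w‖ := fun i => by
    have := norm_sub_norm_le w (a i : ℂ)
    rw [Complex.norm_real, Real.norm_of_nonneg (ha i).le, norm_sub_rev] at this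
    linarith [hai i]
  have hsum : ‖∑ i, (a i : ℂ) ^ 2 / (a i - w)‖ ≤ σ / 2 := by
    calc _ ≤ ∑ i, a i * (1 / 2) := by
          refine (norm_sum_le _ _).trans (Finset.sum_le_sum fun i _ => ?_)
          have hp : 0 < ‖(a i : ℂ) - w‖ := lt_of_lt_of_le (by positivity) (hlow i)
          rw [norm_div, norm_pow, Complex.norm_real, Real.norm_of_nonneg (ha i).le,
            div_le_iff₀ hp]
          have h1 := hlow i
          have h2 := hai i
          have h3 := ha i
          nlinarith
      _ = σ / 2 := by rw [← Finset.sum_mul]; ring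
  have hu := uC_add_const (c := c) hns
  have hcM : ‖(c / M : ℂ)‖ = c / M := by
    rw [norm_div, Complex.norm_real, Complex.norm_natCast, Real.norm_of_nonneg hc.le]
  have hconst : ‖(c / M : ℂ) * ∑ i, (a i : ℂ)‖ = k := by
    rw [norm_mul, hcM, ← Complex.ofReal_sum, Complex.norm_real, Real.norm_of_nonneg hσ.le]
  have hrem : ‖uC a c w + (c / M : ℂ) * ∑ i, (a i : ℂ)‖ ≤ k / 2 := by
    rw [hu, norm_mul, hcM, hkdef, mul_div_assoc]
    gcongr
  have hu1 : k / 2 ≤ ‖uC a c w‖ := by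
    have := norm_sub_le (uC a c w + (c / M : ℂ) * ∑ i, (a i : ℂ)) (uC a c w)
    rw [add_sub_cancel_left, hconst] at this
    linarith
  have hu2 : ‖uC a c w‖ ≤ 3 / 2 * k := by
    have := norm_sub_le (uC a c w + (c / M : ℂ) * ∑ i, (a i : ℂ)) ((c / M : ℂ) * ∑ i, (a i : ℂ))
    rw [add_sub_cancel_right, hconst] at this
    linarith
  have hv : ‖w‖ - 3 / 2 * k ≤ ‖vC a c w‖ := by
    have := norm_sub_norm_le w (uC a c w)
    rw [vC]; linarith
  have hz : ‖phiC a c w‖ = ‖uC a c w‖ * ‖vC a c w‖ := by rw [phiC, norm_neg, norm_mul]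
  have h4 : ‖vC a c w‖ ≤ 2 * ‖phiC a c w‖ / k := by
    rw [le_div_iff₀ hk, hz]
    nlinarith [norm_nonneg (vC a c w)]
  linarith

/-- A sequence in the parametrizing set along which `φ` converges has a convergent
subsequence. -/
theorem exists_tendsto_subseq (hM : 0 < M) (ha : ∀ i, 0 < a i) (hc : 0 < c) {w : ℕ → ℂ} {z : ℂ}
    (hw : ∀ᶠ n in atTop, w n ∈ omegaSet a c)
    (hz : Tendsto (fun n => phiC a c (w n)) atTop (𝓝 z)) :
    ∃ w₀, ∃ g : ℕ → ℕ, StrictMono g ∧ Tendsto (w ∘ g) atTop (𝓝 w₀) ∧ IsLimitPoint a c z w₀ := by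
  have : Nonempty (Fin M) := ⟨⟨0, hM⟩⟩
  have hσ : 0 < ∑ i, a i := Finset.sum_pos (fun i _ => ha i) Finset.univ_nonempty
  set r := 4 * ∑ i, a i + 3 / 2 * (c / M * ∑ i, a i) + 2 * (‖z‖ + 1) / (c / M * ∑ i, a i)
  have hmem : ∀ᶠ n in atTop, w n ∈ Metric.closedBall (0 : ℂ) r := by
    have h1 : ∀ᶠ n in atTop, ‖phiC a c (w n)‖ < ‖z‖ + 1 :=
      hz.norm.eventually (gt_mem_nhds (lt_add_one _))
    filter_upwards [h1] with n hn
    rw [mem_closedBall_zero_iff]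
    refine (norm_le_of_phiC hM ha hc).trans ?_
    have : 0 < c / M * ∑ i, a i := by positivity
    simp only [r]
    gcongr
  obtain ⟨w₀, -, g, hg, hlim⟩ :=
    (isCompact_closedBall (0 : ℂ) r).tendsto_subseq' hmem.frequently
  have hw' : ∀ᶠ n in atTop, (w ∘ g) n ∈ omegaSet a c := hg.tendsto_atTop.eventually hw
  have hns : ∀ i, w₀ ≠ a i := by
    intro i hi
    have hcont : Tendsto (fun n => Complex.normSq (a i - (w ∘ g) n)) atTop
        (𝓝 (Complex.normSq (a i - w₀))) :=
      (Complex.continuous_normSq.tendsto _).comp (tendsto_const_nhds.sub hlim)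
    have h2 : c / M * a i ^ 2 ≤ Complex.normSq (a i - w₀) := by
      refine ge_of_tendsto hcont ?_
      filter_upwards [hw'] with n hn
      exact (normSq_sub_gt_of_sFun_lt_one hc (fun j => ne_ofReal_of_im_pos hn.1 _) hn.2.1 i).le
    rw [hi, sub_self, map_zero] at h2
    have := ha i
    have : 0 < c / M * a i ^ 2 := by positivity
    linarith
  have hu := (continuousAt_uC (c := c) hns).tendsto.comp hlim
  have hv := (continuousAt_vC (c := c) hns).tendsto.comp hlim
  have hs := (continuousAt_sFun (c := c) hns).tendsto.comp hlim
  refine ⟨w₀, g, hg, hlim, hns, ?_, ?_, ?_, ?_⟩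
  · refine ge_of_tendsto ((Complex.continuous_im.tendsto _).comp hlim) ?_
    filter_upwards [hw'] with n hn using hn.1.le
  · refine le_of_tendsto hs ?_
    filter_upwards [hw'] with n hn using hn.2.1.le
  · exact tendsto_nhds_unique ((continuousAt_phiC (c := c) hns).tendsto.comp hlim)
      (hz.comp hg.tendsto_atTop)
  · refine le_of_tendsto_of_tendsto (hs.mul (hu.norm.add hv.norm)) hu.norm ?_
    filter_upwards [hw'] with n hn using (sFun_mul_lt hM ha hc hn).le

/-- The non-strict conditions become strict: a real w would give a real z, and s = 1 would give u =
w - b, v = b, hence Im z = -b Im w < 0. -/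
theorem IsLimitPoint.mem_omegaSet (hM : 0 < M) (ha : ∀ i, 0 < a i) (hc : 0 < c) {z w : ℂ}
    (hz : 0 < z.im) (h : IsLimitPoint a c z w) : w ∈ omegaSet a c := by
  have him : 0 < w.im := by
    refine lt_of_le_of_ne h.im_nonneg fun h0 => ?_
    have h1 : (uC a c w).im = 0 := by rw [uC_im, ← h0, mul_zero]
    have h2 : (vC a c w).im = 0 := by rw [vC_im, ← h0, mul_zero]
    have h3 := h.phiC_eq ▸ hz
    rw [phiC, Complex.neg_im, Complex.mul_im, h1, h2] at h3
    simp at h3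
  refine ⟨him, lt_of_le_of_ne h.sFun_le fun h1 => ?_, h.phiC_eq ▸ hz⟩
  have hB := bFun_pos hM ha hc h.ne (by rintro rfl; simp at him)
  have h3 := h.phiC_eq ▸ hz
  rw [phiC, vC_eq, uC_eq, h1] at h3
  simp at h3
  nlinarith

theorem isOpen_omegaSet : IsOpen (omegaSet a c) := by
  rw [isOpen_iff_mem_nhds]
  rintro w ⟨h1, h2, h3⟩
  have hns : ∀ i, w ≠ a i := fun _ => ne_ofReal_of_im_pos h1 _
  exact ((Complex.continuous_im.continuousAt).eventually (lt_mem_nhds h1)).and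
    (((continuousAt_sFun hns).eventually (gt_mem_nhds h2)).and
      ((Complex.continuous_im.continuousAt.comp (continuousAt_phiC hns)).eventually
        (lt_mem_nhds h3)))

/-- On the imaginary axis, far enough for s < 1/2, the imaginary part of φ is (1 - 2s) b Im w. -/
theorem omegaSet_nonempty (hM : 0 < M) (ha : ∀ i, 0 < a i) (hc : 0 < c) :
    (omegaSet a c).Nonempty := by
  have : Nonempty (Fin M) := ⟨⟨0, hM⟩⟩
  set k := c / M * ∑ i, a i ^ 2
  have hk : 0 < k := mul_pos (by positivity)
    (Finset.sum_pos (fun i _ => by have := ha i; positivity) Finset.univ_nonempty)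
  set y := √(2 * k + 1)
  have hy : 0 < y := by positivity
  have hy2 : y ^ 2 = 2 * k + 1 := Real.sq_sqrt (by positivity)
  set w : ℂ := y * Complex.I
  have hre : w.re = 0 := by simp [w]
  have him : w.im = y := by simp [w]
  have him' : 0 < w.im := by rw [him]; exact hy
  have hns : ∀ i, w ≠ a i := fun i => ne_ofReal_of_im_pos him' _
  have hs : sFun a c w < 1 / 2 := by
    have h1 : sFun a c w ≤ k / y ^ 2 := by
      simp only [sFun, k]
      rw [mul_div_assoc, Finset.sum_div]
      gcongr with i _
      rw [Complex.normSq_apply]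
      simp only [Complex.sub_re, Complex.ofReal_re, hre, Complex.sub_im, Complex.ofReal_im, him]
      nlinarith [sq_nonneg (a i)]
    refine h1.trans_lt ?_
    rw [hy2, div_lt_iff₀ (by positivity)]
    linarith
  have hB := bFun_pos hM ha hc hns (by rintro h; simp [h] at him')
  refine ⟨w, him', by linarith, ?_⟩
  rw [phiC, uC_eq, vC_eq]
  simp only [Complex.neg_im, Complex.mul_im, Complex.sub_re, Complex.sub_im, Complex.add_re,
    Complex.add_im, Complex.mul_re, Complex.ofReal_re, Complex.ofReal_im, hre, him,
    Complex.one_re, Complex.one_im]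
  have : 0 < (1 - 2 * sFun a c w) * bFun a c w * y := by
    have : 0 < 1 - 2 * sFun a c w := by linarith
    positivity
  linarith

/-- The image is open because φ' ≠ 0, relatively closed by compactness of the preimages, and the
half-plane is connected. -/
theorem im_pos_subset_image (hM : 0 < M) (ha : ∀ i, 0 < a i) (hc : 0 < c) :
    {z : ℂ | 0 < z.im} ⊆ phiC a c '' omegaSet a c := by
  refine IsPreconnected.subset_of_closure_inter_subset ?_ ?_ ?_ ?_
  · exact (convex_halfSpace_im_gt 0).isPreconnected
  · rw [isOpen_iff_mem_nhds]
    rintro _ ⟨w, hw, rfl⟩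
    have hns : ∀ i, w ≠ a i := fun i => ne_ofReal_of_im_pos hw.1 _
    rw [← (hasStrictDerivAt_phiC hns).map_nhds_eq
      (deriv_phiC_ne_zero hc (sFun_mul_lt hM ha hc hw))]
    exact image_mem_map (isOpen_omegaSet.mem_nhds hw)
  · obtain ⟨w, hw⟩ := omegaSet_nonempty hM ha hc
    exact ⟨_, hw.2.2, w, hw, rfl⟩
  · rintro z ⟨hz, him⟩
    obtain ⟨x, hx, hlim⟩ := mem_closure_iff_seq_limit.1 hz
    choose w hw hwx using hx
    obtain ⟨w₀, -, -, -, h⟩ := exists_tendsto_subseq hM ha hc (w := w) (z := z)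
      (Eventually.of_forall hw) (by simpa [hwx] using hlim)
    exact ⟨w₀, h.mem_omegaSet hM ha hc him, h.phiC_eq⟩

open Classical in
/-- The inverse of `φ` on the upper half-plane. -/
def wOf (a : Fin M → ℝ) (c : ℝ) (z : ℂ) : ℂ :=
  if h : ∃ w ∈ omegaSet a c, phiC a c w = z then h.choose else 0

theorem wOf_spec (hM : 0 < M) (ha : ∀ i, 0 < a i) (hc : 0 < c) {z : ℂ} (hz : 0 < z.im) :
    wOf a c z ∈ omegaSet a c ∧ phiC a c (wOf a c z) = z := by
  have h : ∃ w ∈ omegaSet a c, phiC a c w = z := im_pos_subset_image hM ha hc hz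
  rw [wOf, dif_pos h]
  exact h.choose_spec

theorem eq_wOf_of_isLimitPoint (hM : 0 < M) (ha : ∀ i, 0 < a i) (hc : 0 < c) {z w : ℂ}
    (hz : 0 < z.im) (h : IsLimitPoint a c z w) : w = wOf a c z := by
  obtain ⟨h1, h2⟩ := wOf_spec hM ha hc hz
  refine eq_of_phiC_eq hc h.ne (fun i => ne_ofReal_of_im_pos h1.1 _) ?_ ?_ h.mul_le
    (sFun_mul_lt hM ha hc h1)
  · rw [h2]; rintro rfl; simp at hz
  · rw [h2, h.phiC_eq]

theorem isLimitPoint_of_mem (hM : 0 < M) (ha : ∀ i, 0 < a i) (hc : 0 < c) {w : ℂ}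
    (hw : w ∈ omegaSet a c) : IsLimitPoint a c (phiC a c w) w :=
  ⟨fun _ => ne_ofReal_of_im_pos hw.1 _, hw.1.le, hw.2.1.le, rfl, (sFun_mul_lt hM ha hc hw).le⟩

theorem wOf_phiC (hM : 0 < M) (ha : ∀ i, 0 < a i) (hc : 0 < c) {w : ℂ}
    (hw : w ∈ omegaSet a c) : wOf a c (phiC a c w) = w :=
  (eq_wOf_of_isLimitPoint hM ha hc hw.2.2 (isLimitPoint_of_mem hM ha hc hw)).symm

/-- Convergence along the upper half-plane of a function of `(w(z), z)` can be tested on the limit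
points of `w(z)`. -/
theorem tendsto_comp_wOf (hM : 0 < M) (ha : ∀ i, 0 < a i) (hc : 0 < c) {X : Type*}
    [TopologicalSpace X] {F : ℂ × ℂ → X} {z : ℂ} {x : X}
    (h : ∀ w, IsLimitPoint a c z w → MapClusterPt w (𝓝[{ζ | 0 < ζ.im}] z) (wOf a c) →
      Tendsto F (𝓝 (w, z)) (𝓝 x)) :
    Tendsto (fun ζ => F (wOf a c ζ, ζ)) (𝓝[{ζ | 0 < ζ.im}] z) (𝓝 x) := by
  refine tendsto_of_subseq_tendsto fun ζ hζ => ?_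
  have hζ' := tendsto_nhdsWithin_iff.1 hζ
  obtain ⟨w₀, g, hg, hlim, hw₀⟩ := exists_tendsto_subseq hM ha hc (w := fun n => wOf a c (ζ n))
    (z := z) (hζ'.2.mono fun n hn => (wOf_spec hM ha hc hn).1)
    (hζ'.1.congr' (hζ'.2.mono fun n hn => (wOf_spec hM ha hc hn).2.symm))
  refine ⟨g, ?_⟩
  refine (h w₀ hw₀ (MapClusterPt.of_comp (hζ.comp hg.tendsto_atTop)
    hlim.mapClusterPt)).comp ?_
  rw [nhds_prod_eq]
  exact hlim.prodMk (hζ'.1.comp hg.tendsto_atTop)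

theorem exists_isLimitPoint (hM : 0 < M) (ha : ∀ i, 0 < a i) (hc : 0 < c) (x : ℝ) :
    ∃ w, IsLimitPoint a c x w ∧ MapClusterPt w (𝓝[{ζ | 0 < ζ.im}] (x : ℂ)) (wOf a c) := by
  set ζ : ℕ → ℂ := fun n => x + ((1 / ((n : ℝ) + 1) : ℝ) : ℂ) * Complex.I with hζdef
  have him : ∀ n, 0 < (ζ n).im := fun n => by
    simp only [hζdef, Complex.add_im, Complex.ofReal_im, Complex.im_ofReal_mul, Complex.I_im,
      zero_add, mul_one]
    positivity
  have hlim : Tendsto ζ atTop (𝓝 x) := by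
    have h : Tendsto (fun n : ℕ => (((1 / ((n : ℝ) + 1) : ℝ)) : ℂ)) atTop (𝓝 ((0 : ℝ) : ℂ)) :=
      (Complex.continuous_ofReal.tendsto 0).comp tendsto_one_div_add_atTop_nhds_zero_nat
    have h2 := (h.mul_const Complex.I).const_add (x : ℂ)
    simpa [hζdef] using h2
  have hζ : Tendsto ζ atTop (𝓝[{ζ | 0 < ζ.im}] (x : ℂ)) :=
    tendsto_nhdsWithin_iff.2 ⟨hlim, Eventually.of_forall him⟩
  obtain ⟨w₀, g, hg, hlim', hw₀⟩ := exists_tendsto_subseq hM ha hc (w := fun n => wOf a c (ζ n))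
    (z := x) (Eventually.of_forall fun n => (wOf_spec hM ha hc (him n)).1)
    (hlim.congr fun n => (wOf_spec hM ha hc (him n)).2.symm)
  exact ⟨w₀, hw₀, MapClusterPt.of_comp (hζ.comp hg.tendsto_atTop) hlim'.mapClusterPt⟩

theorem isOpen_im_pos : IsOpen {z : ℂ | 0 < z.im} :=
  isOpen_lt continuous_const Complex.continuous_im

theorem continuousAt_wOf (hM : 0 < M) (ha : ∀ i, 0 < a i) (hc : 0 < c) {z : ℂ}
    (hz : 0 < z.im) : ContinuousAt (wOf a c) z := by
  have h := tendsto_comp_wOf hM ha hc (F := fun p => p.1) (z := z) (x := wOf a c z)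
    (fun w hw _ => by
      rw [← eq_wOf_of_isLimitPoint hM ha hc hz hw]
      exact continuous_fst.tendsto _)
  rwa [isOpen_im_pos.nhdsWithin_eq hz] at h

theorem differentiableAt_wOf (hM : 0 < M) (ha : ∀ i, 0 < a i) (hc : 0 < c) {z : ℂ}
    (hz : 0 < z.im) : DifferentiableAt ℂ (wOf a c) z := by
  have h1 := (wOf_spec hM ha hc hz).1
  have hns : ∀ i, wOf a c z ≠ a i := fun i => ne_ofReal_of_im_pos h1.1 _
  refine (HasDerivAt.of_local_left_inverse (continuousAt_wOf hM ha hc hz)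
    (hasStrictDerivAt_phiC hns).hasDerivAt
    (deriv_phiC_ne_zero hc (sFun_mul_lt hM ha hc h1)) ?_).differentiableAt
  filter_upwards [isOpen_im_pos.mem_nhds hz] with ζ hζ using (wOf_spec hM ha hc hζ).2

/-- The complex version of `m`. -/
def mC (a : Fin M → ℝ) (w : ℂ) : ℂ := (1 / M : ℂ) * ∑ i, a i / (a i - w)

theorem uC_eq_mC (w : ℂ) : uC a c w = c * (w * mC a w) := by
  rw [uC, mC, Finset.mul_sum, Finset.mul_sum, Finset.mul_sum, Finset.mul_sum]
  refine Finset.sum_congr rfl fun i _ => ?_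
  ring

theorem differentiableAt_mC {w : ℂ} (hw : ∀ i, w ≠ a i) : DifferentiableAt ℂ (mC a) w := by
  unfold mC
  refine DifferentiableAt.const_mul (DifferentiableAt.fun_sum fun i _ => ?_) _
  refine DifferentiableAt.div (by fun_prop) (by fun_prop) (sub_ne_zero.2 (hw i).symm)

theorem mC_im (w : ℂ) : (mC a w).im = w.im * ((1 / M) * ∑ i, a i / Complex.normSq (a i - w)) := by
  have h : ∀ i, ((a i : ℂ) / (a i - w)).im = w.im * (a i / Complex.normSq (a i - w)) := by
    intro i
    rw [Complex.div_im]
    simp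
    ring
  rw [mC, show (1 / M : ℂ) = ((1 / M : ℝ) : ℂ) by push_cast; rfl, Complex.im_ofReal_mul,
    Complex.im_sum]
  simp_rw [h]
  rw [← Finset.mul_sum]
  ring

/-- The separation from the poles bounds m and u uniformly on the parametrizing set, which supplies
the decay required by the Herglotz representation. -/
theorem norm_div_sub_le (ha : ∀ i, 0 < a i) (hc : 0 < c) (hM : 0 < M) {w : ℂ}
    (hw : w ∈ omegaSet a c) (i : Fin M) : ‖(a i : ℂ) / (a i - w)‖ ≤ 1 / √(c / M) := by
  have hk : 0 < √(c / M) := by positivity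
  have h1 := normSq_sub_gt_of_sFun_lt_one hc (fun j => ne_ofReal_of_im_pos hw.1 _) hw.2.1 i
  have h2 : √(c / M) * a i ≤ ‖(a i : ℂ) - w‖ := by
    refine le_of_sq_le_sq ?_ (norm_nonneg _)
    rw [← Complex.normSq_eq_norm_sq, mul_pow, Real.sq_sqrt (by positivity)]
    exact h1.le
  have h3 := ha i
  rw [norm_div, Complex.norm_real, Real.norm_of_nonneg h3.le,
    div_le_div_iff₀ (lt_of_lt_of_le (by positivity) h2) hk]
  linarith

theorem norm_mC_le (ha : ∀ i, 0 < a i) (hc : 0 < c) (hM : 0 < M) {w : ℂ}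
    (hw : w ∈ omegaSet a c) : ‖mC a w‖ ≤ 1 / √(c / M) := by
  rw [mC, norm_mul]
  calc _ ≤ ‖(1 / M : ℂ)‖ * ∑ _i : Fin M, 1 / √(c / M) := by
        gcongr
        exact (norm_sum_le _ _).trans (Finset.sum_le_sum fun i _ => norm_div_sub_le ha hc hM hw i)
    _ = _ := by
        have : (M : ℝ) ≠ 0 := by positivity
        simp
        field_simp

theorem norm_uC_le (ha : ∀ i, 0 < a i) (hc : 0 < c) (hM : 0 < M) {w : ℂ}
    (hw : w ∈ omegaSet a c) : ‖uC a c w‖ ≤ (c / M) * ∑ i, a i * (1 + 1 / √(c / M)) := by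
  have hk : 0 < √(c / M) := by positivity
  have h : ∀ i, ‖(a i : ℂ) * w / (a i - w)‖ ≤ a i * (1 + 1 / √(c / M)) := by
    intro i
    have hns : (a i : ℂ) - w ≠ 0 := sub_ne_zero.2 (ne_ofReal_of_im_pos hw.1 _).symm
    have h3 := ha i
    have e : (a i : ℂ) * w / (a i - w) = a i * (-1 + a i / (a i - w)) := by
      field_simp; ring
    rw [e, norm_mul, Complex.norm_real, Real.norm_of_nonneg h3.le]
    gcongr
    refine (norm_add_le _ _).trans ?_
    rw [norm_neg, norm_one]
    exact add_le_add_right (norm_div_sub_le ha hc hM hw i) 1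
  rw [uC, norm_mul, norm_div, Complex.norm_real, Complex.norm_natCast, Real.norm_of_nonneg hc.le]
  gcongr
  exact (norm_sum_le _ _).trans (Finset.sum_le_sum fun i _ => h i)

end Param

/-! ### From the matrix equation to the scalar parametrization. -/

section Matrices

variable {M : ℕ} {R : Matrix (Fin M) (Fin M) ℂ} {c : ℝ}

theorem affine_eq_conj (hR : R.IsHermitian) (α β : ℂ) :
    α • (1 : Matrix (Fin M) (Fin M) ℂ) + β • R =
      (hR.eigenvectorUnitary : Matrix (Fin M) (Fin M) ℂ) *
        Matrix.diagonal (fun i => α + β * hR.eigenvalues i) *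
        star (hR.eigenvectorUnitary : Matrix (Fin M) (Fin M) ℂ) := by
  have h1 : Matrix.diagonal (fun i => α + β * (hR.eigenvalues i : ℂ)) =
      α • (1 : Matrix (Fin M) (Fin M) ℂ) +
        β • Matrix.diagonal (RCLike.ofReal ∘ hR.eigenvalues : Fin M → ℂ) := by
    ext i j
    by_cases hij : i = j
    · subst hij; simp
    · simp [hij]
  have h2 : (hR.eigenvectorUnitary : Matrix (Fin M) (Fin M) ℂ) *
      star (hR.eigenvectorUnitary : Matrix (Fin M) (Fin M) ℂ) = 1 :=
    Unitary.coe_mul_star_self _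
  rw [h1, Matrix.mul_add, Matrix.add_mul]
  simp only [Matrix.mul_smul, Matrix.smul_mul, Matrix.mul_one, h2]
  congr 2
  conv_lhs => rw [hR.spectral_theorem, Unitary.conjStarAlgAut_apply]

theorem affine_inv_eq (hR : R.IsHermitian) {α β : ℂ} (h : ∀ i, α + β * hR.eigenvalues i ≠ 0) :
    (α • (1 : Matrix (Fin M) (Fin M) ℂ) + β • R)⁻¹ =
      (hR.eigenvectorUnitary : Matrix (Fin M) (Fin M) ℂ) *
        Matrix.diagonal (fun i => (α + β * hR.eigenvalues i)⁻¹) *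
        star (hR.eigenvectorUnitary : Matrix (Fin M) (Fin M) ℂ) := by
  set U := (hR.eigenvectorUnitary : Matrix (Fin M) (Fin M) ℂ)
  have h2 : U * star U = 1 := Unitary.coe_mul_star_self _
  have h3 : star U * U = 1 := Unitary.coe_star_mul_self _
  apply Matrix.inv_eq_right_inv
  rw [affine_eq_conj hR]
  calc _ = U * Matrix.diagonal (fun i => α + β * (hR.eigenvalues i : ℂ)) * (star U * U) *
        Matrix.diagonal (fun i => (α + β * (hR.eigenvalues i : ℂ))⁻¹) * star U := by
        simp only [Matrix.mul_assoc, U]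
    _ = U * (Matrix.diagonal (fun i => α + β * (hR.eigenvalues i : ℂ)) *
        Matrix.diagonal (fun i => (α + β * (hR.eigenvalues i : ℂ))⁻¹)) * star U := by
        rw [h3]; simp only [Matrix.mul_assoc, Matrix.one_mul]
    _ = 1 := by
        rw [Matrix.diagonal_mul_diagonal]
        simp_rw [mul_inv_cancel₀ (h _)]
        simp [h2]

/-- The default value of the inverse of a singular matrix; it is used to show that canonical
solutions never meet this case and to compute m at an eigenvalue. -/
theorem affine_inv_eq_zero (hR : R.IsHermitian) {α β : ℂ} {i : Fin M}
    (h : α + β * hR.eigenvalues i = 0) :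
    (α • (1 : Matrix (Fin M) (Fin M) ℂ) + β • R)⁻¹ = 0 := by
  apply Matrix.nonsing_inv_apply_not_isUnit
  rw [affine_eq_conj hR, Matrix.det_mul, Matrix.det_mul, Matrix.det_diagonal,
    Finset.prod_eq_zero (Finset.mem_univ i) h]
  simp

theorem trace_affine_inv (hR : R.IsHermitian) {α β : ℂ}
    (h : ∀ i, α + β * hR.eigenvalues i ≠ 0) :
    ((α • (1 : Matrix (Fin M) (Fin M) ℂ) + β • R)⁻¹).trace =
      ∑ i, (α + β * hR.eigenvalues i)⁻¹ := by
  rw [affine_inv_eq hR h, Matrix.trace_mul_comm, ← Matrix.mul_assoc, Unitary.coe_star_mul_self,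
    Matrix.one_mul, Matrix.trace_diagonal]

theorem trace_mul_affine_inv (hR : R.IsHermitian) {α β : ℂ}
    (h : ∀ i, α + β * hR.eigenvalues i ≠ 0) :
    (R * (α • (1 : Matrix (Fin M) (Fin M) ℂ) + β • R)⁻¹).trace =
      ∑ i, hR.eigenvalues i / (α + β * hR.eigenvalues i) := by
  set U := (hR.eigenvectorUnitary : Matrix (Fin M) (Fin M) ℂ)
  have h3 : star U * U = 1 := Unitary.coe_star_mul_self _
  have hR' := affine_eq_conj hR 0 1
  simp only [zero_smul, one_smul, zero_add, one_mul] at hR'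
  rw [affine_inv_eq hR h]
  conv_lhs => enter [1, 1]; rw [hR']
  calc _ = (U * (Matrix.diagonal (fun i => (hR.eigenvalues i : ℂ)) * (star U * U) *
        Matrix.diagonal (fun i => (α + β * (hR.eigenvalues i : ℂ))⁻¹) * star U)).trace := by
        simp only [Matrix.mul_assoc, U]
    _ = _ := by
        rw [h3, Matrix.mul_one, Matrix.trace_mul_comm, Matrix.mul_assoc, Matrix.mul_assoc, h3,
          Matrix.mul_one, Matrix.diagonal_mul_diagonal, Matrix.trace_diagonal]
        simp only [div_eq_mul_inv]

theorem mFun_of_ne (hR : R.IsHermitian) {w : ℝ} (hw : ∀ i, w ≠ hR.eigenvalues i) :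
    mFun R w = (1 / M) * ∑ i, hR.eigenvalues i / (hR.eigenvalues i - w) := by
  have e : R - (w : ℂ) • (1 : Matrix (Fin M) (Fin M) ℂ) =
      (-w : ℂ) • (1 : Matrix (Fin M) (Fin M) ℂ) + (1 : ℂ) • R := by
    rw [neg_smul, one_smul]; abel
  rw [mFun, e, trace_mul_affine_inv hR]
  · have : ∑ i, (hR.eigenvalues i : ℂ) / (-w + 1 * hR.eigenvalues i) =
        ((∑ i, hR.eigenvalues i / (hR.eigenvalues i - w) : ℝ) : ℂ) := by
      push_cast
      refine Finset.sum_congr rfl fun i _ => ?_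
      congr 1; ring
    rw [this, Complex.ofReal_re]; ring
  · intro i h
    apply hw i
    have : (w : ℂ) = hR.eigenvalues i := by linear_combination -h
    exact_mod_cast this

theorem mFun_eigenvalue (hR : R.IsHermitian) (i : Fin M) : mFun R (hR.eigenvalues i) = 0 := by
  have e : R - (hR.eigenvalues i : ℂ) • (1 : Matrix (Fin M) (Fin M) ℂ) =
      (-hR.eigenvalues i : ℂ) • (1 : Matrix (Fin M) (Fin M) ℂ) + (1 : ℂ) • R := by
    rw [neg_smul, one_smul]; abel
  rw [mFun, e, affine_inv_eq_zero hR (i := i) (by ring)]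
  simp

theorem resolventT_eq_affine (z t : ℂ) :
    resolventT R c z t = ((-z) • (1 : Matrix (Fin M) (Fin M) ℂ) +
      (-((z * c * t) / (1 - z * c ^ 2 * t ^ 2))) • R)⁻¹ := by
  rw [resolventT, neg_smul, neg_smul, sub_eq_add_neg]

/-- With denominator -z + (z/w)λ = z(λ - w)/w the resolvent is (w/z)(R - w)⁻¹. -/
theorem trace_mul_param (hR : R.IsHermitian) {z w : ℂ} (hz : z ≠ 0) (hw0 : w ≠ 0)
    (hw : ∀ i, w ≠ hR.eigenvalues i) :
    (1 / M : ℂ) * (R * ((-z) • (1 : Matrix (Fin M) (Fin M) ℂ) + (z / w) • R)⁻¹).trace =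
      w * mC hR.eigenvalues w / z := by
  have hne : ∀ i, (hR.eigenvalues i : ℂ) - w ≠ 0 := fun i => sub_ne_zero.2 (hw i).symm
  have e : ∀ i, -z + z / w * hR.eigenvalues i = z * (hR.eigenvalues i - w) / w := fun i => by
    field_simp; ring
  rw [trace_mul_affine_inv hR, mC, Finset.mul_sum, Finset.mul_sum, Finset.mul_sum, Finset.sum_div]
  · refine Finset.sum_congr rfl fun i _ => ?_
    rw [e]
    have := hne i
    field_simp
  · intro i
    rw [e]
    exact div_ne_zero (mul_ne_zero hz (hne i)) hw0

theorem trace_param (hM : 0 < M) (hR : R.IsHermitian) {z w : ℂ} (hz : z ≠ 0) (hw0 : w ≠ 0)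
    (hw : ∀ i, w ≠ hR.eigenvalues i) :
    (1 / M : ℂ) * ((-z) • (1 : Matrix (Fin M) (Fin M) ℂ) + (z / w) • R)⁻¹.trace =
      (mC hR.eigenvalues w - 1) / z := by
  have hne : ∀ i, (hR.eigenvalues i : ℂ) - w ≠ 0 := fun i => sub_ne_zero.2 (hw i).symm
  have hM' : (M : ℂ) ≠ 0 := by exact_mod_cast hM.ne'
  have e : ∀ i, -z + z / w * hR.eigenvalues i = z * (hR.eigenvalues i - w) / w := fun i => by
    field_simp; ring
  have h1 : (1 : ℂ) = (1 / M : ℂ) * ∑ _i : Fin M, 1 := by simp [hM']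
  rw [trace_affine_inv hR, mC]
  · conv_rhs => enter [1, 2]; rw [h1]
    rw [← mul_sub, ← Finset.sum_sub_distrib, mul_div_assoc, Finset.sum_div]
    congr 1
    refine Finset.sum_congr rfl fun i _ => ?_
    rw [e]
    have := hne i
    field_simp
    ring
  · intro i
    rw [e]
    exact div_ne_zero (mul_ne_zero hz (hne i)) hw0

/-- A canonical solution comes from a point of the parametrizing set. -/
theorem IsCanonicalSolution.exists_param (hM : 0 < M) (hR : R.IsHermitian) (hc : 0 < c) {z t : ℂ}
    (hzim : 0 < z.im) (h : IsCanonicalSolution R c z t) :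
    ∃ w ∈ omegaSet hR.eigenvalues c, phiC hR.eigenvalues c w = z ∧
      t = w * mC hR.eigenvalues w / z ∧
      (1 / M : ℂ) * (resolventT R c z t).trace = (mC hR.eigenvalues w - 1) / z := by
  have ht0 : t ≠ 0 := by rintro rfl; simpa using h.im_pos
  have hz0 : z ≠ 0 := by rintro rfl; simpa using h.im_mul_pos
  have hc0 : (c : ℂ) ≠ 0 := by exact_mod_cast hc.ne'
  have heq := h.eqn
  set X := (z * c * t) / (1 - z * c ^ 2 * t ^ 2) with hX
  rw [resolventT_eq_affine, ← hX] at heq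
  have hreg : ∀ i, -z + -X * hR.eigenvalues i ≠ 0 := by
    intro i hi
    rw [affine_inv_eq_zero hR hi] at heq
    simp at heq
    exact ht0 heq
  -- Division by zero returns 0, so a vanishing denominator would make the coefficient of R zero and
  -- z t real.
  have hD : 1 - z * c ^ 2 * t ^ 2 ≠ 0 := by
    intro hD
    have hX0 : X = 0 := by rw [hX, hD, div_zero]
    rw [trace_mul_affine_inv hR hreg, hX0] at heq
    have h1 : z * t = ((-(1 / M) * ∑ i, hR.eigenvalues i : ℝ) : ℂ) := by
      conv_lhs => rw [heq]
      push_cast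
      rw [Finset.mul_sum, Finset.mul_sum, Finset.mul_sum]
      refine Finset.sum_congr rfl fun i _ => ?_
      rw [neg_zero, zero_mul, add_zero]
      field_simp
    have h2 := h.im_mul_pos
    rw [h1, Complex.ofReal_im] at h2
    exact lt_irrefl _ h2
  -- This is u + v with u = c z t and v = -1/(c t), whose product is -z.
  set w := c * (z * t) - 1 / (c * t) with hw
  have hwD : w = -(1 - z * c ^ 2 * t ^ 2) / (c * t) := by
    rw [hw]; field_simp; ring
  have hw0 : w ≠ 0 := by
    rw [hwD]; exact div_ne_zero (neg_ne_zero.2 hD) (mul_ne_zero hc0 ht0)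
  have hXw : -X = z / w := by
    rw [hX, hwD]
    field_simp
  have hns : ∀ i, w ≠ hR.eigenvalues i := by
    intro i hi
    apply hreg i
    rw [hXw, ← hi]
    field_simp
    ring
  have hu : uC hR.eigenvalues c w = c * (z * t) := by
    rw [hXw, trace_mul_param hR hz0 hw0 hns] at heq
    rw [uC_eq_mC, heq]
    field_simp
  have hv : vC hR.eigenvalues c w = -(1 / (c * t)) := by
    rw [vC, hu, hw]; ring
  have hφ : phiC hR.eigenvalues c w = z := by
    rw [phiC, hu, hv]; field_simp
  have huim : 0 < (uC hR.eigenvalues c w).im := by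
    rw [hu, Complex.im_ofReal_mul]
    exact mul_pos hc h.im_mul_pos
  have hvim : 0 < (vC hR.eigenvalues c w).im := by
    have : -(1 / (c * t)) = ((1 / c : ℝ) : ℂ) * (-(t⁻¹)) := by
      push_cast; field_simp
    rw [hv, this, Complex.im_ofReal_mul, Complex.neg_im, Complex.inv_im]
    have h1 := h.im_pos
    have h2 : 0 < Complex.normSq t := Complex.normSq_pos.2 ht0
    rw [neg_div, neg_neg]
    positivity
  have hwim : 0 < w.im := by
    rw [← uC_add_vC (a := hR.eigenvalues) (c := c) w, Complex.add_im]
    exact add_pos huim hvim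
  rw [vC_im] at hvim
  refine ⟨w, ⟨hwim, ?_, ?_⟩, hφ, ?_, ?_⟩
  · have := pos_of_mul_pos_left hvim hwim.le
    linarith
  · rwa [hφ]
  · rw [hXw, trace_mul_param hR hz0 hw0 hns] at heq
    exact heq
  · rw [resolventT_eq_affine, ← hX, hXw, trace_param hM hR hz0 hw0 hns]

/-- A point of the parametrizing set gives a canonical solution. -/
theorem isCanonicalSolution_of_mem (hM : 0 < M) (hR : R.PosDef) (hc : 0 < c) {w : ℂ}
    (hw : w ∈ omegaSet hR.isHermitian.eigenvalues c) :
    IsCanonicalSolution R c (phiC hR.isHermitian.eigenvalues c w)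
      (w * mC hR.isHermitian.eigenvalues w / phiC hR.isHermitian.eigenvalues c w) := by
  set a := hR.isHermitian.eigenvalues with ha
  have hapos : ∀ i, 0 < a i := hR.eigenvalues_pos
  have hns : ∀ i, w ≠ a i := fun _ => ne_ofReal_of_im_pos hw.1 _
  have hw0 : w ≠ 0 := by rintro rfl; simpa using hw.1
  have hc0 : (c : ℂ) ≠ 0 := by exact_mod_cast hc.ne'
  have hz0 : phiC a c w ≠ 0 := by intro h; simpa [h] using hw.2.2
  have hu0 := uC_ne_zero_of_phiC_ne_zero hz0
  have hv0 : vC a c w ≠ 0 := by rintro h; simp [phiC, h] at hz0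
  have hs := sFun_pos hM hapos hc hns
  have hmu : w * mC a w = uC a c w / c := by rw [uC_eq_mC]; field_simp
  have ht : w * mC a w / phiC a c w = -(1 / (c * vC a c w)) := by
    rw [hmu, phiC]; field_simp
  have hX : -((phiC a c w * c * (w * mC a w / phiC a c w)) /
      (1 - phiC a c w * c ^ 2 * (w * mC a w / phiC a c w) ^ 2)) = phiC a c w / w := by
    have h1 : 1 - phiC a c w * c ^ 2 * (w * mC a w / phiC a c w) ^ 2 = w / vC a c w := by
      have h2 : w = uC a c w + vC a c w := (uC_add_vC w).symm
      rw [ht, eq_div_iff hv0]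
      conv_rhs => rw [h2]
      rw [phiC]
      field_simp
      ring
    rw [h1, hmu]
    rw [phiC] at hz0 ⊢
    field_simp
  refine ⟨?_, ?_, ?_⟩
  · rw [resolventT_eq_affine, hX, trace_mul_param hR.isHermitian hz0 hw0 hns]
  · have : -(1 / (c * vC a c w)) = ((1 / c : ℝ) : ℂ) * (-((vC a c w)⁻¹)) := by
      push_cast; field_simp
    rw [ht, this, Complex.im_ofReal_mul, Complex.neg_im, Complex.inv_im, neg_div, neg_neg, vC_im]
    have h1 := hw.1
    have h2 : 0 < Complex.normSq (vC a c w) := Complex.normSq_pos.2 hv0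
    have h3 : 0 < 1 - sFun a c w := by linarith [hw.2.1]
    positivity
  · have : phiC a c w * (w * mC a w / phiC a c w) = ((1 / c : ℝ) : ℂ) * uC a c w := by
      rw [hmu]; push_cast; field_simp
    rw [this, Complex.im_ofReal_mul, uC_im]
    have h1 := hw.1
    positivity

end Matrices

/-! ### φ on the real line: derivatives and monotonicity across the poles. -/

section RealCalculus

variable {M : ℕ} (a : Fin M → ℝ) (c : ℝ)

/-- The real version of `m`. -/
def mR (w : ℝ) : ℝ := (1 / M) * ∑ i, a i / (a i - w)

/-- `u(w) = c w m(w)` for real `w`. -/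
def uR (w : ℝ) : ℝ := (c / M) * ∑ i, a i * w / (a i - w)

/-- `v(w) = w - u(w)` for real `w`. -/
def vR (w : ℝ) : ℝ := w - uR a c w

/-- `φ = -u v` for real `w`. -/
def phiR (w : ℝ) : ℝ := -(uR a c w * vR a c w)

/-- `(c/M) ∑ aᵢ² / (aᵢ - w)ᵏ`. -/
def powSum (k : ℕ) (w : ℝ) : ℝ := (c / M) * ∑ i, a i ^ 2 / (a i - w) ^ k

/-- The derivative of `φ`. -/
def phiDeriv (w : ℝ) : ℝ := powSum a c 2 w * (2 * uR a c w - w) - uR a c w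

/-- The second derivative of `φ`. -/
def phiDerivTwo (w : ℝ) : ℝ :=
  2 * powSum a c 3 w * (2 * uR a c w - w) + 2 * powSum a c 2 w ^ 2 - 2 * powSum a c 2 w

/-- The third derivative of `φ`. -/
def phiDerivThree (w : ℝ) : ℝ :=
  6 * powSum a c 4 w * (2 * uR a c w - w) + 12 * powSum a c 2 w * powSum a c 3 w -
    6 * powSum a c 3 w

/-- The real points where `u < 0 < v`. -/
structure Good (w : ℝ) : Prop where
  ne : ∀ i, w ≠ a i
  u_neg : uR a c w < 0
  v_pos : 0 < vR a c w

variable {a c}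

theorem uR_eq_mR (w : ℝ) : uR a c w = c * w * mR a w := by
  rw [uR, mR, Finset.mul_sum, Finset.mul_sum, Finset.mul_sum]
  refine Finset.sum_congr rfl fun i _ => ?_
  ring

theorem vR_eq_mR (w : ℝ) : vR a c w = w * (1 - c * mR a w) := by
  rw [vR, uR_eq_mR]; ring

theorem phiR_eq_mR (w : ℝ) : phiR a c w = c * w ^ 2 * mR a w * (c * mR a w - 1) := by
  rw [phiR, uR_eq_mR, vR_eq_mR]; ring

theorem uC_ofReal (w : ℝ) : uC a c w = uR a c w := by
  simp [uC, uR]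

theorem vC_ofReal (w : ℝ) : vC a c w = vR a c w := by
  simp [vC, vR, uC_ofReal]

theorem phiC_ofReal (w : ℝ) : phiC a c w = phiR a c w := by
  simp [phiC, phiR, uC_ofReal, vC_ofReal]

theorem mC_ofReal (w : ℝ) : mC a w = mR a w := by
  simp [mC, mR]

theorem sFun_ofReal (w : ℝ) : sFun a c w = powSum a c 2 w := by
  unfold sFun powSum
  congr 1
  refine Finset.sum_congr rfl fun i _ => ?_
  rw [← Complex.ofReal_sub, Complex.normSq_ofReal, sq (a i - w)]

theorem pFun_ofReal_self (w : ℝ) : pFun a c w w = powSum a c 2 w := by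
  simp [pFun, powSum, sq]

theorem sub_ne_zero_of_ne_eigenvalue {w : ℝ} (hw : ∀ i, w ≠ a i) (i : Fin M) : a i - w ≠ 0 :=
  sub_ne_zero.2 (hw i).symm

theorem eventually_ne_eigenvalue {w : ℝ} (hw : ∀ i, w ≠ a i) : ∀ᶠ x in 𝓝 w, ∀ i, x ≠ a i := by
  rw [eventually_all]
  exact fun i => isOpen_ne.mem_nhds (hw i)

theorem hasDerivAt_uR {w : ℝ} (hw : ∀ i, w ≠ a i) :
    HasDerivAt (uR a c) (powSum a c 2 w) w := by
  unfold uR powSum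
  refine HasDerivAt.const_mul _ (HasDerivAt.fun_sum fun i _ => ?_)
  have e1 := sub_ne_zero_of_ne_eigenvalue hw i
  refine (((hasDerivAt_id w).const_mul (a i)).div
    ((hasDerivAt_id w).const_sub (a i)) e1).congr_deriv ?_
  simp only [id]
  field_simp
  ring

theorem hasDerivAt_powSum (k : ℕ) {w : ℝ} (hw : ∀ i, w ≠ a i) :
    HasDerivAt (powSum a c k) (k * powSum a c (k + 1) w) w := by
  have h : HasDerivAt (powSum a c k)
      ((c / M) * ∑ i, k * (a i ^ 2 / (a i - w) ^ (k + 1))) w := by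
    unfold powSum
    refine HasDerivAt.const_mul _ (HasDerivAt.fun_sum fun i _ => ?_)
    have e1 := sub_ne_zero_of_ne_eigenvalue hw i
    refine ((hasDerivAt_const w (a i ^ 2)).div
      (((hasDerivAt_id w).const_sub (a i)).pow k) (pow_ne_zero k e1)).congr_deriv ?_
    rcases k with _ | k
    · simp
    · simp only [id, Nat.add_sub_cancel, Pi.pow_apply]
      field_simp
      ring
  refine h.congr_deriv ?_
  rw [powSum, ← Finset.mul_sum]
  ring

theorem hasDerivAt_phiR {w : ℝ} (hw : ∀ i, w ≠ a i) :
    HasDerivAt (phiR a c) (phiDeriv a c w) w := by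
  have h := hasDerivAt_uR (c := c) hw
  refine ((h.mul ((hasDerivAt_id w).sub h)).neg).congr_deriv ?_
  simp only [phiDeriv, id, Pi.sub_apply]
  ring

theorem hasDerivAt_phiDeriv {w : ℝ} (hw : ∀ i, w ≠ a i) :
    HasDerivAt (phiDeriv a c) (phiDerivTwo a c w) w := by
  have h := hasDerivAt_uR (c := c) hw
  have h2 := hasDerivAt_powSum (c := c) 2 hw
  refine ((h2.mul ((h.const_mul 2).sub (hasDerivAt_id w))).sub h).congr_deriv ?_
  simp only [phiDerivTwo, id, Pi.sub_apply]
  push_cast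
  ring

theorem hasDerivAt_phiDerivTwo {w : ℝ} (hw : ∀ i, w ≠ a i) :
    HasDerivAt (phiDerivTwo a c) (phiDerivThree a c w) w := by
  have h := hasDerivAt_uR (c := c) hw
  have h2 := hasDerivAt_powSum (c := c) 2 hw
  have h3 := hasDerivAt_powSum (c := c) 3 hw
  refine ((((h3.const_mul 2).mul ((h.const_mul 2).sub (hasDerivAt_id w))).add
    ((h2.pow 2).const_mul 2)).sub (h2.const_mul 2)).congr_deriv ?_
  simp only [phiDerivThree, id, Pi.sub_apply]
  push_cast
  ring

theorem phiDeriv_eq (w : ℝ) :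
    phiDeriv a c w = powSum a c 2 w * (uR a c w - vR a c w) - uR a c w := by
  rw [phiDeriv, vR]; ring

theorem powSum_two_pos (hM : 0 < M) (ha : ∀ i, 0 < a i) (hc : 0 < c) {w : ℝ}
    (hw : ∀ i, w ≠ a i) : 0 < powSum a c 2 w := by
  rw [← sFun_ofReal]
  exact sFun_pos hM ha hc fun i => by exact_mod_cast hw i

theorem Good.phiR_pos {w : ℝ} (h : Good a c w) : 0 < phiR a c w := by
  have := mul_neg_of_neg_of_pos h.u_neg h.v_pos
  rw [phiR]; linarith

/-- Here |u| = -u and |v| = v, so the basic inequality reads s(v - u) < -u, which is positivity of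
φ' = s(u - v) - u. -/
theorem Good.mul_lt_iff {w : ℝ} (h : Good a c w) :
    sFun a c w * (‖uC a c w‖ + ‖vC a c w‖) < ‖uC a c w‖ ↔ 0 < phiDeriv a c w := by
  rw [uC_ofReal, vC_ofReal, Complex.norm_real, Complex.norm_real, Real.norm_of_nonpos h.u_neg.le,
    Real.norm_of_nonneg h.v_pos.le, sFun_ofReal, phiDeriv_eq]
  constructor <;> intro h <;> linarith

/-- `φ` is strictly increasing on the set of good points where its derivative is nonnegative. -/
theorem phiR_lt_phiR (hM : 0 < M) (ha : ∀ i, 0 < a i) (hc : 0 < c) {w₁ w₂ : ℝ}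
    (h₁ : Good a c w₁) (h₂ : Good a c w₂) (hd₁ : 0 ≤ phiDeriv a c w₁) (hd₂ : 0 ≤ phiDeriv a c w₂)
    (hlt : w₁ < w₂) : phiR a c w₁ < phiR a c w₂ := by
  set x₁ := phiR a c w₁ with hx₁
  set x₂ := phiR a c w₂ with hx₂
  have hp₁ : 0 < x₁ := h₁.phiR_pos
  have hp₂ : 0 < x₂ := h₂.phiR_pos
  set u₁ := uR a c w₁ with hu₁
  set u₂ := uR a c w₂ with hu₂
  have hn₁ : u₁ < 0 := h₁.u_neg
  have hn₂ : u₂ < 0 := h₂.u_neg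
  set p := (c / M) * ∑ i, a i ^ 2 / ((a i - w₁) * (a i - w₂)) with hp
  have hpC : pFun a c w₁ w₂ = p := by simp [pFun, hp]
  have hpsq : p ^ 2 ≤ powSum a c 2 w₁ * powSum a c 2 w₂ := by
    have := norm_pFun_sq_le (a := a) hc w₁ w₂
    rwa [hpC, Complex.norm_real, Real.norm_eq_abs, sq_abs, sFun_ofReal, sFun_ofReal] at this
  have hdiff : u₁ - u₂ = p * (w₁ - w₂) := by
    have := uC_sub_uC (a := a) (c := c) (w₁ := w₁) (w₂ := w₂)
      (fun i => by exact_mod_cast h₁.ne i) (fun i => by exact_mod_cast h₂.ne i)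
    rw [hpC, uC_ofReal, uC_ofReal] at this
    exact_mod_cast this
  set r₁ := √x₁ / -u₁ with hr₁
  set r₂ := √x₂ / -u₂ with hr₂
  have hs₁ : √x₁ ^ 2 = x₁ := Real.sq_sqrt hp₁.le
  have hs₂ : √x₂ ^ 2 = x₂ := Real.sq_sqrt hp₂.le
  have hrp₁ : 0 < r₁ := div_pos (Real.sqrt_pos.2 hp₁) (by linarith)
  have hrp₂ : 0 < r₂ := div_pos (Real.sqrt_pos.2 hp₂) (by linarith)
  have hw₁ : w₁ = u₁ - x₁ / u₁ := by
    have := hn₁.ne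
    rw [hx₁, phiR, vR, ← hu₁]; field_simp; ring
  have hw₂ : w₂ = u₂ - x₂ / u₂ := by
    have := hn₂.ne
    rw [hx₂, phiR, vR, ← hu₂]; field_simp; ring
  -- At a good point φ' ≥ 0 is the same as s(1 + r²) ≤ 1 with r = √φ/|u|.
  have hk : ∀ w, Good a c w → 0 ≤ phiDeriv a c w →
      powSum a c 2 w * (1 + (√(phiR a c w) / -uR a c w) ^ 2) ≤ 1 := by
    intro w h hd
    have hu := h.u_neg
    rw [phiDeriv_eq] at hd
    rw [div_pow, Real.sq_sqrt h.phiR_pos.le, phiR]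
    have e : powSum a c 2 w * (1 + -(uR a c w * vR a c w) / (-uR a c w) ^ 2) =
        powSum a c 2 w * (uR a c w - vR a c w) / uR a c w := by
      have := hu.ne
      field_simp
      ring
    rw [e, div_le_one_of_neg hu]
    linarith
  have hk₁ := hk w₁ h₁ hd₁
  have hk₂ := hk w₂ h₂ hd₂
  have hS₁ := powSum_two_pos hM ha hc h₁.ne
  have hS₂ := powSum_two_pos hM ha hc h₂.ne
  -- Unlike in the complex case the two values of φ may differ. Writing x/u as -√x r at both points,
  -- their difference collects into the factor √x₁ - √x₂.
  have key : (w₁ - w₂) * (1 - p * (1 + r₁ * r₂)) = (√x₁ - √x₂) * (r₁ + r₂) := by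
    have e1 : (w₁ - w₂) * (1 - p * (1 + r₁ * r₂)) =
        (w₁ - w₂) - (u₁ - u₂) * (1 + r₁ * r₂) := by rw [hdiff]; ring
    rw [e1]
    conv_lhs => rw [hw₁, hw₂, ← hs₁, ← hs₂]
    rw [hr₁, hr₂]
    have := hn₁.ne
    have := hn₂.ne
    field_simp
    ring
  by_contra! hle
  have hsle : √x₂ ≤ √x₁ := Real.sqrt_le_sqrt hle
  have hR : 0 ≤ (√x₁ - √x₂) * (r₁ + r₂) := mul_nonneg (by linarith) (by linarith)
  -- If r₁ ≠ r₂, Cauchy–Schwarz is strict and the two sides have opposite signs. If r₁ = r₂, both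
  -- sides vanish, so φ and then u agree at the two points, forcing w₁ = w₂.
  by_cases hr : r₁ = r₂
  · have hQ := mul_one_add_mul_le hS₁.le hS₂.le hk₁ hk₂ hpsq
    have hL : (w₁ - w₂) * (1 - p * (1 + r₁ * r₂)) ≤ 0 :=
      mul_nonpos_of_nonpos_of_nonneg (by linarith) (sub_nonneg.2 hQ)
    have h0 : (√x₁ - √x₂) * (r₁ + r₂) = 0 := by linarith
    have hx : √x₁ = √x₂ := by
      rcases mul_eq_zero.1 h0 with h | h <;> linarith
    have huu : u₁ = u₂ := by
      rw [hr₁, hr₂, hx, div_eq_div_iff (by linarith) (by linarith)] at hr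
      have := mul_left_cancel₀ (Real.sqrt_pos.2 hp₂).ne' hr
      linarith
    have hxx : x₁ = x₂ := by rw [← hs₁, ← hs₂, hx]
    have : w₁ = w₂ := by rw [hw₁, hw₂, huu, hxx]
    linarith
  · have hQ := mul_one_add_mul_lt_of_ne hS₁ hS₂ hk₁ hk₂ hpsq hr
    have hL : (w₁ - w₂) * (1 - p * (1 + r₁ * r₂)) < 0 :=
      mul_neg_of_neg_of_pos (by linarith) (sub_pos.2 hQ)
    linarith

theorem Good.lt_of_phiR_lt (hM : 0 < M) (ha : ∀ i, 0 < a i) (hc : 0 < c) {w₁ w₂ : ℝ}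
    (h₁ : Good a c w₁) (h₂ : Good a c w₂) (hd₁ : 0 ≤ phiDeriv a c w₁) (hd₂ : 0 ≤ phiDeriv a c w₂)
    (hlt : phiR a c w₁ < phiR a c w₂) : w₁ < w₂ := by
  by_contra! hle
  rcases hle.eq_or_lt with h | h
  · rw [h] at hlt; exact lt_irrefl _ hlt
  · exact lt_asymm hlt (phiR_lt_phiR hM ha hc h₂ h₁ hd₂ hd₁ h)

/-- Where `φ' = φ'' = 0`, the third derivative is negative. -/
theorem phiDerivThree_neg (hM : 0 < M) (ha : ∀ i, 0 < a i) (hc : 0 < c) {w : ℝ} (h : Good a c w)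
    (h1 : phiDeriv a c w = 0) (h2 : phiDerivTwo a c w = 0) : phiDerivThree a c w < 0 := by
  have hs := powSum_two_pos hM ha hc h.ne
  have hu := h.u_neg
  have hv := h.v_pos
  have hcs : powSum a c 3 w ^ 2 ≤ powSum a c 2 w * powSum a c 4 w := by
    have h := Finset.sum_mul_sq_le_sq_mul_sq Finset.univ (fun i => a i / (a i - w))
      (fun i => a i / (a i - w) ^ 2)
    have e1 : ∀ i, a i / (a i - w) * (a i / (a i - w) ^ 2) = a i ^ 2 / (a i - w) ^ 3 := by
      intro i; rw [div_mul_div_comm]; ring_nf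
    have e2 : ∀ i, (a i / (a i - w)) ^ 2 = a i ^ 2 / (a i - w) ^ 2 := fun i => div_pow _ _ _
    have e3 : ∀ i, (a i / (a i - w) ^ 2) ^ 2 = a i ^ 2 / (a i - w) ^ 4 := by
      intro i; rw [div_pow, ← pow_mul]
    simp only [e1, e2, e3] at h
    unfold powSum
    calc _ = (c / M) ^ 2 * (∑ i, a i ^ 2 / (a i - w) ^ 3) ^ 2 := by rw [mul_pow]
      _ ≤ (c / M) ^ 2 * _ := mul_le_mul_of_nonneg_left h (by positivity)
      _ = _ := by ring
  unfold phiDeriv at h1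
  unfold phiDerivTwo at h2
  unfold phiDerivThree
  rw [vR] at hv
  set s := powSum a c 2 w
  set s3 := powSum a c 3 w
  set s4 := powSum a c 4 w
  set u := uR a c w
  have hb : 2 * u - w < u := by linarith
  have hs1 : s < 1 := by
    by_contra! hge
    nlinarith
  have e1 : s * (2 * u - w) = u := by linarith
  -- Multiply φ'' = 0 by s and replace s(2u - w) by u, which is φ' = 0. Hence s3 < 0.
  have e2 : s3 * u = s ^ 2 * (1 - s) := by
    have : s * (s3 * (2 * u - w)) = s * (s - s ^ 2) := by
      congr 1; linarith
    calc s3 * u = s * (s3 * (2 * u - w)) := by linear_combination -s3 * e1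
      _ = _ := by rw [this]; ring
  have hs3 : s3 < 0 := by
    have : 0 < s3 * u := by rw [e2]; have : 0 < 1 - s := by linarith
                            positivity
    exact neg_of_mul_pos_left this hu.le
  -- Cauchy–Schwarz s3² ≤ s s4 times the negative number u. Inserted in φ''', it leaves at most 6 s
  -- s3 < 0.
  have e3 : s ^ 2 * (s4 * (2 * u - w)) ≤ s ^ 2 * (s3 * (1 - s)) := by
    calc s ^ 2 * (s4 * (2 * u - w)) = (s * s4) * u := by
          linear_combination s * s4 * e1
      _ ≤ s3 ^ 2 * u := mul_le_mul_of_nonpos_right hcs hu.le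
      _ = s3 * (s3 * u) := by ring
      _ = _ := by rw [e2]; ring
  have e4 := le_of_mul_le_mul_left e3 (by positivity)
  nlinarith [mul_neg_of_pos_of_neg hs hs3]

theorem nonneg_of_forall_le_left {f : ℝ → ℝ} {d x y : ℝ} (hf : HasDerivAt f d y) (hxy : x < y)
    (h : ∀ z ∈ Set.Icc x y, f z ≤ f y) : 0 ≤ d := by
  have h1 := (hasDerivWithinAt_iff_tendsto_slope' (s := Set.Iio y) (by simp)).1
    hf.hasDerivWithinAt
  refine ge_of_tendsto h1 ?_
  filter_upwards [Ioo_mem_nhdsLT hxy] with z hz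
  rw [slope_def_field]
  exact div_nonneg_of_nonpos (by linarith [h z ⟨hz.1.le, hz.2.le⟩]) (by linarith [hz.2])

theorem nonneg_of_forall_ge_right {f : ℝ → ℝ} {d x y : ℝ} (hf : HasDerivAt f d x) (hxy : x < y)
    (h : ∀ z ∈ Set.Icc x y, f x ≤ f z) : 0 ≤ d := by
  have h1 := (hasDerivWithinAt_iff_tendsto_slope' (s := Set.Ioi x) (by simp)).1
    hf.hasDerivWithinAt
  refine ge_of_tendsto h1 ?_
  filter_upwards [Ioo_mem_nhdsGT hxy] with z hz
  rw [slope_def_field]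
  exact div_nonneg (by linarith [h z ⟨hz.1.le, hz.2.le⟩]) (by linarith [hz.1])

/-- If φ'(w) < 0, a maximum x of φ on [w₁, w] and a minimum y on [w, w₂] both have φ' ≥ 0. Then x <
y but φ(x) ≥ φ(w) ≥ φ(y), against `phiR_lt_phiR`. -/
theorem phiDeriv_nonneg_between (hM : 0 < M) (ha : ∀ i, 0 < a i) (hc : 0 < c) {w₁ w₂ : ℝ}
    (hg : ∀ w ∈ Set.Icc w₁ w₂, Good a c w) (hd₁ : 0 ≤ phiDeriv a c w₁) (hd₂ : 0 ≤ phiDeriv a c w₂)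
    {w : ℝ} (hw : w ∈ Set.Icc w₁ w₂) : 0 ≤ phiDeriv a c w := by
  by_contra! hneg
  have hcont : ∀ x ∈ Set.Icc w₁ w₂, ContinuousAt (phiR a c) x := fun x hx =>
    (hasDerivAt_phiR (hg x hx).ne).continuousAt
  obtain ⟨x, hx, hxmax⟩ := isCompact_Icc.exists_isMaxOn (Set.nonempty_Icc.2 hw.1)
    (f := phiR a c) (fun y hy => (hcont y ⟨hy.1, hy.2.trans hw.2⟩).continuousWithinAt)
  obtain ⟨y, hy, hymin⟩ := isCompact_Icc.exists_isMinOn (Set.nonempty_Icc.2 hw.2)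
    (f := phiR a c) (fun y hy => (hcont y ⟨hw.1.trans hy.1, hy.2⟩).continuousWithinAt)
  have hxg := hg x ⟨hx.1, hx.2.trans hw.2⟩
  have hyg := hg y ⟨hw.1.trans hy.1, hy.2⟩
  have hdx : 0 ≤ phiDeriv a c x := by
    rcases hx.1.eq_or_lt with h | h
    · rwa [← h]
    · exact nonneg_of_forall_le_left (hasDerivAt_phiR hxg.ne) h
        fun z hz => hxmax ⟨hz.1, hz.2.trans hx.2⟩
  have hdy : 0 ≤ phiDeriv a c y := by
    rcases hy.2.eq_or_lt with h | h
    · rwa [h]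
    · exact nonneg_of_forall_ge_right (hasDerivAt_phiR hyg.ne) h
        fun z hz => hymin ⟨hy.1.trans hz.1, hz.2⟩
  have hxw : x ≠ w := by rintro rfl; linarith
  have hlt : x < y := lt_of_lt_of_le (lt_of_le_of_ne hx.2 hxw) hy.1
  have h1 := phiR_lt_phiR hM ha hc hxg hyg hdx hdy hlt
  have h2 : phiR a c w ≤ phiR a c x := hxmax ⟨hw.1, le_rfl⟩
  have h3 : phiR a c y ≤ phiR a c w := hymin ⟨le_rfl, hw.2⟩
  linarith

/-- An interior zero of φ' ≥ 0 is a minimum of φ', so φ'' = 0 there; then φ''' < 0 makes it also a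
local maximum, φ' is locally constant, and φ''' = 0. -/
theorem phiDeriv_pos_between (hM : 0 < M) (ha : ∀ i, 0 < a i) (hc : 0 < c) {w₁ w₂ : ℝ}
    (hg : ∀ w ∈ Set.Icc w₁ w₂, Good a c w) (hd₁ : 0 ≤ phiDeriv a c w₁) (hd₂ : 0 ≤ phiDeriv a c w₂)
    {w : ℝ} (hw : w ∈ Set.Ioo w₁ w₂) : 0 < phiDeriv a c w := by
  have hnn := fun x hx => phiDeriv_nonneg_between hM ha hc hg hd₁ hd₂ (w := x) hx
  have hwI : w ∈ Set.Icc w₁ w₂ := Set.Ioo_subset_Icc_self hw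
  have hgw := hg w hwI
  refine lt_of_le_of_ne (hnn w hwI) fun h0 => ?_
  have hmin : IsLocalMin (phiDeriv a c) w := by
    filter_upwards [Icc_mem_nhds hw.1 hw.2] with x hx
    rw [← h0]; exact hnn x hx
  have h2 : phiDerivTwo a c w = 0 := hmin.hasDerivAt_eq_zero (hasDerivAt_phiDeriv hgw.ne)
  have h3 := phiDerivThree_neg hM ha hc hgw h0.symm h2
  have hev : deriv (phiDeriv a c) =ᶠ[𝓝 w] phiDerivTwo a c := by
    filter_upwards [eventually_ne_eigenvalue hgw.ne] with x hx using (hasDerivAt_phiDeriv hx).deriv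
  have hdd : deriv (deriv (phiDeriv a c)) w = phiDerivThree a c w := by
    rw [hev.deriv_eq, (hasDerivAt_phiDerivTwo hgw.ne).deriv]
  have hmax : IsLocalMax (phiDeriv a c) w :=
    isLocalMax_of_deriv_deriv_neg (by rw [hdd]; exact h3)
      (by rw [(hasDerivAt_phiDeriv hgw.ne).deriv, h2]) (hasDerivAt_phiDeriv hgw.ne).continuousAt
  have hconst : phiDeriv a c =ᶠ[𝓝 w] fun _ => phiDeriv a c w := by
    filter_upwards [hmin, hmax] with x h4 h5 using le_antisymm h5 h4
  have : deriv (phiDeriv a c) =ᶠ[𝓝 w] fun _ => 0 := by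
    have := hconst.deriv
    simpa using this
  have h6 : deriv (deriv (phiDeriv a c)) w = 0 := by
    rw [this.deriv_eq]; simp
  rw [hdd] at h6
  linarith

end RealCalculus

/-! ### The regions of good points: between eigenvalues, above them, and on the negative axis. -/

section Regions

variable {M : ℕ} {a : Fin M → ℝ} {c : ℝ}

/-- Each a/(a - w) increases between poles, and the hypothesis says that no eigenvalue lies in [w₁,
w₂]. -/
theorem mR_lt_mR (hM : 0 < M) (ha : ∀ i, 0 < a i) {w₁ w₂ : ℝ} (hlt : w₁ < w₂)
    (h : ∀ i, a i < w₁ ∨ w₂ < a i) : mR a w₁ < mR a w₂ := by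
  have : Nonempty (Fin M) := ⟨⟨0, hM⟩⟩
  unfold mR
  refine mul_lt_mul_of_pos_left (Finset.sum_lt_sum_of_nonempty Finset.univ_nonempty
    fun i _ => ?_) (by positivity)
  have hi := ha i
  have hne1 : a i - w₁ ≠ 0 := by rcases h i with h | h <;> intro h' <;> linarith
  have hne2 : a i - w₂ ≠ 0 := by rcases h i with h | h <;> intro h' <;> linarith
  have hpos : 0 < (a i - w₁) * (a i - w₂) := by
    rcases h i with h | h
    · exact mul_pos_of_neg_of_neg (by linarith) (by linarith)
    · exact mul_pos (by linarith) (by linarith)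
  rw [← sub_pos]
  have : a i / (a i - w₂) - a i / (a i - w₁) = a i * (w₂ - w₁) / ((a i - w₁) * (a i - w₂)) := by
    field_simp; ring
  rw [this]
  exact div_pos (mul_pos hi (by linarith)) hpos

theorem mR_neg_of_forall_lt (hM : 0 < M) (ha : ∀ i, 0 < a i) {w : ℝ} (h : ∀ i, a i < w) :
    mR a w < 0 := by
  have : Nonempty (Fin M) := ⟨⟨0, hM⟩⟩
  exact mul_neg_of_pos_of_neg (by positivity) (Finset.sum_neg
    (fun i _ => div_neg_of_pos_of_neg (ha i) (by linarith [h i])) Finset.univ_nonempty)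

theorem mR_pos_of_forall_gt (hM : 0 < M) (ha : ∀ i, 0 < a i) {w : ℝ} (h : ∀ i, w < a i) :
    0 < mR a w := by
  have : Nonempty (Fin M) := ⟨⟨0, hM⟩⟩
  exact mul_pos (by positivity) (Finset.sum_pos
    (fun i _ => div_pos (ha i) (by linarith [h i])) Finset.univ_nonempty)

theorem mR_zero (hM : 0 < M) (ha : ∀ i, 0 < a i) : mR a 0 = 1 := by
  have : (M : ℝ) ≠ 0 := by positivity
  simp [mR, fun i => div_self (ha i).ne', this]

theorem exists_lt_of_mR_neg (hM : 0 < M) (ha : ∀ i, 0 < a i) {w : ℝ} (hw : ∀ i, w ≠ a i)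
    (h : mR a w < 0) : ∃ i, a i < w := by
  by_contra! hle
  have := mR_pos_of_forall_gt hM ha fun i => lt_of_le_of_ne (hle i) (hw i)
  linarith

theorem good_of_mR_neg (hM : 0 < M) (ha : ∀ i, 0 < a i) (hc : 0 < c) {w : ℝ}
    (hw : ∀ i, w ≠ a i) (h : mR a w < 0) : Good a c w := by
  obtain ⟨i, hi⟩ := exists_lt_of_mR_neg hM ha hw h
  have hw0 : 0 < w := (ha i).trans hi
  refine ⟨hw, ?_, ?_⟩
  · rw [uR_eq_mR]; exact mul_neg_of_pos_of_neg (by positivity) h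
  · rw [vR_eq_mR]
    refine mul_pos hw0 ?_
    have := mul_neg_of_pos_of_neg hc h
    linarith

theorem good_of_neg (ha : ∀ i, 0 < a i) (hc : 0 < c) {w : ℝ} (hw : w < 0)
    (h : 1 / c < mR a w) : Good a c w := by
  have h0 : 0 < mR a w := lt_trans (by positivity) h
  rw [div_lt_iff₀ hc] at h
  refine ⟨fun i => (hw.trans (ha i)).ne, ?_, ?_⟩
  · rw [uR_eq_mR]
    have := mul_pos hc h0
    nlinarith
  · rw [vR_eq_mR]
    exact mul_pos_of_neg_of_neg hw (by linarith)

/-- The good set splits by the sign of w; the negative part can be nonempty only if c > 1, since m <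
1 on the negative axis. -/
theorem Good.mR_neg_or (hc : 0 < c) {w : ℝ} (h : Good a c w) :
    mR a w < 0 ∨ (w < 0 ∧ 1 / c < mR a w) := by
  have hu := h.u_neg
  have hv := h.v_pos
  rw [uR_eq_mR] at hu
  rw [vR_eq_mR] at hv
  rcases lt_or_ge 0 w with hw | hw
  · left
    by_contra! hm
    have : 0 ≤ c * w * mR a w := by positivity
    linarith
  · right
    have hw' : w < 0 := lt_of_le_of_ne hw (by rintro rfl; simp at hv)
    refine ⟨hw', ?_⟩
    rw [div_lt_iff₀ hc]
    by_contra! hm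
    nlinarith

theorem tendsto_sum_ne (i₀ : Fin M) :
    Tendsto (fun w => ∑ i with a i ≠ a i₀, a i / (a i - w)) (𝓝 (a i₀))
      (𝓝 (∑ i with a i ≠ a i₀, a i / (a i - a i₀))) := by
  refine tendsto_finsetSum _ fun i hi => ?_
  rw [Finset.mem_filter] at hi
  exact tendsto_const_nhds.div (tendsto_const_nhds.sub tendsto_id) (sub_ne_zero.2 hi.2)

/-- Isolates the pole at a i₀; the cardinality is the multiplicity of that eigenvalue. -/
theorem mR_split (i₀ : Fin M) (w : ℝ) :
    mR a w = (1 / M) * ((Finset.univ.filter fun i => a i = a i₀).card * a i₀ * (a i₀ - w)⁻¹ +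
      ∑ i with a i ≠ a i₀, a i / (a i - w)) := by
  rw [mR, ← Finset.sum_filter_add_sum_filter_not Finset.univ (fun i => a i = a i₀)]
  congr 2
  rw [Finset.sum_congr rfl (g := fun _ => a i₀ * (a i₀ - w)⁻¹)]
  · rw [Finset.sum_const, nsmul_eq_mul, mul_assoc]
  · intro i hi
    rw [(Finset.mem_filter.1 hi).2, div_eq_mul_inv]

theorem card_filter_pos (i₀ : Fin M) :
    (0 : ℝ) < (Finset.univ.filter fun i => a i = a i₀).card := by
  exact_mod_cast Finset.card_pos.2 ⟨i₀, by simp⟩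

theorem tendsto_mR_right (hM : 0 < M) (ha : ∀ i, 0 < a i) (i₀ : Fin M) :
    Tendsto (mR a) (𝓝[>] (a i₀)) atBot := by
  have hk := mul_pos (card_filter_pos (a := a) i₀) (ha i₀)
  rw [funext (mR_split (a := a) i₀)]
  have hM' : (0 : ℝ) < 1 / M := by positivity
  refine Tendsto.const_mul_atBot hM' (Tendsto.atBot_add (Tendsto.const_mul_atBot hk ?_)
    ((tendsto_sum_ne i₀).mono_left nhdsWithin_le_nhds))
  refine tendsto_inv_nhdsLT_zero.comp (tendsto_nhdsWithin_iff.2 ⟨?_, ?_⟩)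
  · have : Tendsto (fun w => a i₀ - w) (𝓝 (a i₀)) (𝓝 (a i₀ - a i₀)) :=
      tendsto_const_nhds.sub tendsto_id
    rw [sub_self] at this
    exact this.mono_left nhdsWithin_le_nhds
  · filter_upwards [self_mem_nhdsWithin] with w hw
    exact sub_neg.2 (Set.mem_Ioi.1 hw)

theorem tendsto_mR_left (hM : 0 < M) (ha : ∀ i, 0 < a i) (i₀ : Fin M) :
    Tendsto (mR a) (𝓝[<] (a i₀)) atTop := by
  have hk := mul_pos (card_filter_pos (a := a) i₀) (ha i₀)
  rw [funext (mR_split (a := a) i₀)]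
  have hM' : (0 : ℝ) < 1 / M := by positivity
  refine Tendsto.const_mul_atTop hM' (Tendsto.atTop_add (Tendsto.const_mul_atTop hk ?_)
    ((tendsto_sum_ne i₀).mono_left nhdsWithin_le_nhds))
  refine tendsto_inv_nhdsGT_zero.comp (tendsto_nhdsWithin_iff.2 ⟨?_, ?_⟩)
  · have : Tendsto (fun w => a i₀ - w) (𝓝 (a i₀)) (𝓝 (a i₀ - a i₀)) :=
      tendsto_const_nhds.sub tendsto_id
    rw [sub_self] at this
    exact this.mono_left nhdsWithin_le_nhds
  · filter_upwards [self_mem_nhdsWithin] with w hw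
    exact sub_pos.2 (Set.mem_Iio.1 hw)

theorem tendsto_phiR_right (hM : 0 < M) (ha : ∀ i, 0 < a i) (hc : 0 < c) (i₀ : Fin M) :
    Tendsto (phiR a c) (𝓝[>] (a i₀)) atTop := by
  have hm := tendsto_mR_right hM ha i₀
  have h1 : Tendsto (fun w => c * w ^ 2) (𝓝[>] (a i₀)) (𝓝 (c * a i₀ ^ 2)) :=
    ((continuous_const.mul (continuous_pow 2)).tendsto _).mono_left nhdsWithin_le_nhds
  have h2 : Tendsto (fun w => mR a w * (c * mR a w - 1)) (𝓝[>] (a i₀)) atTop :=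
    hm.atBot_mul_atBot₀ ((Tendsto.const_mul_atBot hc hm).atBot_add (tendsto_const_nhds (x := -1)))
  have := h1.pos_mul_atTop (mul_pos hc (pow_pos (ha i₀) 2)) h2
  refine this.congr fun w => ?_
  rw [phiR_eq_mR]; ring

theorem tendsto_phiR_atTop (hM : 0 < M) (ha : ∀ i, 0 < a i) (hc : 0 < c) :
    Tendsto (phiR a c) atTop atTop := by
  have : Nonempty (Fin M) := ⟨⟨0, hM⟩⟩
  have hterm : ∀ i, Tendsto (fun w => a i * w / (a i - w)) atTop (𝓝 (-a i)) := by
    intro i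
    have h1 : Tendsto (fun w => a i - w) atTop atBot :=
      tendsto_atBot_add_const_left _ _ tendsto_neg_atTop_atBot
    have h2 : Tendsto (fun w => -a i + a i ^ 2 * (a i - w)⁻¹) atTop (𝓝 (-a i + a i ^ 2 * 0)) :=
      ((tendsto_inv_atBot_zero.comp h1).const_mul _).const_add _
    rw [mul_zero, add_zero] at h2
    refine h2.congr' ?_
    filter_upwards [eventually_gt_atTop (a i)] with w hw
    have : a i - w ≠ 0 := by linarith
    field_simp
    ring
  have hu : Tendsto (uR a c) atTop (𝓝 ((c / M) * ∑ i, -a i)) :=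
    (tendsto_finsetSum _ fun i _ => hterm i).const_mul _
  have hneg : (c / M) * ∑ i, -a i < 0 :=
    mul_neg_of_pos_of_neg (by positivity)
      (Finset.sum_neg (fun i _ => by linarith [ha i]) Finset.univ_nonempty)
  have hv : Tendsto (vR a c) atTop atTop := by
    have := tendsto_id.atTop_add hu.neg
    exact this.congr fun w => by simp [vR, sub_eq_add_neg]
  have := hu.neg.pos_mul_atTop (by linarith) hv
  exact this.congr fun w => by simp [phiR]

/-- Near l the function exceeds f p, so a minimum over a compact [e, p] is a minimum over the
half-open interval. -/
theorem exists_min_Ioc {f : ℝ → ℝ} {l p : ℝ} (hlp : l < p) (hf : ContinuousOn f (Set.Ioc l p))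
    (hlim : Tendsto f (𝓝[>] l) atTop) : ∃ x ∈ Set.Ioc l p, ∀ y ∈ Set.Ioc l p, f x ≤ f y := by
  have h1 : ∀ᶠ y in 𝓝[>] l, f p < f y := hlim.eventually_gt_atTop _
  obtain ⟨d, hd, hd'⟩ := (mem_nhdsGT_iff_exists_Ioo_subset' hlp).1 h1
  have hld : l < d := hd
  set e := min ((l + d) / 2) p with he
  have hle : l < e := lt_min (by linarith) hlp
  have hep : e ≤ p := min_le_right _ _
  obtain ⟨x, hx, hxmin⟩ := isCompact_Icc.exists_isMinOn (Set.nonempty_Icc.2 hep)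
    (hf.mono fun y hy => ⟨hle.trans_le hy.1, hy.2⟩)
  refine ⟨x, ⟨hle.trans_le hx.1, hx.2⟩, fun y hy => ?_⟩
  rcases le_or_gt e y with h | h
  · exact hxmin ⟨h, hy.2⟩
  · have h2 : f p < f y := hd' ⟨hy.1, h.trans_le ((min_le_left _ _).trans (by linarith))⟩
    have h3 : f x ≤ f p := hxmin ⟨hep, le_rfl⟩
    linarith

theorem exists_phiDeriv_pos {x y : ℝ} (hxy : x < y) (hg : ∀ w ∈ Set.Icc x y, ∀ i, w ≠ a i)
    (h : phiR a c x < phiR a c y) : ∃ ξ ∈ Set.Ioo x y, 0 < phiDeriv a c ξ := by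
  obtain ⟨ξ, hξ, hslope⟩ := exists_hasDerivAt_eq_slope (phiR a c) (phiDeriv a c) hxy
    (fun w hw => (hasDerivAt_phiR (hg w hw)).continuousAt.continuousWithinAt)
    (fun w hw => hasDerivAt_phiR (hg w (Set.Ioo_subset_Icc_self hw)))
  exact ⟨ξ, hξ, by rw [hslope]; exact div_pos (by linarith) (by linarith)⟩

theorem exists_phiDeriv_nonneg {x y : ℝ} (hxy : x < y) (hg : ∀ w ∈ Set.Icc x y, ∀ i, w ≠ a i)
    (h : phiR a c x ≤ phiR a c y) : ∃ ξ ∈ Set.Ioo x y, 0 ≤ phiDeriv a c ξ := by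
  obtain ⟨ξ, hξ, hslope⟩ := exists_hasDerivAt_eq_slope (phiR a c) (phiDeriv a c) hxy
    (fun w hw => (hasDerivAt_phiR (hg w hw)).continuousAt.continuousWithinAt)
    (fun w hw => hasDerivAt_phiR (hg w (Set.Ioo_subset_Icc_self hw)))
  exact ⟨ξ, hξ, by rw [hslope]; exact div_nonneg (by linarith) (by linarith)⟩

/-- The behaviour of `φ` above the largest eigenvalue. -/
theorem exists_upper (hM : 0 < M) (ha : ∀ i, 0 < a i) (hc : 0 < c) {i₀ : Fin M}
    (hi₀ : ∀ i, a i ≤ a i₀) :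
    ∃ w, a i₀ < w ∧ phiDeriv a c w = 0 ∧ IsLocalMin (phiR a c) w ∧
      (∀ x, a i₀ < x → x < w → phiDeriv a c x < 0) ∧ (∀ x, w < x → 0 < phiDeriv a c x) := by
  have hgood : ∀ w, a i₀ < w → Good a c w := fun w hw =>
    good_of_mR_neg hM ha hc (fun i => ((hi₀ i).trans_lt hw).ne')
      (mR_neg_of_forall_lt hM ha fun i => (hi₀ i).trans_lt hw)
  have hcont : ∀ w, a i₀ < w → ContinuousAt (phiR a c) w := fun w hw =>
    (hasDerivAt_phiR (hgood w hw).ne).continuousAt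
  set p := a i₀ + 1
  have hp : a i₀ < p := by simp [p]
  obtain ⟨T, hT⟩ := eventually_atTop.1
    ((tendsto_phiR_atTop hM ha hc).eventually_gt_atTop (phiR a c p))
  set T' := max T p
  have hpT : p ≤ T' := le_max_right _ _
  obtain ⟨w, hw, hmin⟩ := exists_min_Ioc (l := a i₀) (p := T') (hp.trans_le hpT)
    (fun y hy => (hcont y hy.1).continuousWithinAt) (tendsto_phiR_right hM ha hc i₀)
  have hglob : ∀ y, a i₀ < y → phiR a c w ≤ phiR a c y := by
    intro y hy
    rcases le_or_gt y T' with h | h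
    · exact hmin y ⟨hy, h⟩
    · have h1 := hmin p ⟨hp, hpT⟩
      have h2 := hT y ((le_max_left _ _).trans h.le)
      linarith
  have hlm : IsLocalMin (phiR a c) w := by
    filter_upwards [Ioi_mem_nhds hw.1] with y hy using hglob y hy
  have hd : phiDeriv a c w = 0 := hlm.hasDerivAt_eq_zero (hasDerivAt_phiR (hgood w hw.1).ne)
  refine ⟨w, hw.1, hd, hlm, fun x hx hxw => ?_, fun x hx => ?_⟩
  -- A point left of the global minimum with φ' ≥ 0 would have a strictly smaller value.
  · by_contra! h
    have := phiR_lt_phiR hM ha hc (hgood x hx) (hgood w hw.1) h hd.ge hxw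
    linarith [hglob x hx]
  -- Growth at infinity and the mean value theorem give a point beyond x with φ' > 0; positivity
  -- then holds between it and w.
  · obtain ⟨y, hy, hxy⟩ := ((tendsto_phiR_atTop hM ha hc).eventually_gt_atTop (phiR a c x)).and
      (eventually_gt_atTop x) |>.exists
    obtain ⟨ξ, hξ, hpos⟩ := exists_phiDeriv_pos hxy
      (fun z hz => (hgood z (hw.1.trans (hx.trans_le hz.1))).ne) hy
    exact phiDeriv_pos_between hM ha hc (fun z hz => hgood z (hw.1.trans_le hz.1)) hd.ge hpos.le
      ⟨hx, hξ.1⟩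

/-- The points where `m < 0` between `l` and the next eigenvalue. -/
structure InGap (a : Fin M → ℝ) (l w : ℝ) : Prop where
  lt : l < w
  mR_neg : mR a w < 0
  gap : ∀ i, a i ≤ l ∨ w < a i

theorem InGap.ne {l w : ℝ} (h : InGap a l w) (i : Fin M) : w ≠ a i := by
  rcases h.gap i with h' | h'
  · exact (h'.trans_lt h.lt).ne'
  · exact h'.ne

theorem InGap.good (hM : 0 < M) (ha : ∀ i, 0 < a i) (hc : 0 < c) {l w : ℝ} (h : InGap a l w) :
    Good a c w := good_of_mR_neg hM ha hc h.ne h.mR_neg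

theorem InGap.of_le (hM : 0 < M) (ha : ∀ i, 0 < a i) {l w x : ℝ} (h : InGap a l w) (hx : l < x)
    (hxw : x ≤ w) : InGap a l x := by
  rcases hxw.eq_or_lt with rfl | hlt
  · exact h
  refine ⟨hx, (mR_lt_mR hM ha hlt fun i => ?_).trans h.mR_neg, fun i => ?_⟩
  · exact (h.gap i).imp (fun h' => h'.trans_lt hx) id
  · exact (h.gap i).imp id hxw.trans_lt

theorem InGap.eventually {l w : ℝ} (h : InGap a l w) : ∀ᶠ x in 𝓝 w, InGap a l x := by
  have hc : ContinuousAt (mR a) w := by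
    unfold mR
    refine continuousAt_const.mul (tendsto_finsetSum _ fun i _ => ?_)
    exact continuousAt_const.div (continuousAt_const.sub continuousAt_id)
      (sub_ne_zero.2 (h.ne i).symm)
  have h3 : ∀ᶠ x in 𝓝 w, ∀ i, a i ≤ l ∨ x < a i := by
    rw [eventually_all]
    intro i
    rcases h.gap i with h' | h'
    · exact Eventually.of_forall fun _ => Or.inl h'
    · exact (gt_mem_nhds h').mono fun _ h => Or.inr h
  filter_upwards [lt_mem_nhds h.lt, hc.eventually (gt_mem_nhds h.mR_neg), h3] with x h1 h2 h3
    using ⟨h1, h2, h3⟩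

/-- The zero of `m` which bounds a gap from above. -/
theorem exists_zero_mR (hM : 0 < M) (ha : ∀ i, 0 < a i) {i₀ j₀ : Fin M} (hlt : a i₀ < a j₀) :
    ∃ r, mR a r = 0 ∧ (∀ i, r ≠ a i) ∧ (∀ w, InGap a (a i₀) w → w < r) ∧
      (∀ w, a i₀ < w → w < r → InGap a (a i₀) w) ∧ a i₀ < r := by
  obtain ⟨j, hj, hjmin⟩ := (Finset.univ.filter fun i => a i₀ < a i).exists_min_image a
    ⟨j₀, by simpa using hlt⟩
  have hij : a i₀ < a j := by simpa using hj
  have hgap : ∀ i, a i ≤ a i₀ ∨ a j ≤ a i := by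
    intro i
    rcases le_or_gt (a i) (a i₀) with h | h
    · exact Or.inl h
    · exact Or.inr (hjmin i (by simpa using h))
  have hns : ∀ w, a i₀ < w → w < a j → ∀ i, w ≠ a i := by
    intro w h1 h2 i
    rcases hgap i with h | h
    · exact (h.trans_lt h1).ne'
    · exact (h2.trans_le h).ne
  have hmono : ∀ w₁ w₂, a i₀ < w₁ → w₁ < w₂ → w₂ < a j → mR a w₁ < mR a w₂ := by
    intro w₁ w₂ h1 h2 h3
    refine mR_lt_mR hM ha h2 fun i => ?_
    exact (hgap i).imp (fun h => h.trans_lt h1) (fun h => h3.trans_le h)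
  obtain ⟨x, hx, hx1⟩ := (((tendsto_mR_right hM ha i₀).eventually_lt_atBot 0).and
    (Ioo_mem_nhdsGT hij)).exists
  obtain ⟨y, hy, hy1⟩ := (((tendsto_mR_left hM ha j).eventually_gt_atTop 0).and
    (Ioo_mem_nhdsLT hij)).exists
  have hxy : x < y := by
    by_contra! hle
    rcases hle.eq_or_lt with h | h
    · rw [h] at hy; linarith
    · linarith [hmono y x hy1.1 h hx1.2]
  have hcont : ContinuousOn (mR a) (Set.Icc x y) := by
    intro w hw
    refine ContinuousAt.continuousWithinAt ?_
    unfold mR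
    refine continuousAt_const.mul (tendsto_finsetSum _ fun i _ => ?_)
    exact continuousAt_const.div (continuousAt_const.sub continuousAt_id)
      (sub_ne_zero.2 (hns w (hx1.1.trans_le hw.1) (hw.2.trans_lt hy1.2) i).symm)
  obtain ⟨r, hr, hr0⟩ := intermediate_value_Icc hxy.le hcont ⟨hx.le, hy.le⟩
  have hr1 : a i₀ < r := hx1.1.trans_le hr.1
  have hr2 : r < a j := hr.2.trans_lt hy1.2
  refine ⟨r, hr0, hns r hr1 hr2, fun w hw => ?_, fun w h1 h2 => ⟨h1, ?_, fun i => ?_⟩, hr1⟩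
  · have hwj : w < a j := (hw.gap j).resolve_left (not_le.2 hij)
    by_contra! hle
    rcases hle.eq_or_lt with h | h
    · have := hw.mR_neg; rw [← h, hr0] at this; exact lt_irrefl _ this
    · linarith [hmono r w hr1 h hwj, hw.mR_neg]
  · rw [← hr0]; exact hmono w r h1 h2 hr2
  · exact (hgap i).imp id (fun h => (h2.trans hr2).trans_le h)

/-- The behaviour of `φ` in a gap which contains two points with `φ' ≥ 0`. -/
theorem exists_gap (hM : 0 < M) (ha : ∀ i, 0 < a i) (hc : 0 < c) {i₀ j₀ : Fin M}
    (hlt : a i₀ < a j₀) {w₁ w₂ : ℝ} (h₁ : InGap a (a i₀) w₁) (h₂ : InGap a (a i₀) w₂)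
    (h₁₂ : w₁ < w₂) (hd₁ : 0 ≤ phiDeriv a c w₁) (hd₂ : 0 ≤ phiDeriv a c w₂) :
    ∃ p q, p < q ∧ InGap a (a i₀) p ∧ InGap a (a i₀) q ∧ phiDeriv a c p = 0 ∧ phiDeriv a c q = 0 ∧
      IsLocalMin (phiR a c) p ∧ IsLocalMax (phiR a c) q ∧
      (∀ x, InGap a (a i₀) x → x < p → phiDeriv a c x < 0) ∧
      (∀ x, p < x → x < q → 0 < phiDeriv a c x) ∧
      (∀ x, InGap a (a i₀) x → q < x → phiDeriv a c x < 0) := by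
  obtain ⟨r, hr0, hrns, hltr, hingap, hir⟩ := exists_zero_mR hM ha hlt
  have hgood : ∀ x, InGap a (a i₀) x → Good a c x := fun x hx => hx.good hM ha hc
  have hcont : ∀ x, InGap a (a i₀) x → ContinuousAt (phiR a c) x := fun x hx =>
    (hasDerivAt_phiR hx.ne).continuousAt
  have hinc := phiR_lt_phiR hM ha hc (hgood _ h₁) (hgood _ h₂) hd₁ hd₂ h₁₂
  obtain ⟨p, hp, hpmin⟩ := exists_min_Ioc (l := a i₀) (p := w₂) h₂.lt
    (fun y hy => (hcont y (h₂.of_le hM ha hy.1 hy.2)).continuousWithinAt)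
    (tendsto_phiR_right hM ha hc i₀)
  have hpg : InGap a (a i₀) p := h₂.of_le hM ha hp.1 hp.2
  have hp1 : phiR a c p ≤ phiR a c w₁ := hpmin w₁ ⟨h₁.lt, h₁₂.le⟩
  have hpw : p < w₂ := lt_of_le_of_ne hp.2 (by rintro rfl; linarith)
  have hplm : IsLocalMin (phiR a c) p := by
    filter_upwards [Ioo_mem_nhds hp.1 hpw] with y hy using hpmin y ⟨hy.1, hy.2.le⟩
  have hpd : phiDeriv a c p = 0 := hplm.hasDerivAt_eq_zero (hasDerivAt_phiR hpg.ne)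
  have hphir : phiR a c r = 0 := by rw [phiR_eq_mR, hr0]; ring
  have hw₁r := hltr w₁ h₁
  have hw₂r := hltr w₂ h₂
  -- At the right end r, a zero of m, φ vanishes, and at the left end φ(w₁) < φ(w₂), so the maximum
  -- is interior.
  obtain ⟨q, hq, hqmax⟩ := isCompact_Icc.exists_isMaxOn (Set.nonempty_Icc.2 hw₁r.le)
    (f := phiR a c) (fun y hy => by
      rcases hy.2.eq_or_lt with h | h
      · rw [h]; exact (hasDerivAt_phiR hrns).continuousAt.continuousWithinAt
      · exact (hcont y (hingap y (h₁.lt.trans_le hy.1) h)).continuousWithinAt)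
  have hq2 : phiR a c w₂ ≤ phiR a c q := hqmax ⟨h₁₂.le, hw₂r.le⟩
  have hqr : q < r := lt_of_le_of_ne hq.2 (by
    rintro rfl
    linarith [(hgood _ h₂).phiR_pos])
  have hq1 : w₁ < q := lt_of_le_of_ne hq.1 (by rintro rfl; linarith)
  have hqg : InGap a (a i₀) q := hingap q (h₁.lt.trans hq1) hqr
  have hqlm : IsLocalMax (phiR a c) q := by
    filter_upwards [Ioo_mem_nhds hq1 hqr] with y hy using hqmax ⟨hy.1.le, hy.2.le⟩
  have hqd : phiDeriv a c q = 0 := hqlm.hasDerivAt_eq_zero (hasDerivAt_phiR hqg.ne)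
  have hpq : p < q := (hgood p hpg).lt_of_phiR_lt hM ha hc (hgood q hqg) hpd.ge hqd.ge (by linarith)
  refine ⟨p, q, hpq, hpg, hqg, hpd, hqd, hplm, hqlm, fun x hx hxp => ?_, fun x h1 h2 => ?_,
    fun x hx hqx => ?_⟩
  · by_contra! h
    have h1 := phiR_lt_phiR hM ha hc (hgood x hx) (hgood p hpg) h hpd.ge hxp
    linarith [hpmin x ⟨hx.lt, hxp.le.trans hp.2⟩]
  · exact phiDeriv_pos_between hM ha hc
      (fun z hz => hgood z (hqg.of_le hM ha (hpg.lt.trans_le hz.1) hz.2)) hpd.ge hqd.ge ⟨h1, h2⟩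
  · by_contra! h
    have h1 := phiR_lt_phiR hM ha hc (hgood q hqg) (hgood x hx) hqd.ge h hqx
    have h2 : phiR a c x ≤ phiR a c q := hqmax ⟨hq1.le.trans hqx.le, (hltr x hx).le⟩
    linarith

/-- A local extremum in a gap is accompanied by another point with `φ' ≥ 0`. -/
theorem exists_other_of_isLocalExtr {l w : ℝ} (h : InGap a l w)
    (hext : IsLocalExtr (phiR a c) w) :
    ∃ x, x ≠ w ∧ InGap a l x ∧ 0 ≤ phiDeriv a c x := by
  obtain ⟨δ, hδ, hball⟩ := Metric.eventually_nhds_iff_ball.1 h.eventually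
  have hIcc : ∀ x, |x - w| < δ → InGap a l x := fun x hx =>
    hball x (by rwa [Metric.mem_ball, Real.dist_eq])
  rcases hext with hmin | hmax
  · obtain ⟨ε, hε, hε'⟩ := Metric.eventually_nhds_iff_ball.1 hmin
    -- The mean value theorem to the right of a minimum, or to the left of a maximum, yields φ' ≥ 0
    -- at a point other than w.
    set y := w + min δ ε / 2
    have hm : 0 < min δ ε := lt_min hδ hε
    have hwy : w < y := by simp only [y]; linarith
    have hy : phiR a c w ≤ phiR a c y := hε' y (by
      rw [Metric.mem_ball, Real.dist_eq, abs_of_pos (by linarith)]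
      have := min_le_right δ ε
      simp only [y]; linarith)
    have hin : ∀ z ∈ Set.Icc w y, InGap a l z := fun z hz => hIcc z (by
      rw [abs_of_nonneg (by linarith [hz.1])]
      have := min_le_left δ ε
      have := hz.2
      simp only [y] at this; linarith)
    obtain ⟨ξ, hξ, hd⟩ := exists_phiDeriv_nonneg hwy (fun z hz => (hin z hz).ne) hy
    exact ⟨ξ, hξ.1.ne', hin ξ (Set.Ioo_subset_Icc_self hξ), hd⟩
  · obtain ⟨ε, hε, hε'⟩ := Metric.eventually_nhds_iff_ball.1 hmax
    set y := w - min δ ε / 2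
    have hm : 0 < min δ ε := lt_min hδ hε
    have hwy : y < w := by simp only [y]; linarith
    have hy : phiR a c y ≤ phiR a c w := hε' y (by
      rw [Metric.mem_ball, Real.dist_eq, abs_of_neg (by linarith)]
      have := min_le_right δ ε
      simp only [y]; linarith)
    have hin : ∀ z ∈ Set.Icc y w, InGap a l z := fun z hz => hIcc z (by
      rw [abs_of_nonpos (by linarith [hz.2])]
      have := min_le_left δ ε
      have := hz.1
      simp only [y] at this; linarith)
    obtain ⟨ξ, hξ, hd⟩ := exists_phiDeriv_nonneg hwy (fun z hz => (hin z hz).ne) hy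
    exact ⟨ξ, hξ.2.ne, hin ξ (Set.Ioo_subset_Icc_self hξ), hd⟩

/-- The behaviour of `φ` on the negative axis if `c > 1`. -/
theorem exists_lower (hM : 0 < M) (ha : ∀ i, 0 < a i) (hc : 1 < c) :
    ∃ o w, o < w ∧ w < 0 ∧ mR a o = 1 / c ∧ (∀ x, x < o → mR a x < 1 / c) ∧
      (∀ x, o < x → x < 0 → 1 / c < mR a x) ∧ phiDeriv a c w = 0 ∧ IsLocalMax (phiR a c) w ∧
      (∀ x, o < x → x < w → 0 < phiDeriv a c x) ∧ (∀ x, w < x → x < 0 → phiDeriv a c x < 0) := by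
  have : Nonempty (Fin M) := ⟨⟨0, hM⟩⟩
  have hc0 : 0 < c := by linarith
  have hns : ∀ x, x ≤ 0 → ∀ i, x ≠ a i := fun x hx i => (hx.trans_lt (ha i)).ne
  have hmono : ∀ x y, x < y → y ≤ 0 → mR a x < mR a y := fun x y hxy hy =>
    mR_lt_mR hM ha hxy fun i => Or.inr (hy.trans_lt (ha i))
  have hcont : ∀ x, x ≤ 0 → ContinuousAt (mR a) x := fun x hx => by
    unfold mR
    refine continuousAt_const.mul (tendsto_finsetSum _ fun i _ => ?_)
    exact continuousAt_const.div (continuousAt_const.sub continuousAt_id)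
      (sub_ne_zero.2 (hns x hx i).symm)
  obtain ⟨y, hy0, hy⟩ : ∃ y < 0, mR a y < 1 / c := by
    set k := (1 / M : ℝ) * ∑ i, a i with hk
    have hkpos : 0 < k := mul_pos (by positivity)
      (Finset.sum_pos (fun i _ => ha i) Finset.univ_nonempty)
    -- With k the mean of the eigenvalues, replacing aᵢ + ck by ck in the denominators raises m to
    -- exactly 1/c.
    refine ⟨-(c * k), by have := mul_pos hc0 hkpos; linarith, ?_⟩
    calc mR a (-(c * k)) < (1 / M) * ∑ i, a i / (c * k) := by
          unfold mR
          refine mul_lt_mul_of_pos_left (Finset.sum_lt_sum_of_nonempty Finset.univ_nonempty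
            fun i _ => ?_) (by positivity)
          have := ha i
          rw [sub_neg_eq_add]
          gcongr
          linarith
      _ = 1 / c := by
          rw [← Finset.sum_div, ← mul_div_assoc, ← hk]
          field_simp
  have h1c : 1 / c < mR a 0 := by
    rw [mR_zero hM ha, div_lt_one hc0]; exact hc
  obtain ⟨o, ho, hom⟩ := intermediate_value_Icc hy0.le
    (fun x hx => (hcont x hx.2).continuousWithinAt) ⟨hy.le, h1c.le⟩
  have ho0 : o < 0 := lt_of_le_of_ne ho.2 (by rintro rfl; linarith)
  have hgood : ∀ x, o < x → x < 0 → Good a c x := fun x h1 h2 =>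
    good_of_neg ha hc0 h2 (by rw [← hom]; exact hmono o x h1 h2.le)
  have hpc : ∀ x, x ≤ 0 → ContinuousAt (phiR a c) x := fun x hx =>
    (hasDerivAt_phiR (hns x hx)).continuousAt
  have hphio : phiR a c o = 0 := by
    rw [phiR_eq_mR, hom, mul_one_div_cancel hc0.ne', sub_self, mul_zero]
  have hphi0 : phiR a c 0 = 0 := by rw [phiR_eq_mR]; ring
  obtain ⟨w, hw, hwmax⟩ := isCompact_Icc.exists_isMaxOn (Set.nonempty_Icc.2 ho0.le)
    (f := phiR a c) (fun y hy => (hpc y hy.2).continuousWithinAt)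
  have hhalf := (hgood (o / 2) (by linarith) (by linarith)).phiR_pos
  have hwpos : phiR a c (o / 2) ≤ phiR a c w :=
    hwmax (show o / 2 ∈ Set.Icc o 0 from ⟨by linarith, by linarith⟩)
  have hw1 : o < w := lt_of_le_of_ne hw.1 (by rintro rfl; linarith)
  have hw2 : w < 0 := lt_of_le_of_ne hw.2 (by rintro rfl; linarith)
  have hlm : IsLocalMax (phiR a c) w := by
    filter_upwards [Ioo_mem_nhds hw1 hw2] with y hy using hwmax ⟨hy.1.le, hy.2.le⟩
  have hd : phiDeriv a c w = 0 := hlm.hasDerivAt_eq_zero (hasDerivAt_phiR (hns w hw2.le))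
  refine ⟨o, w, hw1, hw2, hom, fun x hx => ?_, fun x h1 h2 => ?_, hd, hlm, fun x h1 h2 => ?_,
    fun x h1 h2 => ?_⟩
  · rw [← hom]; exact hmono x o hx ho0.le
  · rw [← hom]; exact hmono o x h1 h2.le
  · have hx := hgood x h1 (h2.trans hw2)
    obtain ⟨ξ, hξ, hpos⟩ := exists_phiDeriv_pos h1
      (fun z hz => hns z ((hz.2.trans h2.le).trans hw2.le)) (by rw [hphio]; exact hx.phiR_pos)
    exact phiDeriv_pos_between hM ha hc0
      (fun z hz => hgood z (hξ.1.trans_le hz.1) (hz.2.trans_lt hw2)) hpos.le hd.ge ⟨hξ.2, h2⟩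
  · by_contra! h
    have h3 := phiR_lt_phiR hM ha hc0 (hgood w hw1 hw2) (hgood x (hw1.trans h1) h2) hd.ge h h1
    have h4 : phiR a c x ≤ phiR a c w := hwmax ⟨(hw1.trans h1).le, h2.le⟩
    linarith

theorem mR_lt_one_of_neg (hM : 0 < M) (ha : ∀ i, 0 < a i) {w : ℝ} (hw : w < 0) : mR a w < 1 := by
  rw [← mR_zero hM ha]
  exact mR_lt_mR hM ha hw fun i => Or.inr (ha i)

end Regions

/-! ### Stieltjes transforms: boundary values, support and uniqueness. -/

section Stieltjes

variable {μ ν : Measure ℝ}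

theorem ofReal_sub_ne_zero {z : ℂ} (hz : 0 < z.im) (x : ℝ) : (x : ℂ) - z ≠ 0 := by
  intro h
  have := congrArg Complex.im h
  simp at this
  linarith

theorem norm_inv_ofReal_sub_le {z : ℂ} (hz : 0 < z.im) (x : ℝ) :
    ‖((x : ℂ) - z)⁻¹‖ ≤ 1 / z.im := by
  have h := Complex.abs_im_le_norm ((x : ℂ) - z)
  rw [Complex.sub_im, Complex.ofReal_im, zero_sub, abs_neg, abs_of_pos hz] at h
  rw [norm_inv, ← one_div]
  exact one_div_le_one_div_of_le hz h

theorem continuous_inv_ofReal_sub {z : ℂ} (hz : 0 < z.im) :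
    Continuous fun x : ℝ => ((x : ℂ) - z)⁻¹ :=
  Continuous.inv₀ (by fun_prop) (ofReal_sub_ne_zero hz)

theorem integrable_inv_ofReal_sub [IsFiniteMeasure μ] {z : ℂ} (hz : 0 < z.im) :
    Integrable (fun x : ℝ => ((x : ℂ) - z)⁻¹) μ :=
  Integrable.of_bound (continuous_inv_ofReal_sub hz).aestronglyMeasurable (1 / z.im)
    (Eventually.of_forall (norm_inv_ofReal_sub_le hz))

theorem inv_ofReal_sub_im (z : ℂ) (x : ℝ) :
    (((x : ℂ) - z)⁻¹).im = z.im / Complex.normSq (x - z) := by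
  rw [Complex.inv_im]; simp

theorem stieltjes_im [IsFiniteMeasure μ] {z : ℂ} (hz : 0 < z.im) :
    (stieltjes μ z).im = ∫ x, z.im / Complex.normSq (x - z) ∂μ := by
  rw [stieltjes_eq]
  have h := integral_im (integrable_inv_ofReal_sub (μ := μ) hz)
  simp only [RCLike.im_to_complex, inv_ofReal_sub_im] at h
  exact h.symm

theorem integrable_poisson [IsFiniteMeasure μ] {z : ℂ} (hz : 0 < z.im) :
    Integrable (fun x : ℝ => z.im / Complex.normSq (x - z)) μ := by
  have h := (integrable_inv_ofReal_sub (μ := μ) hz).im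
  simpa only [RCLike.im_to_complex, inv_ofReal_sub_im] using h

theorem norm_stieltjes_le [IsFiniteMeasure μ] {z : ℂ} (hz : 0 < z.im) :
    ‖stieltjes μ z‖ ≤ 1 / z.im * μ.real Set.univ := by
  rw [stieltjes_eq]
  exact norm_integral_le_of_norm_le_const (Eventually.of_forall (norm_inv_ofReal_sub_le hz))

/-- On the ball of radius ε the kernel ε/((x - y)² + ε²) is at least 1/(2ε). -/
theorem measureReal_ball_le [IsFiniteMeasure μ] (y : ℝ) {ε : ℝ} (hε : 0 < ε) :
    μ.real (Metric.ball y ε) ≤ 2 * ε * (stieltjes μ (y + ε * Complex.I)).im := by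
  set z : ℂ := y + ε * Complex.I with hz
  have him : z.im = ε := by simp [hz]
  have hre : z.re = y := by simp [hz]
  have hz0 : 0 < z.im := by rwa [him]
  rw [stieltjes_im hz0, ← integral_const_mul, ← integral_indicator_one measurableSet_ball]
  refine integral_mono ((integrable_const (1 : ℝ)).indicator measurableSet_ball)
    ((integrable_poisson hz0).const_mul _) fun x => ?_
  have hpos : 0 < Complex.normSq (x - z) := Complex.normSq_pos.2 (ofReal_sub_ne_zero hz0 x)
  by_cases hx : x ∈ Metric.ball y ε
  · simp only [Set.indicator_of_mem hx, Pi.one_apply]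
    rw [← mul_div_assoc, le_div_iff₀ hpos, one_mul, Complex.normSq_apply]
    simp only [Complex.sub_re, Complex.ofReal_re, Complex.sub_im, Complex.ofReal_im, him, hre]
    rw [Metric.mem_ball, Real.dist_eq] at hx
    nlinarith [abs_nonneg (x - y), sq_abs (x - y)]
  · simp only [Set.indicator_of_notMem hx]
    positivity

/-- If the imaginary part of the Stieltjes transform vanishes at the boundary near `x`, then `x` is
not in the support of the measure. -/
theorem notMem_support_of_tendsto_im [IsFiniteMeasure μ] {x : ℝ}
    (h : ∀ᶠ y : ℝ in 𝓝 x, Tendsto (fun z => (stieltjes μ z).im) (𝓝[{z | 0 < z.im}] (y : ℂ))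
      (𝓝 0)) : x ∉ μ.support := by
  obtain ⟨δ, hδ, hball⟩ := Metric.nhds_basis_closedBall.eventually_iff.1 h
  rw [Measure.notMem_support_iff_exists]
  refine ⟨Metric.closedBall x δ, Metric.closedBall_mem_nhds x hδ, ?_⟩
  -- The boundary limit at a point is over a full half-disc, so it controls nearby points too;
  -- compactness makes it uniform.
  have huniform : ∀ η > 0, ∃ ρ > (0 : ℝ), ∀ y ∈ Metric.closedBall x δ, ∀ ε : ℝ,
      0 < ε → ε < ρ →
      (stieltjes μ (y + ε * Complex.I)).im ≤ η := by
    intro η hη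
    refine (isCompact_closedBall x δ).induction_on
      (p := fun s => ∃ ρ > (0 : ℝ), ∀ y ∈ s, ∀ ε : ℝ, 0 < ε → ε < ρ →
        (stieltjes μ (y + ε * Complex.I)).im ≤ η) ⟨1, one_pos, by simp⟩ ?_ ?_ ?_
    · rintro s t hst ⟨ρ, hρ, H⟩
      exact ⟨ρ, hρ, fun y hy => H y (hst hy)⟩
    · rintro s t ⟨ρ, hρ, H⟩ ⟨ρ', hρ', H'⟩
      refine ⟨min ρ ρ', lt_min hρ hρ', ?_⟩
      rintro y (hy | hy) ε h0 h1
      · exact H y hy ε h0 (h1.trans_le (min_le_left _ _))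
      · exact H' y hy ε h0 (h1.trans_le (min_le_right _ _))
    · intro y hy
      have h1 := (hball hy).eventually (ge_mem_nhds hη)
      obtain ⟨ρ, hρ, H⟩ := Metric.mem_nhdsWithin_iff.1 h1
      refine ⟨Metric.ball y (ρ / 2), mem_nhdsWithin_of_mem_nhds
        (Metric.ball_mem_nhds y (by positivity)), ρ / 2, by positivity, ?_⟩
      intro y' hy' ε h0 h1
      refine H ⟨?_, ?_⟩
      · rw [Metric.mem_ball, Real.dist_eq] at hy'
        rw [mem_ball_iff_norm]
        calc ‖(y' : ℂ) + ε * Complex.I - y‖ = ‖((y' - y : ℝ) : ℂ) + ε * Complex.I‖ := by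
              push_cast; ring_nf
          _ ≤ |y' - y| + ε := by
              refine (norm_add_le _ _).trans ?_
              rw [norm_mul, Complex.norm_I, Complex.norm_real, Complex.norm_real, mul_one,
                Real.norm_eq_abs, Real.norm_of_nonneg h0.le]
          _ < ρ := by linarith
      · simpa using h0
  -- Cover by n + 1 balls of radius ε = 2δ/n, each of measure at most 2εη. Their total is 2η(2δ + ε)
  -- ≤ 8δη because ε ≤ 2δ.
  have hle : ∀ η > 0, μ.real (Metric.closedBall x δ) ≤ 8 * δ * η := by
    intro η hη
    obtain ⟨ρ, hρ, H⟩ := huniform η hη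
    obtain ⟨n, hn⟩ := exists_nat_gt (2 * δ / ρ)
    have hn0 : (0 : ℝ) < n := lt_of_le_of_lt (by positivity) hn
    have hn1 : (1 : ℝ) ≤ n := by exact_mod_cast hn0
    set ε := 2 * δ / n with hεdef
    have hε : 0 < ε := by positivity
    have hεn : ε * n = 2 * δ := by rw [hεdef]; field_simp
    have hερ : ε < ρ := by
      rw [hεdef, div_lt_iff₀ hn0]; rw [div_lt_iff₀ hρ] at hn; linarith
    have hcover : Metric.closedBall x δ ⊆
        ⋃ k ∈ Finset.range (n + 1), Metric.ball (x - δ + k * ε) ε := by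
      intro y hy
      rw [Metric.mem_closedBall, Real.dist_eq, abs_le] at hy
      have h0 : 0 ≤ (y - (x - δ)) / ε := div_nonneg (by linarith) hε.le
      have h1 := Nat.floor_le h0
      have h2 := Nat.lt_floor_add_one ((y - (x - δ)) / ε)
      rw [le_div_iff₀ hε] at h1
      rw [div_lt_iff₀ hε] at h2
      refine Set.mem_biUnion (x := ⌊(y - (x - δ)) / ε⌋₊) ?_ ?_
      · rw [Finset.mem_coe, Finset.mem_range, Nat.lt_succ_iff]
        refine Nat.floor_le_of_le ?_
        rw [div_le_iff₀ hε]
        linarith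
      · rw [Metric.mem_ball, Real.dist_eq, abs_lt]
        constructor <;> linarith
    calc μ.real (Metric.closedBall x δ)
        ≤ μ.real (⋃ k ∈ Finset.range (n + 1), Metric.ball (x - δ + k * ε) ε) :=
          measureReal_mono hcover (measure_ne_top _ _)
      _ ≤ ∑ k ∈ Finset.range (n + 1), μ.real (Metric.ball (x - δ + k * ε) ε) :=
          measureReal_biUnion_finset_le _ _
      _ ≤ ∑ k ∈ Finset.range (n + 1), 2 * ε * η := by
          refine Finset.sum_le_sum fun k hk => (measureReal_ball_le _ hε).trans ?_
          gcongr
          refine H _ ?_ ε hε hερ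
          have hk' : (k : ℝ) ≤ n := by exact_mod_cast Nat.lt_succ_iff.1 (Finset.mem_range.1 hk)
          have : 0 ≤ (k : ℝ) * ε := by positivity
          have : (k : ℝ) * ε ≤ n * ε := by gcongr
          rw [Metric.mem_closedBall, Real.dist_eq, abs_le]
          constructor <;> linarith
      _ = 2 * η * (ε * n + ε) := by
          rw [Finset.sum_const, Finset.card_range, nsmul_eq_mul]; push_cast; ring
      _ ≤ 8 * δ * η := by
          have : ε ≤ ε * n := le_mul_of_one_le_right hε.le hn1
          nlinarith
  have h0 : μ.real (Metric.closedBall x δ) ≤ 0 := by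
    refine le_of_forall_pos_le_add fun e he => ?_
    have := hle (e / (8 * δ)) (by positivity)
    rw [mul_div_cancel₀ _ (by positivity)] at this
    linarith
  exact (measureReal_eq_zero_iff).1 (le_antisymm h0 measureReal_nonneg)

/-- A finite measure is determined by its Stieltjes transform. -/
theorem eq_of_stieltjes_eq [IsFiniteMeasure μ] [IsFiniteMeasure ν]
    (h : ∀ z : ℂ, 0 < z.im → stieltjes μ z = stieltjes ν z) : μ = ν := by
  have hcauchy : Integrable fun s : ℝ => (1 + s ^ 2)⁻¹ := integrable_inv_one_add_sq
  -- By Fubini and x = l + ε s, pairing g with the imaginary part at height ε integrates against ρ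
  -- the Cauchy average of g at scale ε, which tends to π g.
  have key : ∀ (ρ : Measure ℝ) [IsFiniteMeasure ρ] (g : BoundedContinuousFunction ℝ ℝ) (ε : ℝ),
      0 < ε → ∫ x : ℝ, g x * (stieltjes ρ (x + ε * Complex.I)).im =
        ∫ l, (∫ s : ℝ, g (l + ε * s) * (1 + s ^ 2)⁻¹) ∂ρ := by
    intro ρ _ g ε hε
    have hk : ∀ x l : ℝ, (x + ε * Complex.I : ℂ).im /
        Complex.normSq (l - (x + ε * Complex.I)) = ε⁻¹ * (1 + ((x - l) / ε) ^ 2)⁻¹ := by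
      intro x l
      rw [Complex.normSq_apply]
      simp
      field_simp
      ring
    have h1 : ∀ x : ℝ, g x * (stieltjes ρ (x + ε * Complex.I)).im =
        ∫ l, g x * (ε⁻¹ * (1 + ((x - l) / ε) ^ 2)⁻¹) ∂ρ := by
      intro x
      rw [stieltjes_im (by simpa using hε), ← integral_const_mul]
      simp_rw [hk]
    have hsub : ∀ (G : ℝ → ℝ) (l : ℝ), ∫ x : ℝ, G x * (ε⁻¹ * (1 + ((x - l) / ε) ^ 2)⁻¹) =
        ∫ s : ℝ, G (l + ε * s) * (1 + s ^ 2)⁻¹ := by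
      intro G l
      have e1 := Measure.integral_comp_mul_left
        (fun x => G (x + l) * (ε⁻¹ * (1 + (x / ε) ^ 2)⁻¹)) ε
      have e2 := integral_add_right_eq_self (μ := volume)
        (fun x : ℝ => G x * (ε⁻¹ * (1 + ((x - l) / ε) ^ 2)⁻¹)) l
      simp only [add_sub_cancel_right] at e2
      rw [e2] at e1
      rw [abs_of_pos (inv_pos.2 hε), smul_eq_mul] at e1
      have e3 : ∫ x : ℝ, G x * (ε⁻¹ * (1 + ((x - l) / ε) ^ 2)⁻¹) =
          ε * (ε⁻¹ * ∫ x : ℝ, G x * (ε⁻¹ * (1 + ((x - l) / ε) ^ 2)⁻¹)) := by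
        rw [mul_inv_cancel_left₀ hε.ne']
      rw [e3, ← e1, ← integral_const_mul]
      refine integral_congr_ae (Eventually.of_forall fun s => ?_)
      simp only
      rw [mul_div_cancel_left₀ _ hε.ne', add_comm]
      field_simp
    have hint : ∀ l, Integrable fun x : ℝ => ε⁻¹ * (1 + ((x - l) / ε) ^ 2)⁻¹ := by
      intro l
      exact ((hcauchy.comp_div hε.ne').comp_sub_right l).const_mul _
    have hcontF : Continuous fun p : ℝ × ℝ => g p.1 * (ε⁻¹ * (1 + ((p.1 - p.2) / ε) ^ 2)⁻¹) := by
      refine (g.continuous.comp continuous_fst).mul (continuous_const.mul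
        (Continuous.inv₀ (by fun_prop) fun p => ?_))
      positivity
    have hF : Integrable (Function.uncurry fun x l : ℝ =>
        g x * (ε⁻¹ * (1 + ((x - l) / ε) ^ 2)⁻¹)) (volume.prod ρ) := by
      refine (integrable_prod_iff' hcontF.aestronglyMeasurable).2 ⟨?_, ?_⟩
      · refine Eventually.of_forall fun l => ?_
        exact (hint l).bdd_mul g.continuous.aestronglyMeasurable (c := ‖g‖)
          (Eventually.of_forall g.norm_coe_le_norm)
      · refine Integrable.of_bound (C := ‖g‖ * Real.pi)
          (hcontF.norm.stronglyMeasurable.integral_prod_left').aestronglyMeasurable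
          (Eventually.of_forall fun l => ?_)
        rw [Real.norm_of_nonneg (integral_nonneg fun _ => norm_nonneg _)]
        calc _ ≤ ∫ x : ℝ, ‖g‖ * (ε⁻¹ * (1 + ((x - l) / ε) ^ 2)⁻¹) := by
              refine integral_mono_of_nonneg (Eventually.of_forall fun _ => norm_nonneg _)
                ((hint l).const_mul _) (Eventually.of_forall fun x => ?_)
              simp only [norm_mul]
              gcongr
              · exact g.norm_coe_le_norm x
              · exact le_of_eq (Real.norm_of_nonneg (by positivity))
              · exact le_of_eq (Real.norm_of_nonneg (by positivity))
          _ = ‖g‖ * Real.pi := by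
              rw [hsub (fun _ => ‖g‖), integral_const_mul, integral_univ_inv_one_add_sq]
    simp_rw [h1]
    rw [integral_integral_swap hF]
    exact integral_congr_ae (Eventually.of_forall fun l => hsub g l)
  have lim : ∀ (ρ : Measure ℝ) [IsFiniteMeasure ρ] (g : BoundedContinuousFunction ℝ ℝ),
      Tendsto (fun n : ℕ => ∫ x : ℝ, g x *
        (stieltjes ρ (x + ((1 / ((n : ℝ) + 1) : ℝ) : ℂ) * Complex.I)).im) atTop
        (𝓝 (∫ l, g l * Real.pi ∂ρ)) := by
    intro ρ _ g
    have hlim0 : Tendsto (fun n : ℕ => (1 / ((n : ℝ) + 1) : ℝ)) atTop (𝓝 0) :=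
      tendsto_one_div_add_atTop_nhds_zero_nat
    simp_rw [fun n : ℕ => key ρ g (1 / ((n : ℝ) + 1)) (by positivity)]
    have hb : ∀ (e l s : ℝ), ‖g (l + e * s) * (1 + s ^ 2)⁻¹‖ ≤ ‖g‖ * (1 + s ^ 2)⁻¹ := by
      intro e l s
      rw [norm_mul]
      gcongr
      · exact g.norm_coe_le_norm _
      · exact le_of_eq (Real.norm_of_nonneg (by positivity))
    have hcont : ∀ e : ℝ, Continuous fun p : ℝ × ℝ => g (p.1 + e * p.2) * (1 + p.2 ^ 2)⁻¹ := by
      intro e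
      refine (g.continuous.comp (by fun_prop)).mul (Continuous.inv₀ (by fun_prop) fun p => ?_)
      positivity
    refine tendsto_integral_of_dominated_convergence (fun _ => ‖g‖ * Real.pi) ?_
      (integrable_const _) ?_ ?_
    · intro n
      exact ((hcont _).stronglyMeasurable.integral_prod_right').aestronglyMeasurable
    · intro n
      refine Eventually.of_forall fun l => ?_
      calc _ ≤ ∫ s : ℝ, ‖g‖ * (1 + s ^ 2)⁻¹ :=
            norm_integral_le_of_norm_le (hcauchy.const_mul _) (Eventually.of_forall (hb _ l))
        _ = _ := by rw [integral_const_mul, integral_univ_inv_one_add_sq]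
    · refine Eventually.of_forall fun l => ?_
      have : g l * Real.pi = ∫ s : ℝ, g l * (1 + s ^ 2)⁻¹ := by
        rw [integral_const_mul, integral_univ_inv_one_add_sq]
      rw [this]
      refine tendsto_integral_of_dominated_convergence (fun s => ‖g‖ * (1 + s ^ 2)⁻¹) ?_
        (hcauchy.const_mul _) (fun n => Eventually.of_forall (hb _ l))
        (Eventually.of_forall fun s => ?_)
      · intro n
        exact ((hcont _).comp (Continuous.prodMk_right l)).aestronglyMeasurable
      · refine Tendsto.mul_const _ ((g.continuous.tendsto _).comp ?_)
        have := (hlim0.mul_const s).const_add l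
        simpa using this
  refine ext_of_forall_integral_eq_of_IsFiniteMeasure fun g => ?_
  have e1 := lim μ g
  have e2 := lim ν g
  have e3 : ∀ (n : ℕ) (x : ℝ), stieltjes μ (x + ((1 / ((n : ℝ) + 1) : ℝ) : ℂ) * Complex.I) =
      stieltjes ν (x + ((1 / ((n : ℝ) + 1) : ℝ) : ℂ) * Complex.I) := by
    intro n x
    apply h
    rw [Complex.add_im, Complex.ofReal_im, Complex.im_ofReal_mul, Complex.I_im, zero_add, mul_one]
    positivity
  simp_rw [e3] at e1
  have e4 := tendsto_nhds_unique e1 e2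
  rw [integral_mul_const, integral_mul_const] at e4
  exact mul_right_cancel₀ Real.pi_ne_zero e4

end Stieltjes

/-! ### The Herglotz representation, by transfer to the unit disc. -/

section Herglotz

/-- The Cayley transform from the unit disc to the upper half-plane. -/
def cayley (ξ : ℂ) : ℂ := Complex.I * (1 + ξ) / (1 - ξ)

theorem one_sub_ne_zero_of_norm_lt {ξ : ℂ} (hξ : ‖ξ‖ < 1) : 1 - ξ ≠ 0 := by
  intro h
  rw [sub_eq_zero] at h
  rw [← h, norm_one] at hξ
  exact lt_irrefl _ hξ

theorem cayley_im_pos {ξ : ℂ} (hξ : ‖ξ‖ < 1) : 0 < (cayley ξ).im := by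
  have h1 : 0 < Complex.normSq (1 - ξ) :=
    Complex.normSq_pos.2 (one_sub_ne_zero_of_norm_lt hξ)
  have h2 : Complex.normSq ξ < 1 := by
    rw [Complex.normSq_eq_norm_sq]; nlinarith [norm_nonneg ξ]
  have h3 : (cayley ξ).im = (1 - Complex.normSq ξ) / Complex.normSq (1 - ξ) := by
    rw [cayley, Complex.div_im, ← sub_div]
    congr 1
    simp [Complex.normSq_apply]
    ring
  rw [h3]
  exact div_pos (by linarith) h1

theorem differentiableAt_cayley {ξ : ℂ} (hξ : ‖ξ‖ < 1) : DifferentiableAt ℂ cayley ξ := by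
  unfold cayley
  exact DifferentiableAt.div (by fun_prop) (by fun_prop) (one_sub_ne_zero_of_norm_lt hξ)

theorem add_I_ne_zero {z : ℂ} (hz : 0 < z.im) : z + Complex.I ≠ 0 := by
  intro h
  have := congrArg Complex.im h
  simp at this
  linarith

theorem norm_cayley_inv_lt {z : ℂ} (hz : 0 < z.im) :
    ‖(z - Complex.I) / (z + Complex.I)‖ < 1 := by
  rw [norm_div, div_lt_one (norm_pos_iff.2 (add_I_ne_zero hz))]
  refine lt_of_pow_lt_pow_left₀ 2 (norm_nonneg _) ?_
  rw [← Complex.normSq_eq_norm_sq, ← Complex.normSq_eq_norm_sq, Complex.normSq_apply,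
    Complex.normSq_apply]
  simp
  nlinarith

theorem cayley_cayley_inv {z : ℂ} (hz : 0 < z.im) :
    cayley ((z - Complex.I) / (z + Complex.I)) = z := by
  have h := add_I_ne_zero hz
  have h2 : Complex.I ≠ 0 := Complex.I_ne_zero
  have e1 : 1 - (z - Complex.I) / (z + Complex.I) = 2 * Complex.I / (z + Complex.I) := by
    field_simp; ring
  have e2 : 1 + (z - Complex.I) / (z + Complex.I) = 2 * z / (z + Complex.I) := by
    field_simp; ring
  rw [cayley, e1, e2]
  field_simp

/-- The point of the real line corresponding to the point of angle `θ` of the circle. -/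
def lineOf (θ : ℝ) : ℝ :=
  (-(Complex.I * (circleMap 0 1 θ + 1)) / (circleMap 0 1 θ - 1)).re

/-- The weight relating the Poisson kernels of the disc and of the half-plane. -/
def weightOf (θ : ℝ) : ℝ := 4 / Complex.normSq (circleMap 0 1 θ - 1)

/-- The ratio of the disc kernel to the half-plane kernel depends only on the boundary point, so it
can be absorbed in the measure. -/
theorem poissonKernel_cayley {z : ℂ} (hz : 0 < z.im) {θ : ℝ} (hθ : circleMap 0 1 θ ≠ 1) :
    poissonKernel 0 ((z - Complex.I) / (z + Complex.I)) (circleMap 0 1 θ) =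
      weightOf θ * (z.im / Complex.normSq (lineOf θ - z)) := by
  set e := circleMap 0 1 θ with he
  have hne : ‖e‖ = 1 := by simp [he]
  have he1 : e - 1 ≠ 0 := sub_ne_zero.2 hθ
  have hsq : e.re * e.re + e.im * e.im = 1 := by
    rw [← Complex.normSq_apply, Complex.normSq_eq_norm_sq, hne]; norm_num
  have hreal : -(Complex.I * (e + 1)) / (e - 1) = (lineOf θ : ℂ) := by
    apply Complex.ext
    · rw [Complex.ofReal_re, lineOf]
    · rw [Complex.ofReal_im, Complex.div_im, ← sub_div]
      refine div_eq_zero_iff.2 (Or.inl ?_)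
      simp
      linear_combination -hsq
  have h1 : e - (z - Complex.I) / (z + Complex.I) =
      (e - 1) * (z - lineOf θ) / (z + Complex.I) := by
    rw [← hreal]
    have := add_I_ne_zero hz
    field_simp
    ring
  have hp1 := norm_ne_zero_iff.2 (add_I_ne_zero hz)
  have hp2 := norm_ne_zero_iff.2 he1
  have hp3 := norm_ne_zero_iff.2 (ofReal_sub_ne_zero hz (lineOf θ))
  have h4 : ‖z + Complex.I‖ ^ 2 - ‖z - Complex.I‖ ^ 2 = 4 * z.im := by
    rw [← Complex.normSq_eq_norm_sq, ← Complex.normSq_eq_norm_sq, Complex.normSq_apply,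
      Complex.normSq_apply]
    simp
    ring
  rw [poissonKernel_def, weightOf, ← he, Complex.normSq_eq_norm_sq, Complex.normSq_eq_norm_sq,
    sub_zero, sub_zero, h1, hne, norm_div, norm_div, norm_mul, norm_sub_rev z (lineOf θ : ℂ)]
  have h5 : z.im = (‖z + Complex.I‖ ^ 2 - ‖z - Complex.I‖ ^ 2) / 4 := by linarith
  rw [h5]
  field_simp

/-- The angle sent to infinity: an atom there contributes a linear term to Im f. -/
theorem poissonKernel_cayley_one {z : ℂ} (hz : 0 < z.im) {θ : ℝ} (hθ : circleMap 0 1 θ = 1) :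
    poissonKernel 0 ((z - Complex.I) / (z + Complex.I)) (circleMap 0 1 θ) = z.im := by
  have hp1 := norm_ne_zero_iff.2 (add_I_ne_zero hz)
  have e1 : 1 - (z - Complex.I) / (z + Complex.I) = 2 * Complex.I / (z + Complex.I) := by
    have := add_I_ne_zero hz
    field_simp; ring
  have h4 : ‖z + Complex.I‖ ^ 2 - ‖z - Complex.I‖ ^ 2 = 4 * z.im := by
    rw [← Complex.normSq_eq_norm_sq, ← Complex.normSq_eq_norm_sq, Complex.normSq_apply,
      Complex.normSq_apply]
    simp
    ring
  rw [poissonKernel_def, hθ, sub_zero, sub_zero, e1, norm_div, norm_div, norm_mul, norm_one,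
    Complex.norm_I, Complex.norm_ofNat]
  field_simp
  linarith

theorem continuous_poissonKernel_circleMap {ξ : ℂ} (hξ : ‖ξ‖ < 1) :
    Continuous fun θ : ℝ => poissonKernel 0 ξ (circleMap 0 1 θ) := by
  unfold poissonKernel
  refine Continuous.div (by fun_prop) (by fun_prop) fun θ h => ?_
  have h1 : circleMap 0 1 θ - 0 - (ξ - 0) = 0 := by simpa using h
  simp only [sub_zero, sub_eq_zero] at h1
  rw [← h1] at hξ
  simp at hξ

theorem norm_poissonKernel_circleMap_le {ξ : ℂ} (hξ : ‖ξ‖ < 1) (θ : ℝ) :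
    ‖poissonKernel 0 ξ (circleMap 0 1 θ)‖ ≤ 1 / (1 - ‖ξ‖) ^ 2 := by
  have h1 : 1 - ‖ξ‖ ≤ ‖circleMap 0 1 θ - ξ‖ := by
    have := norm_sub_norm_le (circleMap 0 1 θ) ξ
    simpa using this
  have h2 : 0 < 1 - ‖ξ‖ := by linarith
  rw [poissonKernel_def, sub_zero, sub_zero, norm_div, norm_pow, norm_norm]
  have h3 : ‖‖circleMap 0 1 θ‖ ^ 2 - ‖ξ‖ ^ 2‖ ≤ 1 := by
    rw [Real.norm_eq_abs, abs_le]
    have : ‖circleMap 0 1 θ‖ = 1 := by simp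
    rw [this]
    constructor <;> nlinarith [norm_nonneg ξ]
  gcongr

theorem poissonKernel_zero (θ : ℝ) : poissonKernel 0 0 (circleMap 0 1 θ) = 1 := by
  simp [poissonKernel_def]

variable {f : ℂ → ℂ}

/-- After shrinking by r < 1 the function is holomorphic across the unit circle, so Poisson's
formula needs nothing of f at the boundary. -/
theorem circleAverage_im_cayley (hf : DifferentiableOn ℂ f {z | 0 < z.im}) {r : ℝ}
    (hr0 : 0 < r) (hr1 : r < 1) {ξ : ℂ} (hξ : ‖ξ‖ < 1) :
    (2 * Real.pi)⁻¹ * ∫ θ in (0)..(2 * Real.pi), poissonKernel 0 ξ (circleMap 0 1 θ) *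
      (f (cayley (r * circleMap 0 1 θ))).im = (f (cayley (r * ξ))).im := by
  have hlt : ∀ ζ : ℂ, ‖ζ‖ ≤ 1 → ‖(r : ℂ) * ζ‖ < 1 := by
    intro ζ hζ
    rw [norm_mul, Complex.norm_real, Real.norm_of_nonneg hr0.le]
    nlinarith [norm_nonneg ζ]
  have hd : ∀ ζ : ℂ, ‖ζ‖ ≤ 1 → DifferentiableAt ℂ (fun ζ => f (cayley (r * ζ))) ζ := by
    intro ζ hζ
    have h1 : DifferentiableAt ℂ f (cayley (r * ζ)) :=
      hf.differentiableAt ((isOpen_lt continuous_const Complex.continuous_im).mem_nhds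
        (cayley_im_pos (hlt ζ hζ)))
    exact h1.comp ζ ((differentiableAt_cayley (hlt ζ hζ)).comp ζ (by fun_prop))
  have hF : DiffContOnCl ℂ (fun ζ => f (cayley (r * ζ))) (Metric.ball 0 1) := by
    refine DifferentiableOn.diffContOnCl fun ζ hζ => ?_
    rw [closure_ball _ one_ne_zero, mem_closedBall_zero_iff] at hζ
    exact (hd ζ hζ).differentiableWithinAt
  have h := hF.circleAverage_poissonKernel_smul (w := ξ) (by simpa using hξ)
  have hcont : Continuous fun θ : ℝ => (poissonKernel 0 ξ (circleMap 0 1 θ)) •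
      f (cayley (r * circleMap 0 1 θ)) := by
    refine (continuous_poissonKernel_circleMap hξ).smul ?_
    refine continuous_iff_continuousAt.2 fun θ => ?_
    exact ContinuousAt.comp (f := circleMap 0 1) (g := fun ζ => f (cayley (r * ζ)))
      (hd _ (by simp)).continuousAt (continuous_circleMap 0 1).continuousAt
  rw [Real.circleAverage] at h
  have h2 := congrArg Complex.im h
  simp only [Pi.smul_apply', Complex.real_smul, Complex.im_ofReal_mul] at h2
  rw [← h2]
  congr 1
  have h3 := Complex.imCLM.intervalIntegral_comp_comm
    (hcont.intervalIntegrable (μ := volume) 0 (2 * Real.pi))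
  simp only [Complex.imCLM_apply, Complex.real_smul, Complex.im_ofReal_mul] at h3
  exact h3

/-- The Herglotz representation of the imaginary part on the disc, with a measure on the angles. -/
theorem exists_measure_circle (hf : DifferentiableOn ℂ f {z | 0 < z.im})
    (hpos : ∀ z, 0 < z.im → 0 ≤ (f z).im) :
    ∃ σ : FiniteMeasure ℝ, ∀ ξ : ℂ, ‖ξ‖ < 1 →
      ∫ θ, poissonKernel 0 ξ (circleMap 0 1 θ) ∂(σ : Measure ℝ) = (f (cayley ξ)).im := by
  -- The shift by 2 keeps the radius positive at n = 0.
  set r : ℕ → ℝ := fun n => 1 - 1 / ((n : ℝ) + 2) with hr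
  have hr0 : ∀ n, 0 < r n := fun n => by
    simp only [hr, sub_pos]
    rw [div_lt_one (by positivity)]
    have : (0 : ℝ) ≤ n := by positivity
    linarith
  have hr1 : ∀ n, r n < 1 := fun n => by
    simp only [hr]
    have : (0 : ℝ) < 1 / ((n : ℝ) + 2) := by positivity
    linarith
  have hrlim : Tendsto r atTop (𝓝 1) := by
    have h := (tendsto_one_div_add_atTop_nhds_zero_nat (𝕜 := ℝ)).comp (tendsto_add_atTop_nat 1)
    have h2 := h.const_sub 1
    rw [sub_zero] at h2
    refine h2.congr fun n => ?_
    simp only [hr, Function.comp]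
    push_cast
    congr 2
    ring
  set d : ℕ → ℝ → ℝ := fun n θ =>
    (2 * Real.pi)⁻¹ * (f (cayley (r n * circleMap 0 1 θ))).im with hd
  have hnorm : ∀ (n : ℕ) (ζ : ℂ), ‖ζ‖ ≤ 1 → ‖(r n : ℂ) * ζ‖ < 1 := by
    intro n ζ hζ
    rw [norm_mul, Complex.norm_real, Real.norm_of_nonneg (hr0 n).le]
    nlinarith [norm_nonneg ζ, hr0 n, hr1 n]
  have hcontF : ∀ ξ : ℂ, ‖ξ‖ < 1 → ContinuousAt (fun ξ => (f (cayley ξ)).im) ξ := by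
    intro ξ hξ
    have h1 : DifferentiableAt ℂ f (cayley ξ) :=
      hf.differentiableAt ((isOpen_lt continuous_const Complex.continuous_im).mem_nhds
        (cayley_im_pos hξ))
    exact Complex.continuous_im.continuousAt.comp
      (h1.continuousAt.comp (differentiableAt_cayley hξ).continuousAt)
  have hdcont : ∀ n, Continuous (d n) := by
    intro n
    refine continuous_const.mul (continuous_iff_continuousAt.2 fun θ => ?_)
    exact ContinuousAt.comp (f := fun θ => (r n : ℂ) * circleMap 0 1 θ)
      (g := fun ξ => (f (cayley ξ)).im) (hcontF _ (hnorm n _ (by simp)))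
      (continuous_const.mul (continuous_circleMap 0 1)).continuousAt
  have hdpos : ∀ n θ, 0 ≤ d n θ := fun n θ =>
    mul_nonneg (by positivity) (hpos _ (cayley_im_pos (hnorm n _ (by simp))))
  set m : ℕ → Measure ℝ := fun n =>
    (volume.restrict (Set.Ioc 0 (2 * Real.pi))).withDensity fun θ => ENNReal.ofReal (d n θ)
    with hm
  have hint : ∀ n (g : ℝ → ℝ), ∫ θ, g θ ∂(m n) =
      ∫ θ in (0)..(2 * Real.pi), g θ * d n θ := by
    intro n g
    rw [hm, integral_withDensity_eq_integral_toReal_smul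
      ((hdcont n).measurable.ennreal_ofReal) (Eventually.of_forall fun _ => ENNReal.ofReal_lt_top),
      intervalIntegral.integral_of_le (by positivity)]
    refine integral_congr_ae (Eventually.of_forall fun θ => ?_)
    simp only [smul_eq_mul, ENNReal.toReal_ofReal (hdpos n θ)]
    ring
  have hfin : ∀ n, IsFiniteMeasure (m n) := by
    intro n
    refine isFiniteMeasure_withDensity_ofReal (Integrable.hasFiniteIntegral ?_)
    exact ((hdcont n).integrableOn_Icc (a := 0) (b := 2 * Real.pi)).mono_set
      Set.Ioc_subset_Icc_self
  have hP : ∀ n (ξ : ℂ), ‖ξ‖ < 1 → ∫ θ, poissonKernel 0 ξ (circleMap 0 1 θ) ∂(m n) =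
      (f (cayley (r n * ξ))).im := by
    intro n ξ hξ
    rw [hint, ← circleAverage_im_cayley hf (hr0 n) (hr1 n) hξ,
      ← intervalIntegral.integral_const_mul]
    refine intervalIntegral.integral_congr fun θ _ => ?_
    simp only [hd]
    ring
  set σ : ℕ → FiniteMeasure ℝ := fun n => ⟨m n, hfin n⟩ with hσ
  have hmass : ∀ n, (σ n).mass ≤ ((f Complex.I).im).toNNReal := by
    intro n
    have h1 := hP n 0 (by simp)
    simp only [poissonKernel_zero, mul_zero] at h1
    rw [show cayley 0 = Complex.I by simp [cayley]] at h1
    rw [integral_const, smul_eq_mul, mul_one] at h1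
    rw [← h1]
    apply le_of_eq
    rw [← NNReal.coe_inj, Real.coe_toNNReal _ measureReal_nonneg]
    rfl
  have hsupp : ∀ n, (σ n) (Set.Icc 0 (2 * Real.pi))ᶜ = 0 := by
    intro n
    rw [FiniteMeasure.null_iff_toMeasure_null]
    have h1 : m n ≪ volume.restrict (Set.Ioc 0 (2 * Real.pi)) :=
      withDensity_absolutelyContinuous _ _
    refine h1 ?_
    rw [Measure.restrict_apply measurableSet_Icc.compl]
    have : (Set.Icc 0 (2 * Real.pi))ᶜ ∩ Set.Ioc 0 (2 * Real.pi) = ∅ := by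
      ext x
      simp only [Set.mem_inter_iff, Set.mem_compl_iff, Set.mem_Icc, Set.mem_Ioc,
        Set.mem_empty_iff_false, iff_false]
      rintro ⟨h1, h2, h3⟩
      exact h1 ⟨h2.le, h3⟩
    rw [this, measure_empty]
  -- Weak compactness of measures of bounded mass on a fixed compact interval; the mass is the value
  -- of the Poisson integral at the centre. The limit is taken along an ultrafilter.
  have hK := isCompact_setOfPred_finiteMeasure_le_of_isCompact (E := ℝ)
    ((f Complex.I).im).toNNReal (isCompact_Icc (a := (0 : ℝ)) (b := 2 * Real.pi))
  obtain ⟨τ, -, hτ⟩ := hK.ultrafilter_le_nhds' (Ultrafilter.map σ (hyperfilter ℕ))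
    (by
      rw [Ultrafilter.mem_map]
      exact univ_mem' fun n => ⟨hmass n, hsupp n⟩)
  have hτ' : Tendsto σ (hyperfilter ℕ) (𝓝 τ) := hτ
  refine ⟨τ, fun ξ hξ => ?_⟩
  have h1 := (FiniteMeasure.tendsto_iff_forall_integral_tendsto.1 hτ')
    (BoundedContinuousFunction.ofNormedAddCommGroup
      (fun θ : ℝ => poissonKernel 0 ξ (circleMap 0 1 θ)) (continuous_poissonKernel_circleMap hξ)
      _ (norm_poissonKernel_circleMap_le hξ))
  simp only [BoundedContinuousFunction.coe_ofNormedAddCommGroup] at h1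
  have h2 : Tendsto (fun n => (f (cayley (r n * ξ))).im) atTop (𝓝 (f (cayley ξ)).im) := by
    refine (hcontF ξ hξ).tendsto.comp ?_
    have h3 : Tendsto (fun n => (r n : ℂ) * ξ) atTop (𝓝 (((1 : ℝ) : ℂ) * ξ)) :=
      ((Complex.continuous_ofReal.tendsto 1).comp hrlim).mul_const ξ
    simpa using h3
  refine tendsto_nhds_unique h1 ((h2.mono_left Nat.hyperfilter_le_atTop).congr fun n => ?_)
  exact (hP n ξ hξ).symm

theorem measurable_lineOf : Measurable lineOf := by
  unfold lineOf
  have : Measurable (circleMap 0 1) := (continuous_circleMap 0 1).measurable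
  fun_prop

theorem measurable_weightOf : Measurable weightOf := by
  unfold weightOf
  have : Measurable (circleMap 0 1) := (continuous_circleMap 0 1).measurable
  have h2 : Measurable Complex.normSq := Complex.continuous_normSq.measurable
  exact measurable_const.div (h2.comp (this.sub_const 1))

theorem weightOf_nonneg (θ : ℝ) : 0 ≤ weightOf θ :=
  div_nonneg (by norm_num) (Complex.normSq_nonneg _)

theorem differentiableOn_stieltjes {μ : Measure ℝ} [IsFiniteMeasure μ] :
    DifferentiableOn ℂ (stieltjes μ) {z | 0 < z.im} := by
  intro z hz
  refine (hasDerivAt_resolventTransform z ?_).differentiableAt.differentiableWithinAt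
  rintro ⟨x, -, rfl⟩
  simp at hz

/-- **Herglotz representation**: a holomorphic function on the upper half-plane with nonnegative
imaginary part which is `O(1/y)` on the imaginary axis is the Stieltjes transform of a finite
measure. -/
theorem exists_stieltjes_eq (hf : DifferentiableOn ℂ f {z | 0 < z.im})
    (hpos : ∀ z, 0 < z.im → 0 ≤ (f z).im) {C : ℝ}
    (hC : ∀ y : ℝ, 0 < y → y * ‖f (y * Complex.I)‖ ≤ C) :
    ∃ μ : Measure ℝ, IsFiniteMeasure μ ∧ ∀ z, 0 < z.im → stieltjes μ z = f z := by
  obtain ⟨σ, hσ⟩ := exists_measure_circle hf hpos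
  have hσz : ∀ z, 0 < z.im → ∫ θ, poissonKernel 0 ((z - Complex.I) / (z + Complex.I))
      (circleMap 0 1 θ) ∂(σ : Measure ℝ) = (f z).im := fun z hz => by
    rw [hσ _ (norm_cayley_inv_lt hz), cayley_cayley_inv hz]
  have hPint : ∀ z, 0 < z.im → Integrable (fun θ => poissonKernel 0
      ((z - Complex.I) / (z + Complex.I)) (circleMap 0 1 θ)) (σ : Measure ℝ) := fun z hz =>
    Integrable.of_bound
      (continuous_poissonKernel_circleMap (norm_cayley_inv_lt hz)).aestronglyMeasurable _
      (Eventually.of_forall (norm_poissonKernel_circleMap_le (norm_cayley_inv_lt hz)))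
  have hPnonneg : ∀ z, 0 < z.im → ∀ θ, 0 ≤ poissonKernel 0
      ((z - Complex.I) / (z + Complex.I)) (circleMap 0 1 θ) := by
    intro z hz θ
    by_cases hθ : circleMap 0 1 θ = 1
    · rw [poissonKernel_cayley_one hz hθ]; exact hz.le
    · rw [poissonKernel_cayley hz hθ]
      exact mul_nonneg (weightOf_nonneg θ) (div_nonneg hz.le (Complex.normSq_nonneg _))
  have hy : ∀ y : ℝ, 0 < y → 0 < (y * Complex.I : ℂ).im := fun y hy => by simpa using hy
  have hbound : ∀ y : ℝ, 0 < y → y * ∫ θ, poissonKernel 0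
      ((y * Complex.I - Complex.I) / (y * Complex.I + Complex.I))
      (circleMap 0 1 θ) ∂(σ : Measure ℝ) ≤ C := by
    intro y h
    rw [hσz _ (hy y h)]
    refine le_trans ?_ (hC y h)
    gcongr
    exact (le_abs_self _).trans (Complex.abs_im_le_norm _)
  have hC0 : 0 ≤ C := le_trans (by positivity) (hC 1 one_pos)
  set A : Set ℝ := {θ | circleMap 0 1 θ = 1} with hA
  have hAmeas : MeasurableSet A :=
    (isClosed_eq (continuous_circleMap 0 1) continuous_const).measurableSet
  -- An atom at infinity would make y Im f(iy) grow like y², against the bound C.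
  have hAnull : (σ : Measure ℝ) A = 0 := by
    have h1 : ∀ y : ℝ, 0 < y → y * (y * (σ : Measure ℝ).real A) ≤ C := by
      intro y h
      refine le_trans ?_ (hbound y h)
      gcongr
      calc y * (σ : Measure ℝ).real A = ∫ θ, A.indicator (fun _ => y) θ ∂(σ : Measure ℝ) := by
            rw [integral_indicator_const _ hAmeas, smul_eq_mul]; ring
        _ ≤ _ := by
            refine integral_mono ((integrable_const y).indicator hAmeas) (hPint _ (hy y h))
              fun θ => ?_
            by_cases hθ : θ ∈ A
            · rw [Set.indicator_of_mem hθ]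
              simp only
              rw [poissonKernel_cayley_one (hy y h) hθ]
              simp
            · rw [Set.indicator_of_notMem hθ]
              exact hPnonneg _ (hy y h) θ
    by_contra hne
    have hpos : 0 < (σ : Measure ℝ).real A :=
      lt_of_le_of_ne measureReal_nonneg fun h => hne ((measureReal_eq_zero_iff).1 h.symm)
    have h2 := h1 ((C + 1) / (σ : Measure ℝ).real A + 1) (by positivity)
    have h3 : ((C + 1) / (σ : Measure ℝ).real A + 1) * (σ : Measure ℝ).real A =
        C + 1 + (σ : Measure ℝ).real A := by field_simp
    rw [h3] at h2
    have h4 : 0 < (C + 1) / (σ : Measure ℝ).real A := by positivity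
    nlinarith
  have hae : ∀ᵐ θ ∂(σ : Measure ℝ), circleMap 0 1 θ ≠ 1 := by
    rw [ae_iff]; simpa [hA] using hAnull
  have hPae : ∀ z, 0 < z.im → (fun θ => poissonKernel 0
      ((z - Complex.I) / (z + Complex.I)) (circleMap 0 1 θ)) =ᵐ[(σ : Measure ℝ)]
      fun θ => weightOf θ * (z.im / Complex.normSq (lineOf θ - z)) := fun z hz => by
    filter_upwards [hae] with θ hθ using poissonKernel_cayley hz hθ
  -- At z = iy, y times the integrand is the weight times y²/(x² + y²), which tends to the weight;
  -- Fatou bounds the total mass by C.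
  have hweight : ∫⁻ θ, ENNReal.ofReal (weightOf θ) ∂(σ : Measure ℝ) ≤ ENNReal.ofReal C := by
    set g : ℕ → ℝ → ℝ := fun n θ =>
      ((n : ℝ) + 1) * (weightOf θ * (((n : ℝ) + 1) /
        Complex.normSq (lineOf θ - (((n : ℝ) + 1 : ℝ) : ℂ) * Complex.I))) with hg
    have hval : ∀ n θ, g n θ = weightOf θ *
        (((n : ℝ) + 1) ^ 2 / (lineOf θ ^ 2 + ((n : ℝ) + 1) ^ 2)) := by
      intro n θ
      simp only [hg]
      rw [Complex.normSq_apply]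
      simp only [Complex.sub_re, Complex.ofReal_re, Complex.re_ofReal_mul, Complex.I_re,
        Complex.sub_im, Complex.ofReal_im, Complex.im_ofReal_mul, Complex.I_im]
      ring_nf
    have hlim : ∀ θ, Tendsto (fun n => g n θ) atTop (𝓝 (weightOf θ)) := by
      intro θ
      simp_rw [hval]
      have h0 : Tendsto (fun n : ℕ => (1 / ((n : ℝ) + 1)) ^ 2) atTop (𝓝 (0 ^ 2)) :=
        (tendsto_one_div_add_atTop_nhds_zero_nat (𝕜 := ℝ)).pow 2
      have h1 : Tendsto (fun n : ℕ => weightOf θ *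
          (1 / (lineOf θ ^ 2 * (1 / ((n : ℝ) + 1)) ^ 2 + 1))) atTop
          (𝓝 (weightOf θ * (1 / (lineOf θ ^ 2 * 0 ^ 2 + 1)))) :=
        ((tendsto_const_nhds (x := (1 : ℝ))).div ((h0.const_mul _).add_const 1)
          (by norm_num)).const_mul _
      have h2 : weightOf θ * (1 / (lineOf θ ^ 2 * 0 ^ 2 + 1)) = weightOf θ := by norm_num
      rw [h2] at h1
      refine h1.congr fun n => ?_
      have : (n : ℝ) + 1 ≠ 0 := by positivity
      field_simp
    have hgmeas : ∀ n, Measurable (g n) := by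
      intro n
      simp_rw [funext (hval n)]
      have h1 := measurable_weightOf
      have h2 := measurable_lineOf
      fun_prop
    have hint : ∀ n, ∫⁻ θ, ENNReal.ofReal (g n θ) ∂(σ : Measure ℝ) ≤ ENNReal.ofReal C := by
      intro n
      have hn : (0 : ℝ) < (n : ℝ) + 1 := by positivity
      have h1 : g n =ᵐ[(σ : Measure ℝ)] fun θ => ((n : ℝ) + 1) * poissonKernel 0
          (((((n : ℝ) + 1 : ℝ) : ℂ) * Complex.I - Complex.I) /
            ((((n : ℝ) + 1 : ℝ) : ℂ) * Complex.I + Complex.I)) (circleMap 0 1 θ) := by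
        filter_upwards [hPae _ (hy _ hn)] with θ hθ
        rw [hθ]
        simp only [hg, Complex.im_ofReal_mul, Complex.I_im, mul_one]
      rw [← ofReal_integral_eq_lintegral_ofReal]
      · refine ENNReal.ofReal_le_ofReal ?_
        rw [integral_congr_ae h1, integral_const_mul]
        exact hbound _ hn
      · exact ((hPint _ (hy _ hn)).const_mul _).congr h1.symm
      · refine Eventually.of_forall fun θ => ?_
        rw [hval]
        exact mul_nonneg (weightOf_nonneg θ) (by positivity)
    calc ∫⁻ θ, ENNReal.ofReal (weightOf θ) ∂(σ : Measure ℝ)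
        = ∫⁻ θ, liminf (fun n => ENNReal.ofReal (g n θ)) atTop ∂(σ : Measure ℝ) := by
          refine lintegral_congr fun θ => ?_
          exact ((ENNReal.tendsto_ofReal (hlim θ)).liminf_eq).symm
      _ ≤ liminf (fun n => ∫⁻ θ, ENNReal.ofReal (g n θ) ∂(σ : Measure ℝ)) atTop :=
          lintegral_liminf_le fun n => (hgmeas n).ennreal_ofReal
      _ ≤ ENNReal.ofReal C :=
          liminf_le_of_frequently_le' (Frequently.of_forall hint)
  set ρ : Measure ℝ := (σ : Measure ℝ).withDensity fun θ => ENNReal.ofReal (weightOf θ) with hρ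
  have hρfin : IsFiniteMeasure ρ :=
    isFiniteMeasure_withDensity (ne_top_of_le_ne_top ENNReal.ofReal_ne_top hweight)
  set μ : Measure ℝ := ρ.map lineOf with hμ
  have hμfin : IsFiniteMeasure μ := inferInstance
  refine ⟨μ, hμfin, ?_⟩
  have him : ∀ z, 0 < z.im → (stieltjes μ z).im = (f z).im := by
    intro z hz
    have hcont : Continuous fun x : ℝ => z.im / Complex.normSq (x - z) := by
      refine Continuous.div (by fun_prop)
        (Complex.continuous_normSq.comp (by fun_prop)) fun x => ?_
      exact (Complex.normSq_pos.2 (ofReal_sub_ne_zero hz x)).ne'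
    rw [stieltjes_im hz, hμ, integral_map measurable_lineOf.aemeasurable
      hcont.aestronglyMeasurable, hρ,
      integral_withDensity_eq_integral_toReal_smul measurable_weightOf.ennreal_ofReal
        (Eventually.of_forall fun _ => ENNReal.ofReal_lt_top), ← hσz z hz,
      integral_congr_ae (hPae z hz)]
    refine integral_congr_ae (Eventually.of_forall fun θ => ?_)
    simp only [smul_eq_mul, ENNReal.toReal_ofReal (weightOf_nonneg θ)]
  have hopen : IsOpen {z : ℂ | 0 < z.im} := isOpen_lt continuous_const Complex.continuous_im
  have hdiff : AnalyticOnNhd ℂ (fun z => stieltjes μ z - f z) {z | 0 < z.im} :=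
    (differentiableOn_stieltjes.sub hf).analyticOnNhd hopen
  have hreal : ∀ z : ℂ, 0 < z.im → (stieltjes μ z - f z).im = 0 := fun z hz => by
    rw [Complex.sub_im, him z hz, sub_self]
  have hI : 0 < (Complex.I).im := by simp
  -- A holomorphic function with zero imaginary part has no open image, hence is constant.
  obtain ⟨k, hk⟩ : ∃ k, ∀ z ∈ {z : ℂ | 0 < z.im}, stieltjes μ z - f z = k := by
    refine (hdiff.is_constant_or_isOpen (convex_halfSpace_im_gt 0).isPreconnected).resolve_right
      fun h => ?_
    have h1 := h _ subset_rfl hopen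
    have h2 := h1.mem_nhds (Set.mem_image_of_mem _ hI)
    obtain ⟨ε, hε, hball⟩ := Metric.mem_nhds_iff.1 h2
    have h3 : stieltjes μ Complex.I - f Complex.I + ((ε / 2 : ℝ) : ℂ) * Complex.I ∈
        Metric.ball (stieltjes μ Complex.I - f Complex.I) ε := by
      rw [mem_ball_iff_norm, add_sub_cancel_left, norm_mul, Complex.norm_I, Complex.norm_real,
        Real.norm_of_nonneg (by positivity)]
      linarith
    obtain ⟨z, hz, hzeq⟩ := hball h3
    have h4 := congrArg Complex.im hzeq
    simp only at h4
    rw [hreal z hz, Complex.add_im, hreal _ hI, Complex.im_ofReal_mul, Complex.I_im] at h4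
    linarith
  -- Both functions are O(1/y) on the imaginary axis.
  have hk0 : k = 0 := by
    have h1 : ∀ y : ℝ, 0 < y → y * ‖k‖ ≤ μ.real Set.univ + C := by
      intro y h
      rw [← hk _ (hy y h)]
      have h2 := norm_stieltjes_le (μ := μ) (hy y h)
      have h3 := hC y h
      rw [Complex.im_ofReal_mul, Complex.I_im, mul_one] at h2
      have h4 : y * ‖stieltjes μ (y * Complex.I)‖ ≤ μ.real Set.univ := by
        calc _ ≤ y * (1 / y * μ.real Set.univ) := by gcongr
          _ = _ := by field_simp
      have h5 := norm_sub_le (stieltjes μ (y * Complex.I)) (f (y * Complex.I))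
      nlinarith
    by_contra hne
    have hpos : 0 < ‖k‖ := norm_pos_iff.2 hne
    have hm : 0 ≤ μ.real Set.univ := measureReal_nonneg
    have h2 := h1 ((μ.real Set.univ + C + 1) / ‖k‖) (by positivity)
    rw [div_mul_cancel₀ _ hpos.ne'] at h2
    linarith
  intro z hz
  have := hk z hz
  rw [hk0, sub_eq_zero] at this
  exact this

end Herglotz

/-! ### The positive part of the support is the complement of `gapSet`. -/

section Support

variable {M : ℕ} {a : Fin M → ℝ} {c : ℝ} {μ ν : Measure ℝ}

theorem eq_of_mapClusterPt_of_tendsto {α X : Type*} [TopologicalSpace X] [T2Space X]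
    {F : Filter α} {u : α → X} {x y : X} (h : MapClusterPt x F u) (h' : Tendsto u F (𝓝 y)) :
    x = y := by
  have : (𝓝 x ⊓ map u F).NeBot := h
  exact eq_of_nhds_neBot (this.mono (inf_le_inf_left _ h'))

theorem hasDerivAt_stieltjes [IsFiniteMeasure μ] {x : ℝ} (hx : x ∉ μ.support) :
    ∃ d, HasDerivAt (stieltjes μ) d (x : ℂ) := by
  refine ⟨_, hasDerivAt_resolventTransform (x : ℂ) ?_⟩
  rintro ⟨y, hy, hxy⟩
  have : y = x := by simpa using hxy
  exact hx (this ▸ hy)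

theorem continuousAt_stieltjes [IsFiniteMeasure μ] {x : ℝ} (hx : x ∉ μ.support) :
    ContinuousAt (stieltjes μ) (x : ℂ) := by
  obtain ⟨d, hd⟩ := hasDerivAt_stieltjes hx
  exact hd.continuousAt

theorem stieltjes_ofReal (x : ℝ) : stieltjes μ x = ((∫ y, (y - x)⁻¹ ∂μ : ℝ) : ℂ) := by
  rw [stieltjes_eq, ← integral_complex_ofReal]
  push_cast
  rfl

/-- `μ` is a finite measure with Stieltjes transform `Φ(w(z)) / z`, where `Φ` is continuous off the
eigenvalues and real on the real line. -/
structure IsTransformOf (a : Fin M → ℝ) (c : ℝ) (Φ : ℂ → ℂ) (μ : Measure ℝ) : Prop where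
  finite : IsFiniteMeasure μ
  continuousAt : ∀ w : ℂ, (∀ i, w ≠ a i) → ContinuousAt Φ w
  real : ∀ w : ℝ, (∀ i, w ≠ a i) → (Φ w).im = 0
  transform : ∀ z : ℂ, 0 < z.im → stieltjes μ z = Φ (wOf a c z) / z

variable {Φ : ℂ → ℂ}

/-- If w(z) accumulates only at real points as z tends to x, then Φ(w(z))/z accumulates only at real
numbers; x ≠ 0 is needed for the division. -/
theorem IsTransformOf.tendsto_im (hM : 0 < M) (ha : ∀ i, 0 < a i) (hc : 0 < c)
    (hμ : IsTransformOf a c Φ μ) {x : ℝ} (hx : x ≠ 0)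
    (h : ∀ w, IsLimitPoint a c x w → MapClusterPt w (𝓝[{ζ | 0 < ζ.im}] (x : ℂ)) (wOf a c) →
      w.im = 0) :
    Tendsto (fun z => (stieltjes μ z).im) (𝓝[{z | 0 < z.im}] (x : ℂ)) (𝓝 0) := by
  have h1 := tendsto_comp_wOf hM ha hc (F := fun p => (Φ p.1 / p.2).im) (z := x) (x := (0 : ℝ))
    (fun w hw hcl => by
      have hwr : w = (w.re : ℂ) := Complex.ext rfl (by simpa using h w hw hcl)
      have hΦ : ContinuousAt Φ w := hμ.continuousAt w hw.ne
      have hreal : (Φ w / x).im = 0 := by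
        rw [Complex.div_ofReal_im]
        rw [hwr, hμ.real w.re (fun i => by
          have := hw.ne i
          rw [hwr] at this
          exact_mod_cast this), zero_div]
      rw [← hreal]
      have hx' : (x : ℂ) ≠ 0 := by exact_mod_cast hx
      refine (Complex.continuous_im.tendsto _).comp ?_
      refine Tendsto.div (hΦ.tendsto.comp ?_) ?_ hx'
      · exact continuous_fst.tendsto (w, (x : ℂ))
      · exact continuous_snd.tendsto (w, (x : ℂ)))
  refine h1.congr' ?_
  filter_upwards [self_mem_nhdsWithin] with z hz
  rw [hμ.transform z hz]

/-- For `x < 0` the limit points are real. -/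
theorem IsLimitPoint.im_eq_zero_of_neg (hM : 0 < M) (ha : ∀ i, 0 < a i) (hc : 0 < c) {x : ℝ}
    (hx : x < 0) {w : ℂ} (h : IsLimitPoint a c x w) : w.im = 0 := by
  by_contra hne
  have hy : 0 < w.im := lt_of_le_of_ne h.im_nonneg (Ne.symm hne)
  have hφ : phiC a c w ≠ 0 := by rw [h.phiC_eq]; exact_mod_cast hx.ne
  have hu := uC_ne_zero_of_phiC_ne_zero hφ
  have hs := sFun_pos hM ha hc h.ne
  -- For x < 0, v is a positive multiple of 1/u, so Im v < 0 when Im u > 0; but Im v = (1 - s) Im w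
  -- ≥ 0.
  have hv : vC a c w = ((-x : ℝ) : ℂ) * (uC a c w)⁻¹ := by
    have := h.phiC_eq
    rw [phiC] at this
    rw [eq_mul_inv_iff_mul_eq₀ hu]
    push_cast
    linear_combination -this
  have hvim := vC_im (a := a) (c := c) w
  rw [hv, Complex.im_ofReal_mul, Complex.inv_im, uC_im] at hvim
  have h1 : 0 < Complex.normSq (uC a c w) := Complex.normSq_pos.2 hu
  have h2 : 0 ≤ (1 - sFun a c w) * w.im := mul_nonneg (by linarith [h.sFun_le]) hy.le
  have h3 : 0 < -x * (sFun a c w * w.im / Complex.normSq (uC a c w)) :=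
    mul_pos (by linarith) (by positivity)
  rw [neg_div, mul_neg] at hvim
  linarith

theorem IsTransformOf.measure_Iio_eq_zero (hM : 0 < M) (ha : ∀ i, 0 < a i) (hc : 0 < c)
    (hμ : IsTransformOf a c Φ μ) : μ (Set.Iio 0) = 0 := by
  have := hμ.finite
  refine measure_mono_null (fun x hx => ?_) (Measure.measure_compl_support (μ := μ))
  refine notMem_support_of_tendsto_im ?_
  filter_upwards [Iio_mem_nhds hx] with y hy
  exact hμ.tendsto_im hM ha hc (ne_of_lt hy) fun w hw _ => hw.im_eq_zero_of_neg hM ha hc hy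

theorem Good.eventually {w : ℝ} (h : Good a c w) : ∀ᶠ x in 𝓝 w, Good a c x := by
  have hu := (hasDerivAt_uR (c := c) h.ne).continuousAt
  have hv : ContinuousAt (vR a c) w := continuousAt_id.sub hu
  filter_upwards [eventually_ne_eigenvalue h.ne, hu.eventually (gt_mem_nhds h.u_neg),
    hv.eventually (lt_mem_nhds h.v_pos)] with x h1 h2 h3 using ⟨h1, h2, h3⟩

/-- The image under `φ` of the good points where `φ' > 0`. -/
def gapSet (a : Fin M → ℝ) (c : ℝ) : Set ℝ := phiR a c '' {w | Good a c w ∧ 0 < phiDeriv a c w}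

theorem isOpen_gapSet : IsOpen (gapSet a c) := by
  rw [isOpen_iff_mem_nhds]
  rintro _ ⟨w, ⟨hg, hd⟩, rfl⟩
  have hd' := hasDerivAt_phiDeriv (c := c) hg.ne
  have hstrict : HasStrictDerivAt (phiR a c) (phiDeriv a c w) w :=
    hasStrictDerivAt_of_hasDerivAt_of_continuousAt
      ((eventually_ne_eigenvalue hg.ne).mono fun x hx => hasDerivAt_phiR hx) hd'.continuousAt
  rw [← hstrict.map_nhds_eq hd.ne']
  refine image_mem_map ?_
  exact hg.eventually.and (hd'.continuousAt.eventually (lt_mem_nhds hd))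

/-- The limit point satisfies only the non-strict inequality; φ' > 0 supplies the strict one at w.
-/
theorem IsLimitPoint.eq_of_good (hc : 0 < c) {w : ℝ} (hg : Good a c w) (hd : 0 < phiDeriv a c w)
    {w' : ℂ} (h : IsLimitPoint a c (phiR a c w) w') : w' = w := by
  refine eq_of_phiC_eq hc h.ne (fun i => by exact_mod_cast hg.ne i) ?_ ?_ h.mul_le
    (hg.mul_lt_iff.2 hd)
  · rw [phiC_ofReal]; exact_mod_cast hg.phiR_pos.ne'
  · rw [h.phiC_eq, phiC_ofReal]

theorem IsTransformOf.notMem_support (hM : 0 < M) (ha : ∀ i, 0 < a i) (hc : 0 < c)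
    (hμ : IsTransformOf a c Φ μ) {x : ℝ} (hx : x ∈ gapSet a c) : x ∉ μ.support := by
  have := hμ.finite
  refine notMem_support_of_tendsto_im ?_
  filter_upwards [isOpen_gapSet.mem_nhds hx] with y hy
  obtain ⟨w, ⟨hg, hd⟩, rfl⟩ := hy
  refine hμ.tendsto_im hM ha hc hg.phiR_pos.ne' fun w' hw' _ => ?_
  rw [hw'.eq_of_good hc hg hd, Complex.ofReal_im]

theorem IsTransformOf.stieltjes_phiR (hM : 0 < M) (ha : ∀ i, 0 < a i) (hc : 0 < c)
    (hμ : IsTransformOf a c Φ μ) {w : ℝ} (hg : Good a c w) (hd : 0 < phiDeriv a c w) :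
    phiR a c w * stieltjes μ (phiR a c w : ℝ) = Φ w := by
  have := hμ.finite
  have hns := hμ.notMem_support hM ha hc ⟨w, ⟨hg, hd⟩, rfl⟩
  have h1 : Tendsto (fun z => z * stieltjes μ z) (𝓝[{z | 0 < z.im}] ((phiR a c w : ℝ) : ℂ))
      (𝓝 (phiR a c w * stieltjes μ (phiR a c w : ℝ))) :=
    (tendsto_id.mul (continuousAt_stieltjes hns).tendsto).mono_left nhdsWithin_le_nhds
  obtain ⟨w', hw', hcl⟩ := exists_isLimitPoint hM ha hc (a := a) (phiR a c w)
  have hww := hw'.eq_of_good hc hg hd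
  subst hww
  have h2 : MapClusterPt (Φ w) (𝓝[{z | 0 < z.im}] ((phiR a c w : ℝ) : ℂ)) (Φ ∘ wOf a c) :=
    hcl.continuousAt_comp (hμ.continuousAt w hw'.ne)
  refine (eq_of_mapClusterPt_of_tendsto h2 (h1.congr' ?_)).symm
  filter_upwards [self_mem_nhdsWithin] with z hz
  have hz0 : z ≠ 0 := by
    rintro rfl
    have : (0 : ℝ) < (0 : ℂ).im := hz
    simp at this
  rw [hμ.transform z hz, Function.comp, mul_div_cancel₀ _ hz0]

/-- The origin belongs to the support if `Φ` does not vanish at the end of a branch where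
`φ = 0`. -/
theorem IsTransformOf.zero_mem_support (hM : 0 < M) (ha : ∀ i, 0 < a i) (hc : 0 < c)
    (hμ : IsTransformOf a c Φ μ) {o : ℝ} (ho : ∀ i, o ≠ a i) (hφ : phiR a c o = 0)
    (hΦ : Φ o ≠ 0) (h : ∀ᶠ w in 𝓝[>] o, Good a c w ∧ 0 < phiDeriv a c w) : 0 ∈ μ.support := by
  have := hμ.finite
  -- Off the support z times the transform tends to 0 with z. Along z = φ(w), as w decreases to o,
  -- it equals Φ(w), which tends to Φ(o) ≠ 0.
  by_contra h0
  have hcont := continuousAt_stieltjes (μ := μ) h0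
  have hφlim : Tendsto (fun w => ((phiR a c w : ℝ) : ℂ)) (𝓝[>] o) (𝓝 ((0 : ℝ) : ℂ)) := by
    rw [← hφ]
    exact ((Complex.continuous_ofReal.tendsto _).comp
      (hasDerivAt_phiR ho).continuousAt.tendsto).mono_left nhdsWithin_le_nhds
  have h1 : Tendsto (fun w => (phiR a c w : ℂ) * stieltjes μ (phiR a c w : ℝ)) (𝓝[>] o)
      (𝓝 (((0 : ℝ) : ℂ) * stieltjes μ (0 : ℝ))) :=
    hφlim.mul (hcont.tendsto.comp hφlim)
  have h2 : Tendsto (fun w : ℝ => Φ w) (𝓝[>] o) (𝓝 (Φ o)) :=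
    ((hμ.continuousAt o (fun i => by exact_mod_cast ho i)).tendsto.comp
      (Complex.continuous_ofReal.tendsto o)).mono_left nhdsWithin_le_nhds
  have h3 := tendsto_nhds_unique (h1.congr' (h.mono fun w hw =>
    hμ.stieltjes_phiR hM ha hc hw.1 hw.2)) h2
  rw [Complex.ofReal_zero, zero_mul] at h3
  exact hΦ h3.symm

/-- A positive point outside the support of the measure with transform `u(w(z)) / (c z)` is the
image of a good point with `φ' > 0`. -/
theorem mem_gapSet_of_notMem_support (hM : 0 < M) (ha : ∀ i, 0 < a i) (hc : 0 < c)
    (hμ : IsTransformOf a c (fun w => w * mC a w) μ) {x : ℝ} (hx : 0 < x)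
    (hns : x ∉ μ.support) : x ∈ gapSet a c := by
  have := hμ.finite
  have hc0 : (c : ℂ) ≠ 0 := by exact_mod_cast hc.ne'
  have hx0 : (x : ℂ) ≠ 0 := by exact_mod_cast hx.ne'
  set s := stieltjes μ with hs
  obtain ⟨d₀, hd₀⟩ := hasDerivAt_stieltjes hns
  have hus : ∀ z : ℂ, 0 < z.im → uC a c (wOf a c z) = c * (z * s z) := by
    intro z hz
    have hz0 : z ≠ 0 := by rintro rfl; simp at hz
    rw [uC_eq_mC, hs, hμ.transform z hz, mul_div_cancel₀ _ hz0]
  obtain ⟨w', hw', hcl⟩ := exists_isLimitPoint hM ha hc (a := a) x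
  have hu' : uC a c w' = c * (x * s x) := by
    have h1 : MapClusterPt (uC a c w') (𝓝[{z | 0 < z.im}] (x : ℂ)) (uC a c ∘ wOf a c) :=
      hcl.continuousAt_comp (continuousAt_uC hw'.ne)
    have h2 : Tendsto (fun z => c * (z * s z)) (𝓝[{z | 0 < z.im}] (x : ℂ))
        (𝓝 (c * (x * s x))) :=
      (tendsto_const_nhds.mul (tendsto_id.mul hd₀.continuousAt.tendsto)).mono_left
        nhdsWithin_le_nhds
    refine eq_of_mapClusterPt_of_tendsto h1 (h2.congr' ?_)
    filter_upwards [self_mem_nhdsWithin] with z hz using (hus z hz).symm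
  have hφ0 : phiC a c w' ≠ 0 := by rw [hw'.phiC_eq]; exact hx0
  have hu0 := uC_ne_zero_of_phiC_ne_zero hφ0
  have hs0 : s x ≠ 0 := by
    intro h
    rw [h, mul_zero, mul_zero] at hu'
    exact hu0 hu'
  -- The transform is real at x, hence so are u and w = u - x/u.
  obtain ⟨w, rfl⟩ : ∃ w : ℝ, w' = w := by
    have h1 := eq_sub_phiC_div hφ0
    rw [hw'.phiC_eq, hu', hs, stieltjes_ofReal] at h1
    refine ⟨c * (x * ∫ y, (y - x)⁻¹ ∂μ) - x / (c * (x * ∫ y, (y - x)⁻¹ ∂μ)), ?_⟩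
    conv_lhs => rw [h1]
    push_cast
    rfl
  have hnsw : ∀ i, w ≠ a i := fun i => by exact_mod_cast hw'.ne i
  have hφw : phiR a c w = x := by
    have := hw'.phiC_eq
    rw [phiC_ofReal] at this
    exact_mod_cast this
  -- the extension of `w(z)` to the boundary point
  set W : ℂ → ℂ := fun z => c * (z * s z) - 1 / (c * s z) with hW
  have hWz : ∀ z : ℂ, 0 < z.im → W z = wOf a c z := by
    intro z hz
    have hspec := wOf_spec hM ha hc hz
    have hz0 : z ≠ 0 := by rintro rfl; simp at hz
    have h1 := eq_sub_phiC_div (a := a) (c := c) (w := wOf a c z) (by rw [hspec.2]; exact hz0)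
    have hu := uC_ne_zero_of_phiC_ne_zero (a := a) (c := c) (w := wOf a c z)
      (by rw [hspec.2]; exact hz0)
    rw [hus z hz] at hu
    have hsz : s z ≠ 0 := by
      intro h; simp [h] at hu
    rw [h1, hspec.2, hus z hz, hW]
    field_simp
  have hWx : W x = w := by
    have h1 := eq_sub_phiC_div hφ0
    rw [hw'.phiC_eq, hu'] at h1
    rw [h1, hW]
    field_simp
  obtain ⟨d, hd⟩ : ∃ d, HasDerivAt W d (x : ℂ) :=
    ⟨_, (((hasDerivAt_id (x : ℂ)).mul hd₀).const_mul (c : ℂ)).sub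
      ((hasDerivAt_const (x : ℂ) (1 : ℂ)).div (hd₀.const_mul (c : ℂ)) (mul_ne_zero hc0 hs0))⟩
  have hφ' : HasDerivAt (phiC a c) ((phiDeriv a c w : ℝ) : ℂ) (W x) := by
    rw [hWx]
    refine (hasStrictDerivAt_phiC hw'.ne).hasDerivAt.congr_deriv ?_
    rw [pFun_ofReal_self, uC_ofReal, vC_ofReal, phiDeriv_eq]
    push_cast
    rfl
  -- restriction to the vertical line
  set γ : ℝ → ℂ := fun y => x + y * Complex.I with hγ
  have hγ0 : γ 0 = x := by simp [hγ]
  have hγim : ∀ y, (γ y).im = y := fun y => by simp [hγ]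
  have hγd : HasDerivAt γ Complex.I 0 := by
    have h1 : HasDerivAt (fun y : ℝ => (y : ℂ)) 1 0 := Complex.ofRealCLM.hasDerivAt
    have h2 := (h1.mul_const Complex.I).const_add (x : ℂ)
    rwa [one_mul] at h2
  have hWγ : HasDerivAt (W ∘ γ) (d * Complex.I) 0 :=
    HasDerivAt.comp (h₂ := W) 0 (by rw [hγ0]; exact hd) hγd
  have hφγ : HasDerivAt (phiC a c ∘ (W ∘ γ)) ((phiDeriv a c w : ℝ) * (d * Complex.I)) 0 :=
    HasDerivAt.comp (h₂ := phiC a c) 0 (by rw [Function.comp, hγ0]; exact hφ') hWγ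
  have hEq : Set.EqOn (phiC a c ∘ (W ∘ γ)) γ (Set.Ici 0) := by
    intro y hy
    rcases (Set.mem_Ici.1 hy).eq_or_lt with h | h
    · rw [← h]
      simp only [Function.comp, hγ0, hWx]
      exact hw'.phiC_eq
    · have hpos : 0 < (γ y).im := by rw [hγim]; exact h
      simp only [Function.comp]
      rw [hWz _ hpos, (wOf_spec hM ha hc hpos).2]
  -- φ(W(z)) = z is known only above the axis, so derivatives are compared along a half-line.
  have hone : ((phiDeriv a c w : ℝ) : ℂ) * (d * Complex.I) = Complex.I :=
    (uniqueDiffOn_Ici (0 : ℝ) 0 Set.self_mem_Ici).eq_deriv _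
      (hφγ.hasDerivWithinAt.congr (fun y hy => (hEq hy).symm) (hEq Set.self_mem_Ici).symm)
      hγd.hasDerivWithinAt
  have hone' : phiDeriv a c w * d.re = 1 := by
    have h1 : ((phiDeriv a c w : ℝ) : ℂ) * d = 1 := by
      apply mul_right_cancel₀ Complex.I_ne_zero
      rw [mul_assoc, hone, one_mul]
    have h2 := congrArg Complex.re h1
    rwa [Complex.re_ofReal_mul, Complex.one_re] at h2
  -- The imaginary part of W vanishes at x and is positive above it.
  have hdre : 0 ≤ d.re := by
    have h1 : HasDerivAt (fun y => (W (γ y)).im) d.re 0 := by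
      have h := Complex.imCLM.hasFDerivAt.comp_hasDerivAt (0 : ℝ) hWγ
      simpa [Function.comp_def] using h
    refine nonneg_of_forall_ge_right h1 one_pos fun y hy => ?_
    simp only [hγ0, hWx, Complex.ofReal_im]
    rcases hy.1.eq_or_lt with h | h
    · rw [← h, hγ0, hWx, Complex.ofReal_im]
    · have hpos : 0 < (γ y).im := by rw [hγim]; exact h
      rw [hWz _ hpos]
      exact (wOf_spec hM ha hc hpos).1.1.le
  have hderiv : 0 < phiDeriv a c w := by
    by_contra! h
    have := mul_nonpos_of_nonpos_of_nonneg h hdre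
    linarith
  have huv : uR a c w * vR a c w < 0 := by
    rw [phiR] at hφw; linarith
  have hle := hw'.mul_le
  rw [uC_ofReal, vC_ofReal, Complex.norm_real, Complex.norm_real, sFun_ofReal,
    Real.norm_eq_abs, Real.norm_eq_abs] at hle
  -- If u > 0 > v, the limiting inequality is s(u - v) ≤ u, that is, φ' ≤ 0.
  rcases mul_neg_iff.1 huv with ⟨h1, h2⟩ | ⟨h1, h2⟩
  · rw [abs_of_pos h1, abs_of_neg h2] at hle
    rw [phiDeriv_eq] at hderiv
    linarith
  · exact ⟨w, ⟨⟨hnsw, h1, h2⟩, hderiv⟩, hφw⟩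

/-- A positive point outside the support of the measure with transform `(m(w(z)) - 1) / z` is
outside the support of the one with transform `u(w(z)) / (c z)`. -/
theorem notMem_support_of_notMem_support (hM : 0 < M) (ha : ∀ i, 0 < a i) (hc : 0 < c)
    (hμ : IsTransformOf a c (fun w => w * mC a w) μ)
    (hν : IsTransformOf a c (fun w => mC a w - 1) ν) {x : ℝ} (hx : 0 < x)
    (hns : x ∉ ν.support) : x ∉ μ.support := by
  have := hμ.finite
  have := hν.finite
  have : Nonempty (Fin M) := ⟨⟨0, hM⟩⟩
  refine notMem_support_of_tendsto_im ?_
  filter_upwards [Ioi_mem_nhds hx, Measure.isOpen_compl_support.mem_nhds hns] with y hy hyns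
  have hy0 : 0 < y := hy
  rw [Set.mem_compl_iff] at hyns
  have hcont := continuousAt_stieltjes (μ := ν) hyns
  refine hμ.tendsto_im hM ha hc hy0.ne' fun w hw hcl => ?_
  have h1 : MapClusterPt (mC a w - 1) (𝓝[{z | 0 < z.im}] (y : ℂ))
      ((fun w => mC a w - 1) ∘ wOf a c) :=
    MapClusterPt.continuousAt_comp (f := fun w => mC a w - 1) (hν.continuousAt w hw.ne) hcl
  have h2 : Tendsto (fun z => z * stieltjes ν z) (𝓝[{z | 0 < z.im}] (y : ℂ))
      (𝓝 (y * stieltjes ν y)) :=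
    (tendsto_id.mul hcont.tendsto).mono_left nhdsWithin_le_nhds
  have h3 : mC a w - 1 = y * stieltjes ν y := by
    refine eq_of_mapClusterPt_of_tendsto h1 (h2.congr' ?_)
    filter_upwards [self_mem_nhdsWithin] with z hz
    have hz0 : z ≠ 0 := by
      rintro rfl
      have : (0 : ℝ) < (0 : ℂ).im := hz
      simp at this
    rw [hν.transform z hz, Function.comp, mul_div_cancel₀ _ hz0]
  have h4 : (mC a w).im = 0 := by
    have h := congrArg Complex.im h3
    rwa [stieltjes_ofReal, Complex.sub_im, Complex.one_im, sub_zero, ← Complex.ofReal_mul,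
      Complex.ofReal_im] at h
  rw [mC_im] at h4
  have hM' : (0 : ℝ) < 1 / M := by positivity
  refine (mul_eq_zero.1 h4).resolve_right (ne_of_gt (mul_pos hM'
    (Finset.sum_pos (fun i _ => ?_) Finset.univ_nonempty)))
  exact div_pos (ha i) (Complex.normSq_pos.2 (sub_ne_zero.2 (hw.ne i).symm))

/-- A cycle of inclusions on the positive axis: `gapSet` avoids both supports, the complement of
supp ν avoids supp μ, and the complement of supp μ lies in `gapSet`. -/
theorem mem_support_iff_notMem_gapSet (hM : 0 < M) (ha : ∀ i, 0 < a i) (hc : 0 < c)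
    (hμ : IsTransformOf a c (fun w => w * mC a w) μ)
    (hν : IsTransformOf a c (fun w => mC a w - 1) ν) {x : ℝ} (hx : 0 < x) :
    (x ∈ μ.support ↔ x ∉ gapSet a c) ∧ (x ∈ ν.support ↔ x ∉ gapSet a c) := by
  refine ⟨⟨fun h h' => hμ.notMem_support hM ha hc h' h, fun h => ?_⟩,
    ⟨fun h h' => hν.notMem_support hM ha hc h' h, fun h => ?_⟩⟩
  · by_contra h'
    exact h (mem_gapSet_of_notMem_support hM ha hc hμ hx h')
  · by_contra h'
    exact h (mem_gapSet_of_notMem_support hM ha hc hμ hx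
      (notMem_support_of_notMem_support hM ha hc hμ hν hx h'))

end Support

/-! ### Existence and uniqueness of t, μ and ν. -/

section Measures

variable {M : ℕ} {a : Fin M → ℝ} {c : ℝ} {R : Matrix (Fin M) (Fin M) ℂ} {μ ν : Measure ℝ}

/-- Since w = u + v, φ/w is -1/(1/u + 1/v), and u and v have nonnegative imaginary parts. -/
theorem im_phiC_div_nonpos {w : ℂ} (hM : 0 < M) (ha : ∀ i, 0 < a i) (hc : 0 < c)
    (hw : w ∈ omegaSet a c) : (phiC a c w / w).im ≤ 0 := by
  have hs := sFun_pos hM ha hc fun i => ne_ofReal_of_im_pos hw.1 (a i)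
  have hu : 0 ≤ (uC a c w).im := by rw [uC_im]; exact mul_nonneg hs.le hw.1.le
  have hv : 0 ≤ (vC a c w).im := by
    rw [vC_im]; exact mul_nonneg (by linarith [hw.2.1]) hw.1.le
  have h0 : 0 < Complex.normSq w :=
    Complex.normSq_pos.2 (by rintro rfl; simpa using hw.1)
  have e : phiC a c w / w =
      -((Complex.normSq (uC a c w) / Complex.normSq w : ℝ) * vC a c w +
        (Complex.normSq (vC a c w) / Complex.normSq w : ℝ) * uC a c w) := by
    have hw0 : w ≠ 0 := Complex.normSq_pos.1 h0
    have hw1 : (starRingEnd ℂ) w ≠ 0 := by rwa [Ne, map_eq_zero]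
    have hsum : (starRingEnd ℂ) w = (starRingEnd ℂ) (uC a c w) + (starRingEnd ℂ) (vC a c w) := by
      rw [← map_add, uC_add_vC]
    push_cast
    rw [← Complex.mul_conj, ← Complex.mul_conj, ← Complex.mul_conj, phiC]
    field_simp
    rw [hsum]
  rw [e, Complex.neg_im, Complex.add_im, Complex.im_ofReal_mul, Complex.im_ofReal_mul]
  have h1 := Complex.normSq_nonneg (uC a c w)
  have h2 := Complex.normSq_nonneg (vC a c w)
  have : 0 ≤ Complex.normSq (uC a c w) / Complex.normSq w * (vC a c w).im +
      Complex.normSq (vC a c w) / Complex.normSq w * (uC a c w).im := by positivity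
  linarith

/-- The quotient is the mean of (aᵢ z/w - z)⁻¹ with z = φ(w), and each denominator has negative
imaginary part. -/
theorem im_mC_sub_one_div_nonneg {w : ℂ} (hM : 0 < M) (ha : ∀ i, 0 < a i) (hc : 0 < c)
    (hw : w ∈ omegaSet a c) : 0 ≤ ((mC a w - 1) / phiC a c w).im := by
  set z := phiC a c w with hz
  have hw0 : w ≠ 0 := by rintro rfl; simpa using hw.1
  have hzim : 0 < z.im := hw.2.2
  have hz0 : z ≠ 0 := by intro h; simp [h] at hzim
  have hM' : (M : ℂ) ≠ 0 := by exact_mod_cast hM.ne'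
  have hne : ∀ i, (a i : ℂ) - w ≠ 0 := fun i => sub_ne_zero.2 (ne_ofReal_of_im_pos hw.1 _).symm
  have e : (mC a w - 1) / z = ((1 / M : ℝ) : ℂ) * ∑ i, (a i * (z / w) - z)⁻¹ := by
    have h1 : ∀ i, (a i * (z / w) - z)⁻¹ = ((a i : ℂ) / (a i - w) - 1) / z := fun i => by
      have := hne i
      have h2 : (a i : ℂ) * (z / w) - z = z * (a i - w) / w := by field_simp
      rw [h2]
      field_simp
      ring
    simp_rw [h1]
    rw [← Finset.sum_div, Finset.sum_sub_distrib, mC]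
    simp only [Finset.sum_const, Finset.card_univ, Fintype.card_fin, nsmul_eq_mul, mul_one]
    push_cast
    field_simp
  rw [e, Complex.im_ofReal_mul, Complex.im_sum]
  refine mul_nonneg (by positivity) (Finset.sum_nonneg fun i _ => ?_)
  rw [Complex.inv_im, Complex.sub_im, Complex.im_ofReal_mul]
  have h1 := im_phiC_div_nonpos hM ha hc hw
  refine div_nonneg ?_ (Complex.normSq_nonneg _)
  have := mul_nonpos_of_nonneg_of_nonpos (ha i).le h1
  linarith

theorem IsTransformOf.mk_mul (hfin : IsFiniteMeasure μ)
    (h : ∀ z : ℂ, 0 < z.im → stieltjes μ z = wOf a c z * mC a (wOf a c z) / z) :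
    IsTransformOf a c (fun w => w * mC a w) μ where
  finite := hfin
  continuousAt w hw := continuousAt_id.mul (differentiableAt_mC hw).continuousAt
  real w _ := by rw [mC_ofReal, ← Complex.ofReal_mul, Complex.ofReal_im]
  transform := h

theorem IsTransformOf.mk_sub (hfin : IsFiniteMeasure μ)
    (h : ∀ z : ℂ, 0 < z.im → stieltjes μ z = (mC a (wOf a c z) - 1) / z) :
    IsTransformOf a c (fun w => mC a w - 1) μ where
  finite := hfin
  continuousAt w hw := (differentiableAt_mC hw).continuousAt.sub continuousAt_const
  real w _ := by rw [mC_ofReal]; simp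
  transform := h

theorem exists_measure_of_bound (hM : 0 < M) (ha : ∀ i, 0 < a i) (hc : 0 < c) {Φ : ℂ → ℂ} {C : ℝ}
    (hΦ : ∀ w ∈ omegaSet a c, DifferentiableAt ℂ Φ w)
    (hpos : ∀ w ∈ omegaSet a c, 0 ≤ (Φ w / phiC a c w).im)
    (hC : ∀ w ∈ omegaSet a c, ‖Φ w‖ ≤ C) :
    ∃ μ : Measure ℝ, IsFiniteMeasure μ ∧
      ∀ z : ℂ, 0 < z.im → stieltjes μ z = Φ (wOf a c z) / z := by
  refine exists_stieltjes_eq (f := fun z => Φ (wOf a c z) / z) (C := C) (fun z hz => ?_)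
    (fun z hz => ?_) (fun y hy => ?_)
  · have hz' : 0 < z.im := hz
    have hz0 : z ≠ 0 := by intro h; simp [h] at hz'
    have h1 : DifferentiableAt ℂ (fun z => Φ (wOf a c z)) z :=
      (hΦ _ (wOf_spec hM ha hc hz').1).comp (f := wOf a c) z (differentiableAt_wOf hM ha hc hz')
    exact (h1.div differentiableAt_id hz0).differentiableWithinAt
  · have h := wOf_spec hM ha hc hz
    have := hpos _ h.1
    rwa [h.2] at this
  · have hyi : 0 < ((y : ℂ) * Complex.I).im := by simpa using hy
    have h := hC _ (wOf_spec hM ha hc hyi).1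
    have hy0 : y ≠ 0 := hy.ne'
    rw [norm_div, norm_mul, Complex.norm_I, mul_one, Complex.norm_real, Real.norm_eq_abs,
      abs_of_pos hy, mul_div_cancel₀ _ hy0]
    exact h

theorem IsCanonicalSolution.eq_wOf (hM : 0 < M) (hR : R.PosDef) (hc : 0 < c) {z t : ℂ}
    (hz : 0 < z.im) (h : IsCanonicalSolution R c z t) :
    t = wOf hR.isHermitian.eigenvalues c z *
        mC hR.isHermitian.eigenvalues (wOf hR.isHermitian.eigenvalues c z) / z ∧
      (1 / M : ℂ) * (resolventT R c z t).trace =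
        (mC hR.isHermitian.eigenvalues (wOf hR.isHermitian.eigenvalues c z) - 1) / z := by
  obtain ⟨w, hw, hφ, ht, hT⟩ := h.exists_param hM hR.isHermitian hc hz
  have := wOf_phiC hM hR.eigenvalues_pos hc hw
  rw [hφ] at this
  rw [this]
  exact ⟨ht, hT⟩

theorem isCanonicalSolution_wOf (hM : 0 < M) (hR : R.PosDef) (hc : 0 < c) {z : ℂ}
    (hz : 0 < z.im) :
    IsCanonicalSolution R c z (wOf hR.isHermitian.eigenvalues c z *
      mC hR.isHermitian.eigenvalues (wOf hR.isHermitian.eigenvalues c z) / z) := by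
  have h := wOf_spec hM hR.eigenvalues_pos hc hz
  have := isCanonicalSolution_of_mem hM hR hc h.1
  rwa [h.2] at this

theorem existsUnique_isCanonicalSolution (hM : 0 < M) (hR : R.PosDef) (hc : 0 < c) {z : ℂ}
    (hz : 0 < z.im) : ∃! t : ℂ, IsCanonicalSolution R c z t :=
  ⟨_, isCanonicalSolution_wOf hM hR hc hz, fun _ ht => (ht.eq_wOf hM hR hc hz).1⟩

theorem IsMu.isTransformOf (hM : 0 < M) (hR : R.PosDef) (hc : 0 < c) (h : IsMu R c μ) :
    IsTransformOf hR.isHermitian.eigenvalues c (fun w => w * mC hR.isHermitian.eigenvalues w) μ :=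
  .mk_mul h.finite fun z hz => ((h.transform z hz).eq_wOf hM hR hc hz).1

theorem IsNu.isTransformOf (hM : 0 < M) (hR : R.PosDef) (hc : 0 < c) (h : IsNu R c ν) :
    IsTransformOf hR.isHermitian.eigenvalues c (fun w => mC hR.isHermitian.eigenvalues w - 1) ν :=
  .mk_sub h.finite fun z hz => by
    have ht := isCanonicalSolution_wOf hM hR hc hz
    rw [h.transform z _ hz ht, (ht.eq_wOf hM hR hc hz).2]

theorem existsUnique_isMu (hM : 0 < M) (hR : R.PosDef) (hc : 0 < c) :
    ∃! μ : Measure ℝ, IsMu R c μ := by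
  set a := hR.isHermitian.eigenvalues with ha
  have hapos : ∀ i, 0 < a i := hR.eigenvalues_pos
  obtain ⟨μ, hfin, hμ⟩ := exists_measure_of_bound hM hapos hc (Φ := fun w => w * mC a w)
    (C := ((c / M) * ∑ i, a i * (1 + 1 / √(c / M))) / c)
    (fun w hw => differentiableAt_id.mul
      (differentiableAt_mC fun i => ne_ofReal_of_im_pos hw.1 _))
    (fun w hw => (isCanonicalSolution_of_mem hM hR hc hw).im_pos.le)
    (fun w hw => by
      rw [le_div_iff₀ hc]
      have := norm_uC_le hapos hc hM hw
      rwa [uC_eq_mC, norm_mul, Complex.norm_real, Real.norm_eq_abs, abs_of_pos hc, mul_comm] at this)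
  refine ⟨μ, ⟨hfin, (IsTransformOf.mk_mul hfin hμ).measure_Iio_eq_zero hM hapos hc, fun z hz => ?_⟩,
    fun μ' h' => ?_⟩
  · rw [hμ z hz]; exact isCanonicalSolution_wOf hM hR hc hz
  · have := h'.finite
    refine eq_of_stieltjes_eq fun z hz => ?_
    rw [hμ z hz]
    exact (h'.isTransformOf hM hR hc).transform z hz

theorem existsUnique_isNu (hM : 0 < M) (hR : R.PosDef) (hc : 0 < c) :
    ∃! ν : Measure ℝ, IsNu R c ν := by
  set a := hR.isHermitian.eigenvalues with ha
  have hapos : ∀ i, 0 < a i := hR.eigenvalues_pos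
  obtain ⟨ν, hfin, hν⟩ := exists_measure_of_bound hM hapos hc (Φ := fun w => mC a w - 1)
    (C := 1 / √(c / M) + 1)
    (fun w hw => (differentiableAt_mC fun i => ne_ofReal_of_im_pos hw.1 _).sub
      (differentiableAt_const _))
    (fun w hw => im_mC_sub_one_div_nonneg hM hapos hc hw)
    (fun w hw => (norm_sub_le _ _).trans (by
      rw [norm_one]; gcongr; exact norm_mC_le hapos hc hM hw))
  refine ⟨ν, ⟨hfin, (IsTransformOf.mk_sub hfin hν).measure_Iio_eq_zero hM hapos hc,
    fun z t hz ht => ?_⟩, fun ν' h' => ?_⟩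
  · rw [hν z hz, (ht.eq_wOf hM hR hc hz).2]
  · have := h'.finite
    refine eq_of_stieltjes_eq fun z hz => ?_
    rw [hν z hz]
    exact (h'.isTransformOf hM hR hc).transform z hz

end Measures

/-! ### Enumeration of the edges. -/

section Edges

variable {M : ℕ} {a : Fin M → ℝ} {c : ℝ}

theorem exists_strictMono_enum (B : Finset ℝ) :
    ∃ E : ℕ → ℝ, (∀ k < B.card, E k ∈ B) ∧ (∀ j k, j < k → k < B.card → E j < E k) ∧
      ∀ l ∈ B, ∃ k < B.card, E k = l := by
  refine ⟨fun k => if h : k < B.card then B.orderEmbOfFin rfl ⟨k, h⟩ else 0, fun k hk => ?_,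
    fun j k hjk hk => ?_, fun l hl => ?_⟩
  · simp only [dif_pos hk]; exact B.orderEmbOfFin_mem rfl _
  · simp only [dif_pos hk, dif_pos (hjk.trans hk)]
    exact (B.orderEmbOfFin rfl).strictMono hjk
  · have : l ∈ Set.range (B.orderEmbOfFin rfl) := by rw [B.range_orderEmbOfFin rfl]; exact hl
    obtain ⟨⟨k, hk⟩, rfl⟩ := this
    exact ⟨k, hk, dif_pos hk⟩

/-- The two critical points `p < q` of `φ` in the gap above `l`. -/
structure IsGapPair (a : Fin M → ℝ) (c l p q : ℝ) : Prop where
  lt : p < q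
  inGap_left : InGap a l p
  inGap_right : InGap a l q
  deriv_left : phiDeriv a c p = 0
  deriv_right : phiDeriv a c q = 0
  isLocalMin : IsLocalMin (phiR a c) p
  isLocalMax : IsLocalMax (phiR a c) q
  neg_left : ∀ x, InGap a l x → x < p → phiDeriv a c x < 0
  pos : ∀ x, p < x → x < q → 0 < phiDeriv a c x
  neg_right : ∀ x, InGap a l x → q < x → phiDeriv a c x < 0

/-- The gap is labelled by the largest eigenvalue below w. -/
theorem exists_inGap (hM : 0 < M) (ha : ∀ i, 0 < a i) {w : ℝ} (hw : ∀ i, w ≠ a i)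
    (h : mR a w < 0) : ∃ i, InGap a (a i) w := by
  classical
  obtain ⟨i₁, hi₁⟩ := exists_lt_of_mR_neg hM ha hw h
  obtain ⟨i, hi, hmax⟩ := Finset.exists_max_image (Finset.univ.filter fun i => a i < w) a
    ⟨i₁, by simpa using hi₁⟩
  refine ⟨i, ⟨by simpa using hi, h, fun j => ?_⟩⟩
  rcases lt_or_gt_of_ne (hw j) with hj | hj
  · exact Or.inr hj
  · exact Or.inl (hmax j (by simpa using hj))

/-- The gap above `l` contains two points where `φ' ≥ 0`. -/
def HasGap (a : Fin M → ℝ) (c l : ℝ) : Prop :=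
  (∃ j, l < a j) ∧ ∃ x y, x < y ∧ InGap a l x ∧ InGap a l y ∧ 0 ≤ phiDeriv a c x ∧ 0 ≤ phiDeriv a c y

theorem hasGap_of_ne {l x y : ℝ} (hl : ∃ j, l < a j) (hne : x ≠ y) (hx : InGap a l x)
    (hy : InGap a l y) (hdx : 0 ≤ phiDeriv a c x) (hdy : 0 ≤ phiDeriv a c y) : HasGap a c l := by
  rcases lt_or_gt_of_ne hne with h | h
  · exact ⟨hl, x, y, h, hx, hy, hdx, hdy⟩
  · exact ⟨hl, y, x, h, hy, hx, hdy, hdx⟩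

theorem HasGap.exists_isGapPair (hM : 0 < M) (ha : ∀ i, 0 < a i) (hc : 0 < c) {i : Fin M}
    (h : HasGap a c (a i)) : ∃ p q, IsGapPair a c (a i) p q := by
  obtain ⟨⟨j, hj⟩, x, y, hxy, hx, hy, hdx, hdy⟩ := h
  obtain ⟨p, q, h1, h2, h3, h4, h5, h6, h7, h8, h9, h10⟩ :=
    exists_gap hM ha hc hj hx hy hxy hdx hdy
  exact ⟨p, q, h1, h2, h3, h4, h5, h6, h7, h8, h9, h10⟩

theorem InGap.hasGap_of_isLocalExtr {l w : ℝ} (hl : ∃ j, l < a j) (h : InGap a l w)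
    (hext : IsLocalExtr (phiR a c) w) : HasGap a c l := by
  obtain ⟨x, hne, hx, hdx⟩ := exists_other_of_isLocalExtr h hext
  exact hasGap_of_ne hl hne hx h hdx (hext.hasDerivAt_eq_zero (hasDerivAt_phiR h.ne)).ge

/-- Positivity of φ' is an open condition, so a neighbour of w is the second point. -/
theorem InGap.hasGap_of_deriv_pos {l w : ℝ} (hl : ∃ j, l < a j) (h : InGap a l w)
    (hd : 0 < phiDeriv a c w) : HasGap a c l := by
  have h1 : ∀ᶠ x in 𝓝 w, InGap a l x ∧ 0 < phiDeriv a c x :=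
    h.eventually.and ((hasDerivAt_phiDeriv h.ne).continuousAt.eventually (lt_mem_nhds hd))
  obtain ⟨x, ⟨hx, hdx⟩, hne⟩ :=
    ((h1.filter_mono nhdsWithin_le_nhds).and (self_mem_nhdsWithin (s := Set.Ioi w))).exists
  exact hasGap_of_ne hl (ne_of_gt hne) hx h hdx.le hd.le

theorem InGap.exists_lt {l w : ℝ} (h : InGap a l w) (hl : ∃ j, l < a j) : ∃ j, w < a j := by
  obtain ⟨j, hj⟩ := hl
  exact ⟨j, (h.gap j).resolve_left (not_le.2 hj)⟩

/-- The edges of the gaps: `wp k` and `wm (k + 1)` are the ends of the `k`-th interval where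
`φ' > 0`, with `wp q` the critical point above the eigenvalues and, if `c > 1`, `wm 1` the negative
one. -/
structure IsEdgeSystem (a : Fin M → ℝ) (c : ℝ) (q : ℕ) (wm wp : ℕ → ℝ) : Prop where
  one_le : 1 ≤ q
  le_card : q ≤ (Set.range a).ncard
  wp_good : ∀ k, 1 ≤ k → k ≤ q → Good a c (wp k) ∧ phiDeriv a c (wp k) = 0
  wm_good : ∀ k, 2 ≤ k → k ≤ q → Good a c (wm k) ∧ phiDeriv a c (wm k) = 0
  wp_pos : ∀ k, 1 ≤ k → k ≤ q → 0 < wp k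
  wp_lt_wm : ∀ k, 1 ≤ k → k < q → wp k < wm (k + 1)
  wm_lt_wp : ∀ k, 2 ≤ k → k ≤ q → wm k < wp k
  inner : {w | (∃ i, w < a i) ∧ (∀ i, w ≠ a i) ∧ mR a w < 0 ∧ IsLocalExtr (phiR a c) w} =
    wp '' Set.Ico 1 q ∪ wm '' Set.Ioc 1 q
  lt_upper : ∀ i, a i < wp q
  upper_iff : ∀ w, (∀ i, a i < w) → (phiDeriv a c w = 0 ↔ w = wp q)
  upper_min : IsLocalMin (phiR a c) (wp q)
  lower : 1 < c → ∃ o, o < wm 1 ∧ wm 1 < 0 ∧ mR a o = 1 / c ∧ (∀ x, x < o → mR a x < 1 / c) ∧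
    (∀ x, o < x → x < 0 → Good a c x ∧ (phiDeriv a c x = 0 ↔ x = wm 1)) ∧
    IsLocalMax (phiR a c) (wm 1) ∧ ∀ x, o < x → x < wm 1 → 0 < phiDeriv a c x
  cases_of_pos : ∀ w, Good a c w → 0 < phiDeriv a c w → (1 < c ∧ w < wm 1) ∨
    (∃ k, 1 ≤ k ∧ k < q ∧ wp k < w ∧ w < wm (k + 1)) ∨ wp q < w
  between : ∀ k, 1 ≤ k → k < q → ∀ w, wp k ≤ w → w ≤ wm (k + 1) →
    Good a c w ∧ (wp k < w → w < wm (k + 1) → 0 < phiDeriv a c w)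
  above : ∀ w, wp q < w → Good a c w ∧ 0 < phiDeriv a c w

theorem exists_isEdgeSystem (hM : 0 < M) (ha : ∀ i, 0 < a i) (hc : 0 < c) :
    ∃ q wm wp, IsEdgeSystem a c q wm wp := by
  classical
  have : Nonempty (Fin M) := ⟨⟨0, hM⟩⟩
  obtain ⟨im, him⟩ := Finite.exists_max a
  obtain ⟨W, hW, hWd, hWmin, hWneg, hWpos⟩ := exists_upper hM ha hc him
  have hlow : ∃ w₀ : ℝ, 1 < c → ∃ o, o < w₀ ∧ w₀ < 0 ∧ mR a o = 1 / c ∧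
      (∀ x, x < o → mR a x < 1 / c) ∧ (∀ x, o < x → x < 0 → 1 / c < mR a x) ∧
      phiDeriv a c w₀ = 0 ∧ IsLocalMax (phiR a c) w₀ ∧
      (∀ x, o < x → x < w₀ → 0 < phiDeriv a c x) ∧ (∀ x, w₀ < x → x < 0 → phiDeriv a c x < 0) := by
    by_cases h : 1 < c
    · obtain ⟨o, w, h'⟩ := exists_lower hM ha h
      exact ⟨w, fun _ => ⟨o, h'⟩⟩
    · exact ⟨0, fun h' => absurd h' h⟩
  obtain ⟨w₀, hw₀⟩ := hlow
  -- The distinct eigenvalues whose upper gap produces a pair of edges; passing to the image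
  -- discards multiplicities.
  set B : Finset ℝ := (Finset.univ.image a).filter (HasGap a c) with hB
  have hBmem : ∀ l ∈ B, (∃ i, a i = l) ∧ HasGap a c l := fun l hl => by
    simpa [hB] using hl
  have hpair : ∀ l ∈ B, ∃ p q, IsGapPair a c l p q := by
    intro l hl
    obtain ⟨⟨i, rfl⟩, hg⟩ := hBmem l hl
    exact hg.exists_isGapPair hM ha hc
  choose! P Q hPQ using hpair
  obtain ⟨E, hEmem, hElt, hEsurj⟩ := exists_strictMono_enum B
  set n := B.card with hn
  -- The largest eigenvalue has no eigenvalue above it, so it is never in B; this leaves room for q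
  -- = n + 1.
  have hBcard : n + 1 ≤ (Set.range a).ncard := by
    have h1 : B ⊆ (Finset.univ.image a).erase (a im) := by
      intro l hl
      obtain ⟨⟨i, rfl⟩, ⟨j, hj⟩, -⟩ := hBmem l hl
      refine Finset.mem_erase.2 ⟨fun h => ?_, Finset.mem_image_of_mem _ (Finset.mem_univ _)⟩
      exact absurd (him j) (by rw [← h]; exact not_le.2 hj)
    have h2 := Finset.card_le_card h1
    rw [Finset.card_erase_of_mem (Finset.mem_image_of_mem _ (Finset.mem_univ _))] at h2
    have h3 : (Set.range a).ncard = (Finset.univ.image a).card := by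
      rw [← Set.ncard_coe_finset, Finset.coe_image, Finset.coe_univ, Set.image_univ]
    have h4 : 0 < (Finset.univ.image a).card :=
      Finset.card_pos.2 (Finset.univ_nonempty.image _)
    omega
  -- Pairs are enumerated from 0, edges from 1: the k-th pair gives `wp (k + 1)` and `wm (k + 2)`,
  -- leaving `wm 1` for the negative critical point and `wp (n + 1)` for the upper one. Values at 0
  -- are never used.
  set wp : ℕ → ℝ := fun k => if k ≤ n then P (E (k - 1)) else W with hwp
  set wm : ℕ → ℝ := fun k => if k = 1 then w₀ else Q (E (k - 2)) with hwm
  have hwp1 : ∀ k, k < n → wp (k + 1) = P (E k) := fun k hk => by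
    simp only [hwp, if_pos (Nat.succ_le_of_lt hk), Nat.add_sub_cancel]
  have hwpn : wp (n + 1) = W := by simp [hwp]
  have hwm2 : ∀ k, wm (k + 2) = Q (E k) := fun k => by simp [hwm]
  have hwm1 : wm 1 = w₀ := by simp [hwm]
  have hpr : ∀ k, k < n → IsGapPair a c (E k) (P (E k)) (Q (E k)) := fun k hk =>
    hPQ _ (hEmem k hk)
  have hupgood : ∀ w, a im < w → Good a c w := fun w hw =>
    good_of_mR_neg hM ha hc (fun i => ((him i).trans_lt hw).ne')
      (mR_neg_of_forall_lt hM ha fun i => (him i).trans_lt hw)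
  have hEpos : ∀ k, k < n → 0 < E k := fun k hk => by
    obtain ⟨⟨i, hi⟩, -⟩ := hBmem _ (hEmem k hk)
    rw [← hi]; exact ha i
  have hbet : ∀ k, k < n → ∀ w, P (E k) ≤ w → w ≤ Q (E k) → InGap a (E k) w :=
    fun k hk w h1 h2 => (hpr k hk).inGap_right.of_le hM ha
      ((hpr k hk).inGap_left.lt.trans_le h1) h2
  refine ⟨n + 1, wm, wp, ?_⟩
  refine
    { one_le := by omega
      le_card := hBcard
      wp_good := fun k hk1 hk => ?_
      wm_good := fun k hk1 hk => ?_
      wp_pos := fun k hk1 hk => ?_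
      wp_lt_wm := fun k hk1 hk => ?_
      wm_lt_wp := fun k hk1 hk => ?_
      inner := ?_
      lt_upper := fun i => by rw [hwpn]; exact (him i).trans_lt hW
      upper_iff := fun w hw => ?_
      upper_min := by rw [hwpn]; exact hWmin
      lower := fun h1c => ?_
      cases_of_pos := fun w hg hd => ?_
      between := fun k hk1 hk w h1 h2 => ?_
      above := fun w hw => ?_ }
  · obtain ⟨k, rfl⟩ := Nat.exists_eq_add_of_le' hk1
    rcases (Nat.lt_or_ge k n) with h | h
    · rw [hwp1 k h]
      exact ⟨(hpr k h).inGap_left.good hM ha hc, (hpr k h).deriv_left⟩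
    · obtain rfl : k = n := by omega
      rw [hwpn]
      exact ⟨hupgood W hW, hWd⟩
  · obtain ⟨k, rfl⟩ := Nat.exists_eq_add_of_le' hk1
    rw [hwm2 k]
    exact ⟨(hpr k (by omega)).inGap_right.good hM ha hc, (hpr k (by omega)).deriv_right⟩
  · obtain ⟨k, rfl⟩ := Nat.exists_eq_add_of_le' hk1
    rcases (Nat.lt_or_ge k n) with h | h
    · rw [hwp1 k h]
      exact (hEpos k h).trans (hpr k h).inGap_left.lt
    · obtain rfl : k = n := by omega
      rw [hwpn]
      exact (ha im).trans hW
  · obtain ⟨k, rfl⟩ := Nat.exists_eq_add_of_le' hk1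
    rw [hwp1 k (by omega), show k + 1 + 1 = k + 2 from rfl, hwm2 k]
    exact (hpr k (by omega)).lt
  · obtain ⟨k, rfl⟩ := Nat.exists_eq_add_of_le' hk1
    rw [hwm2 k, show k + 2 = (k + 1) + 1 from rfl]
    rcases (Nat.lt_or_ge (k + 1) n) with h | h
    · rw [hwp1 (k + 1) h]
      obtain ⟨⟨i, hi⟩, -⟩ := hBmem _ (hEmem (k + 1) h)
      have h1 := hElt k (k + 1) (by omega) h
      have h2 := ((hpr k (by omega)).inGap_right.gap i).resolve_left (by rw [hi]; exact not_le.2 h1)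
      rw [hi] at h2
      exact h2.trans (hpr (k + 1) h).inGap_left.lt
    · rw [show k + 1 = n by omega, hwpn]
      obtain ⟨j, hj⟩ := (hpr k (by omega)).inGap_right.exists_lt (hBmem _ (hEmem k (by omega))).2.1
      exact hj.trans ((him j).trans_lt hW)
  · ext w
    constructor
    · rintro ⟨⟨j, hj⟩, hne, hm, hext⟩
      obtain ⟨i, hi⟩ := exists_inGap hM ha hne hm
      have hgap := hi.hasGap_of_isLocalExtr ⟨j, hi.lt.trans hj⟩ hext
      have hmem : a i ∈ B := by simp [hB, hgap]
      obtain ⟨k, hk, hEk⟩ := hEsurj _ hmem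
      have hd := hext.hasDerivAt_eq_zero (hasDerivAt_phiR hne)
      have hp := hpr k hk
      rw [← hEk] at hi
      rcases lt_trichotomy w (P (E k)) with h | h | h
      · exact absurd hd (hp.neg_left w hi h).ne
      · exact Or.inl ⟨k + 1, ⟨by omega, by omega⟩, by rw [hwp1 k hk, h]⟩
      rcases lt_trichotomy w (Q (E k)) with h' | h' | h'
      · exact absurd hd (hp.pos w h h').ne'
      · exact Or.inr ⟨k + 2, ⟨by omega, by omega⟩, by rw [hwm2 k, h']⟩
      · exact absurd hd (hp.neg_right w hi h').ne
    · rintro (⟨k, ⟨hk1, hk⟩, rfl⟩ | ⟨k, ⟨hk1, hk⟩, rfl⟩)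
      · obtain ⟨k, rfl⟩ := Nat.exists_eq_add_of_le' hk1
        have hk' : k < n := by omega
        rw [hwp1 k hk']
        have hp := hpr k hk'
        exact ⟨hp.inGap_left.exists_lt (hBmem _ (hEmem k hk')).2.1, hp.inGap_left.ne,
          hp.inGap_left.mR_neg, Or.inl hp.isLocalMin⟩
      · obtain ⟨k, rfl⟩ := Nat.exists_eq_add_of_le' (show 2 ≤ k from hk1)
        have hk' : k < n := by omega
        rw [hwm2 k]
        have hp := hpr k hk'
        exact ⟨hp.inGap_right.exists_lt (hBmem _ (hEmem k hk')).2.1, hp.inGap_right.ne,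
          hp.inGap_right.mR_neg, Or.inr hp.isLocalMax⟩
  · rw [hwpn]
    refine ⟨fun h => ?_, fun h => by rw [h, hWd]⟩
    rcases lt_trichotomy w W with h' | h' | h'
    · exact absurd h (hWneg w (hw im) h').ne
    · exact h'
    · exact absurd h (hWpos w h').ne'
  · rw [hwm1]
    obtain ⟨o, h1, h2, h3, h4, h5, h6, h7, h8, h9⟩ := hw₀ h1c
    refine ⟨o, h1, h2, h3, h4, fun x hx hx0 => ⟨good_of_neg ha hc hx0 (h5 x hx hx0), ?_⟩, h7, h8⟩
    refine ⟨fun h => ?_, fun h => by rw [h, h6]⟩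
    rcases lt_trichotomy x w₀ with h' | h' | h'
    · exact absurd h (h8 x hx h').ne'
    · exact h'
    · exact absurd h (h9 x h' hx0).ne
  · rcases hg.mR_neg_or hc with hm | ⟨hw0, hm⟩
    · right
      by_cases hall : ∀ i, a i < w
      · right
        rw [hwpn]
        rcases lt_trichotomy w W with h' | h' | h'
        · exact absurd hd (hWneg w (hall im) h').not_gt
        · rw [h', hWd] at hd; exact absurd hd (lt_irrefl _)
        · exact h'
      · left
        push Not at hall
        obtain ⟨j, hj⟩ := hall
        have hj' : w < a j := lt_of_le_of_ne hj (hg.ne j)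
        obtain ⟨i, hi⟩ := exists_inGap hM ha hg.ne hm
        have hgap := hi.hasGap_of_deriv_pos ⟨j, hi.lt.trans hj'⟩ hd
        have hmem : a i ∈ B := by simp [hB, hgap]
        obtain ⟨k, hk, hEk⟩ := hEsurj _ hmem
        have hp := hpr k hk
        rw [← hEk] at hi
        refine ⟨k + 1, by omega, by omega, ?_, ?_⟩
        · rw [hwp1 k hk]
          rcases lt_trichotomy w (P (E k)) with h | h | h
          · exact absurd hd (hp.neg_left w hi h).not_gt
          · rw [h, hp.deriv_left] at hd; exact absurd hd (lt_irrefl _)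
          · exact h
        · rw [show k + 1 + 1 = k + 2 from rfl, hwm2 k]
          rcases lt_trichotomy w (Q (E k)) with h | h | h
          · exact h
          · rw [h, hp.deriv_right] at hd; exact absurd hd (lt_irrefl _)
          · exact absurd hd (hp.neg_right w hi h).not_gt
    · left
      have h1c : 1 < c := by
        have := hm.trans (mR_lt_one_of_neg hM ha hw0)
        rwa [div_lt_one hc] at this
      refine ⟨h1c, ?_⟩
      rw [hwm1]
      obtain ⟨o, h1, h2, h3, h4, h5, h6, h7, h8, h9⟩ := hw₀ h1c
      rcases lt_trichotomy w w₀ with h' | h' | h'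
      · exact h'
      · rw [h', h6] at hd; exact absurd hd (lt_irrefl _)
      · exact absurd hd (h9 w h' hw0).not_gt
  · obtain ⟨k, rfl⟩ := Nat.exists_eq_add_of_le' hk1
    have hk' : k < n := by omega
    rw [hwp1 k hk'] at h1 ⊢
    rw [show k + 1 + 1 = k + 2 from rfl, hwm2 k] at h2 ⊢
    exact ⟨(hbet k hk' w h1 h2).good hM ha hc, (hpr k hk').pos w⟩
  · rw [hwpn] at hw
    exact ⟨hupgood w (hW.trans hw), hWpos w hw⟩

end Edges

/-! ### From critical points to bands. -/

section Bands

variable {M : ℕ} {a : Fin M → ℝ} {c : ℝ} {q : ℕ} {wm wp : ℕ → ℝ} {κ μ ν : Measure ℝ}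

/-- The ends are interlaced. Stating the gap conditions as implications lets an induction push a
point that avoids every band past each right end in turn. -/
theorem exists_band_iff {xm xp : ℕ → ℝ} (hq : 1 ≤ q) (h₁ : ∀ k, 1 ≤ k → k ≤ q → xm k < xp k)
    (h₂ : ∀ k, 1 ≤ k → k < q → xp k < xm (k + 1)) (x : ℝ) :
    (∃ k, (1 ≤ k ∧ k ≤ q) ∧ xm k ≤ x ∧ x ≤ xp k) ↔
      xm 1 ≤ x ∧ x ≤ xp q ∧ ∀ k, 1 ≤ k → k < q → xp k < x → xm (k + 1) ≤ x := by
  have hm : ∀ j k, 1 ≤ j → j ≤ k → k ≤ q → xm j ≤ xm k ∧ xp j ≤ xp k := by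
    intro j k hj hjk
    induction k, hjk using Nat.le_induction with
    | base => exact fun _ => ⟨le_rfl, le_rfl⟩
    | succ k hk ih =>
      intro hkq
      have h := ih (by omega)
      have h3 := h₁ k (by omega) (by omega)
      have h4 := h₂ k (by omega) (by omega)
      have h5 := h₁ (k + 1) (by omega) hkq
      exact ⟨by linarith [h.1], by linarith [h.2]⟩
  constructor
  · rintro ⟨k, ⟨hk1, hkq⟩, hxm, hxp⟩
    refine ⟨(hm 1 k le_rfl hk1 hkq).1.trans hxm, hxp.trans (hm k q hk1 hkq le_rfl).2, ?_⟩
    intro j hj hjq hjx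
    rcases Nat.lt_or_ge j k with h | h
    · exact (hm (j + 1) k (by omega) h hkq).1.trans hxm
    · exact absurd (hxp.trans (hm k j hk1 h hjq.le).2) (not_le.2 hjx)
  · rintro ⟨hx1, hxq, hgap⟩
    by_contra! hno
    have : ∀ k, 1 ≤ k → k ≤ q → xp k < x := by
      intro k hk
      induction k, hk using Nat.le_induction with
      | base => exact fun h => hno 1 ⟨le_rfl, h⟩ hx1
      | succ k hk ih =>
        exact fun h => hno (k + 1) ⟨by omega, h⟩ (hgap k hk h (ih (by omega)))
    exact absurd hxq (not_le.2 (this q hq le_rfl))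

/-- The left ends of the bands in terms of the eigenvalues. -/
def leftEnd (a : Fin M → ℝ) (c : ℝ) (wm : ℕ → ℝ) (k : ℕ) : ℝ :=
  if k = 1 ∧ c ≤ 1 then 0 else phiR a c (wm k)

namespace IsEdgeSystem

theorem wm_good' (h : IsEdgeSystem a c q wm wp) {k : ℕ} (hk1 : 1 ≤ k) (hk : k ≤ q)
    (hkc : ¬(k = 1 ∧ c ≤ 1)) : Good a c (wm k) ∧ phiDeriv a c (wm k) = 0 ∧ wm k < wp k := by
  rcases hk1.eq_or_lt with rfl | hk2
  · have hc : 1 < c := by simpa using hkc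
    obtain ⟨o, h1, h2, h3, h4, h5, -⟩ := h.lower hc
    have := h5 _ h1 h2
    exact ⟨this.1, this.2.2 rfl, h2.trans (h.wp_pos 1 le_rfl hk)⟩
  · exact ⟨(h.wm_good k hk2 hk).1, (h.wm_good k hk2 hk).2, h.wm_lt_wp k hk2 hk⟩

theorem leftEnd_lt (hM : 0 < M) (ha : ∀ i, 0 < a i) (hc : 0 < c) (h : IsEdgeSystem a c q wm wp)
    {k : ℕ} (hk1 : 1 ≤ k) (hk : k ≤ q) : leftEnd a c wm k < phiR a c (wp k) := by
  have hp := h.wp_good k hk1 hk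
  rw [leftEnd]
  split_ifs with hkc
  · exact hp.1.phiR_pos
  · have hm := h.wm_good' hk1 hk hkc
    exact phiR_lt_phiR hM ha hc hm.1 hp.1 hm.2.1.ge hp.2.ge hm.2.2

theorem leftEnd_succ {k : ℕ} (hk1 : 1 ≤ k) : leftEnd a c wm (k + 1) = phiR a c (wm (k + 1)) := by
  rw [leftEnd, if_neg (by omega)]

theorem lt_leftEnd_succ (hM : 0 < M) (ha : ∀ i, 0 < a i) (hc : 0 < c)
    (h : IsEdgeSystem a c q wm wp) {k : ℕ} (hk1 : 1 ≤ k) (hk : k < q) :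
    phiR a c (wp k) < leftEnd a c wm (k + 1) := by
  have hp := h.wp_good k hk1 hk.le
  have hm := h.wm_good (k + 1) (by omega) hk
  rw [leftEnd_succ hk1]
  exact phiR_lt_phiR hM ha hc hp.1 hm.1 hp.2.ge hm.2.ge (h.wp_lt_wm k hk1 hk)

theorem leftEnd_nonneg (h : IsEdgeSystem a c q wm wp) {k : ℕ} (hk1 : 1 ≤ k) (hk : k ≤ q) :
    0 ≤ leftEnd a c wm k := by
  rw [leftEnd]
  split_ifs with hkc
  · exact le_rfl
  · exact (h.wm_good' hk1 hk hkc).1.phiR_pos.le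

theorem leftEnd_one_pos (h : IsEdgeSystem a c q wm wp) (hc : 1 < c) : 0 < leftEnd a c wm 1 := by
  rw [leftEnd, if_neg (by simpa using hc)]
  exact (h.wm_good' le_rfl h.one_le (by simpa using hc)).1.phiR_pos

/-- Monotonicity over all good points with φ' ≥ 0 places φ(w) between the critical values at the
ends of its interval. Conversely the intermediate value theorem fills each gap, starting at φ(o) = 0
on the negative axis. -/
theorem mem_gapSet_iff (hM : 0 < M) (ha : ∀ i, 0 < a i) (hc : 0 < c)
    (h : IsEdgeSystem a c q wm wp) {x : ℝ} (hx : 0 < x) :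
    x ∈ gapSet a c ↔ x < leftEnd a c wm 1 ∨
      (∃ k, 1 ≤ k ∧ k < q ∧ phiR a c (wp k) < x ∧ x < leftEnd a c wm (k + 1)) ∨
      phiR a c (wp q) < x := by
  constructor
  · rintro ⟨w, ⟨hg, hd⟩, rfl⟩
    rcases h.cases_of_pos w hg hd with ⟨h1c, hw⟩ | ⟨k, hk1, hk, h1, h2⟩ | hw
    · left
      have hkc : ¬(1 = 1 ∧ c ≤ 1) := by simpa using h1c
      have hm := h.wm_good' le_rfl h.one_le hkc
      rw [leftEnd, if_neg hkc]
      exact phiR_lt_phiR hM ha hc hg hm.1 hd.le hm.2.1.ge hw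
    · have hp := h.wp_good k hk1 hk.le
      have hm := h.wm_good (k + 1) (by omega) hk
      refine Or.inr (Or.inl ⟨k, hk1, hk, phiR_lt_phiR hM ha hc hp.1 hg hp.2.ge hd.le h1, ?_⟩)
      rw [leftEnd_succ hk1]
      exact phiR_lt_phiR hM ha hc hg hm.1 hd.le hm.2.ge h2
    · have hp := h.wp_good q h.one_le le_rfl
      exact Or.inr (Or.inr (phiR_lt_phiR hM ha hc hp.1 hg hp.2.ge hd.le hw))
  · rintro (hx1 | ⟨k, hk1, hk, h1, h2⟩ | hxq)
    · by_cases hkc : 1 = 1 ∧ c ≤ 1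
      · rw [leftEnd, if_pos hkc] at hx1
        exact absurd hx1 hx.not_gt
      rw [leftEnd, if_neg hkc] at hx1
      obtain ⟨o, ho1, ho2, ho3, -, ho5, -, ho7⟩ := h.lower (by simpa using hkc)
      have hcont : ContinuousOn (phiR a c) (Set.Icc o (wm 1)) := fun y hy =>
        (hasDerivAt_phiR (fun i => ((hy.2.trans_lt ho2).trans
          (ha i)).ne)).continuousAt.continuousWithinAt
      have hφo : phiR a c o = 0 := by
        rw [phiR_eq_mR, ho3, mul_one_div_cancel hc.ne', sub_self, mul_zero]
      obtain ⟨w, hw, rfl⟩ := intermediate_value_Ioo ho1.le hcont ⟨by rwa [hφo], hx1⟩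
      exact ⟨w, ⟨(ho5 w hw.1 (hw.2.trans ho2)).1, ho7 w hw.1 hw.2⟩, rfl⟩
    · rw [leftEnd_succ hk1] at h2
      have hcont : ContinuousOn (phiR a c) (Set.Icc (wp k) (wm (k + 1))) := fun y hy =>
        (hasDerivAt_phiR
          (h.between k hk1 hk y hy.1 hy.2).1.ne).continuousAt.continuousWithinAt
      obtain ⟨w, hw, rfl⟩ := intermediate_value_Ioo (h.wp_lt_wm k hk1 hk).le hcont ⟨h1, h2⟩
      have hb := h.between k hk1 hk w hw.1.le hw.2.le
      exact ⟨w, ⟨hb.1, hb.2 hw.1 hw.2⟩, rfl⟩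
    · obtain ⟨y, hy, hyq⟩ := ((tendsto_phiR_atTop hM ha hc).eventually_gt_atTop x).and
        (eventually_gt_atTop (wp q)) |>.exists
      have hcont : ContinuousOn (phiR a c) (Set.Icc (wp q) y) := fun t ht =>
        (hasDerivAt_phiR
          (fun i => ((h.lt_upper i).trans_le ht.1).ne')).continuousAt.continuousWithinAt
      obtain ⟨w, hw, rfl⟩ := intermediate_value_Ioo hyq.le hcont ⟨hxq, hy⟩
      exact ⟨w, h.above w hw.1, rfl⟩

theorem notMem_gapSet_iff (hM : 0 < M) (ha : ∀ i, 0 < a i) (hc : 0 < c)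
    (h : IsEdgeSystem a c q wm wp) {x : ℝ} (hx : 0 < x) :
    x ∉ gapSet a c ↔ ∃ k, (1 ≤ k ∧ k ≤ q) ∧ leftEnd a c wm k ≤ x ∧ x ≤ phiR a c (wp k) := by
  rw [exists_band_iff (xp := fun k => phiR a c (wp k)) h.one_le
    (fun k hk1 hk => h.leftEnd_lt hM ha hc hk1 hk)
    (fun k hk1 hk => h.lt_leftEnd_succ hM ha hc hk1 hk), h.mem_gapSet_iff hM ha hc hx]
  push Not
  exact and_congr_right fun _ => and_comm

theorem support_eq (hM : 0 < M) (ha : ∀ i, 0 < a i) (hc : 0 < c)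
    (h : IsEdgeSystem a c q wm wp) (hneg : κ (Set.Iio 0) = 0)
    (hpos : ∀ x, 0 < x → (x ∈ κ.support ↔ x ∉ gapSet a c)) (hzero : 1 < c → 0 ∈ κ.support) :
    κ.support = bandSet c q (leftEnd a c wm) (fun k => phiR a c (wp k)) := by
  ext x
  have hband : x ∈ bandSet c q (leftEnd a c wm) (fun k => phiR a c (wp k)) ↔
      (1 < c ∧ x = 0) ∨
        ∃ k, (1 ≤ k ∧ k ≤ q) ∧ leftEnd a c wm k ≤ x ∧ x ≤ phiR a c (wp k) := by
    simp [bandSet, and_left_comm]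
  rw [hband]
  rcases lt_trichotomy x 0 with hx | rfl | hx
  · have h1 : x ∉ κ.support := by
      rw [Measure.notMem_support_iff_exists]
      exact ⟨Set.Iio 0, Iio_mem_nhds hx, hneg⟩
    refine ⟨fun h' => absurd h' h1, ?_⟩
    rintro (⟨-, rfl⟩ | ⟨k, ⟨hk1, hk⟩, h2, -⟩)
    · exact absurd hx (lt_irrefl _)
    · exact absurd ((h.leftEnd_nonneg hk1 hk).trans h2) (not_le.2 hx)
  · rcases lt_or_ge 1 c with h1c | h1c
    · exact ⟨fun _ => Or.inl ⟨h1c, rfl⟩, fun _ => hzero h1c⟩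
    · have hl : leftEnd a c wm 1 = 0 := if_pos ⟨rfl, h1c⟩
      have hlt := h.leftEnd_lt hM ha hc le_rfl h.one_le
      rw [hl] at hlt
      refine ⟨fun _ => Or.inr ⟨1, ⟨le_rfl, h.one_le⟩, hl.le, hlt.le⟩, fun _ => ?_⟩
      -- For c ≤ 1 the origin is the left end of a nondegenerate band and is reached because the
      -- support is closed.
      have hsub : Set.Ioo 0 (phiR a c (wp 1)) ⊆ κ.support := fun y hy =>
        (hpos y hy.1).2 ((h.notMem_gapSet_iff hM ha hc hy.1).2
          ⟨1, ⟨le_rfl, h.one_le⟩, by rw [hl]; exact hy.1.le, hy.2.le⟩)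
      have hcl := closure_minimal hsub Measure.isClosed_support
      rw [closure_Ioo hlt.ne] at hcl
      exact hcl ⟨le_rfl, hlt.le⟩
  · rw [hpos x hx, h.notMem_gapSet_iff hM ha hc hx]
    exact ⟨Or.inr, fun h' => h'.resolve_left fun h'' => hx.ne' h''.2⟩

theorem zero_mem_support (hM : 0 < M) (ha : ∀ i, 0 < a i) (hc : 1 < c)
    (h : IsEdgeSystem a c q wm wp) {Φ : ℂ → ℂ} (hμ : IsTransformOf a c Φ μ)
    (hΦ : ∀ o : ℝ, o < 0 → mR a o = 1 / c → Φ o ≠ 0) : 0 ∈ μ.support := by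
  have hc0 : 0 < c := by linarith
  obtain ⟨o, ho1, ho2, ho3, -, ho5, -, ho7⟩ := h.lower hc
  have ho0 := ho1.trans ho2
  refine hμ.zero_mem_support hM ha hc0 (o := o) (fun i => (ho0.trans (ha i)).ne) ?_
    (hΦ o ho0 ho3) ?_
  · rw [phiR_eq_mR, ho3, mul_one_div_cancel hc0.ne', sub_self, mul_zero]
  · filter_upwards [Ioo_mem_nhdsGT ho1] with w hw
    exact ⟨(ho5 w hw.1 (hw.2.trans ho2)).1, ho7 w hw.1 hw.2⟩

theorem support_eq_of_isTransformOf (hM : 0 < M) (ha : ∀ i, 0 < a i) (hc : 0 < c)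
    (h : IsEdgeSystem a c q wm wp) (hμ : IsTransformOf a c (fun w => w * mC a w) μ)
    (hν : IsTransformOf a c (fun w => mC a w - 1) ν) :
    μ.support = bandSet c q (leftEnd a c wm) (fun k => phiR a c (wp k)) ∧
      ν.support = bandSet c q (leftEnd a c wm) (fun k => phiR a c (wp k)) := by
  refine ⟨h.support_eq hM ha hc (hμ.measure_Iio_eq_zero hM ha hc)
      (fun x hx => (mem_support_iff_notMem_gapSet hM ha hc hμ hν hx).1)
      fun h1c => h.zero_mem_support hM ha h1c hμ fun o ho hm => ?_,
    h.support_eq hM ha hc (hν.measure_Iio_eq_zero hM ha hc)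
      (fun x hx => (mem_support_iff_notMem_gapSet hM ha hc hμ hν hx).2)
      fun h1c => h.zero_mem_support hM ha h1c hν fun o _ hm => ?_⟩
  -- At o the function Φ is o/c for μ and 1/c - 1 for ν; both are nonzero because o < 0 and c > 1.
  · rw [mC_ofReal, hm, ← Complex.ofReal_mul]
    exact_mod_cast mul_ne_zero ho.ne (one_div_ne_zero hc.ne')
  · rw [mC_ofReal, hm, ← Complex.ofReal_one, ← Complex.ofReal_sub]
    have : 1 / c < 1 := by rwa [div_lt_one hc]
    exact_mod_cast (sub_neg.2 this).ne

end IsEdgeSystem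

theorem bandSet_congr {xm xp xm' xp' : ℕ → ℝ} (hm : ∀ k, 1 ≤ k → k ≤ q → xm k = xm' k)
    (hp : ∀ k, 1 ≤ k → k ≤ q → xp k = xp' k) : bandSet c q xm xp = bandSet c q xm' xp' := by
  unfold bandSet
  congr 1
  refine Set.iUnion₂_congr fun k hk => ?_
  rw [hm k hk.1 hk.2, hp k hk.1 hk.2]

end Bands

/-! ### Transfer from the eigenvalues back to R. -/

section Labelling

variable {M : ℕ} {c : ℝ} {q : ℕ} {wm wp : ℕ → ℝ} {R : Matrix (Fin M) (Fin M) ℂ}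

theorem phi_eq_phiR (hR : R.IsHermitian) {w : ℝ} (hw : ∀ i, w ≠ hR.eigenvalues i) :
    phi R c w = phiR hR.eigenvalues c w := by
  rw [phi, mFun_of_ne hR hw, phiR_eq_mR]
  rfl

theorem phi_eventuallyEq (hR : R.IsHermitian) {w : ℝ} (hw : ∀ i, w ≠ hR.eigenvalues i) :
    phi R c =ᶠ[𝓝 w] phiR hR.eigenvalues c :=
  (eventually_ne_eigenvalue hw).mono fun _ hx => phi_eq_phiR hR hx

theorem deriv_phi (hR : R.IsHermitian) {w : ℝ} (hw : ∀ i, w ≠ hR.eigenvalues i) :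
    deriv (phi R c) w = phiDeriv hR.eigenvalues c w := by
  rw [(phi_eventuallyEq hR hw).deriv_eq, (hasDerivAt_phiR hw).deriv]

/-- The default value m = 0 at an eigenvalue means that the condition m < 0 already excludes the
poles. -/
theorem ne_eigenvalue_of_mFun_ne_zero (hR : R.IsHermitian) {w : ℝ} (h : mFun R w ≠ 0) (i : Fin M) :
    w ≠ hR.eigenvalues i := by
  rintro rfl
  exact h (mFun_eigenvalue hR i)

theorem IsEdgeSystem.leftEdge_eq (hR : R.IsHermitian)
    (h : IsEdgeSystem hR.eigenvalues c q wm wp) {k : ℕ} (hk1 : 1 ≤ k) (hk : k ≤ q) :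
    leftEdge R c wm k = leftEnd hR.eigenvalues c wm k := by
  rw [leftEdge, leftEnd]
  split_ifs with hkc
  · rfl
  · exact phi_eq_phiR hR (h.wm_good' hk1 hk hkc).1.ne

theorem IsEdgeSystem.rightEdge_eq (hR : R.IsHermitian)
    (h : IsEdgeSystem hR.eigenvalues c q wm wp) {k : ℕ} (hk1 : 1 ≤ k) (hk : k ≤ q) :
    rightEdge R c wp k = phiR hR.eigenvalues c (wp k) :=
  phi_eq_phiR hR (h.wp_good k hk1 hk).1.ne

theorem IsEdgeSystem.isEdgeLabelling (hR : R.PosDef)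
    (h : IsEdgeSystem hR.isHermitian.eigenvalues c q wm wp) : IsEdgeLabelling R c q wm wp := by
  have hH := hR.isHermitian
  have ha : ∀ i, 0 < hH.eigenvalues i := hR.eigenvalues_pos
  have hspec : spectrum ℝ R = Set.range hH.eigenvalues := hH.spectrum_real_eq_range_eigenvalues
  have hup : ∀ i, wp q ≠ hH.eigenvalues i := fun i => (h.lt_upper i).ne'
  refine
    { one_le := h.one_le
      le_card := by rw [hspec]; exact h.le_card
      wp_lt_wm := h.wp_lt_wm
      wm_lt_wp := fun k h1 h2 => h.wm_lt_wp k h1 h2.le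
      inner := ?_
      upper := ?_
      upper_min := (phi_eventuallyEq hH hup).isLocalMin_iff.2 h.upper_min
      lower := fun h1c => ?_
      lower_max := fun h1c => ?_ }
  · rw [← h.inner]
    ext w
    constructor
    · rintro ⟨⟨l, hl, hwl⟩, hm, hext⟩
      rw [hspec] at hl
      obtain ⟨i, rfl⟩ := hl
      have hne := ne_eigenvalue_of_mFun_ne_zero hH hm.ne
      rw [mFun_of_ne hH hne] at hm
      exact ⟨⟨i, hwl⟩, hne, hm, (phi_eventuallyEq hH hne).isLocalExtr_iff.1 hext⟩
    · rintro ⟨⟨i, hi⟩, hne, hm, hext⟩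
      refine ⟨⟨_, by rw [hspec]; exact ⟨i, rfl⟩, hi⟩, ?_,
        (phi_eventuallyEq hH hne).isLocalExtr_iff.2 hext⟩
      rw [mFun_of_ne hH hne]
      exact hm
  · ext w
    have hs : (∀ l ∈ spectrum ℝ R, l < w) ↔ ∀ i, hH.eigenvalues i < w := by
      rw [hspec, Set.forall_mem_range]
    rw [upperCritical, Set.mem_ofPred_eq, hs, Set.mem_singleton_iff]
    constructor
    · rintro ⟨hw, hd⟩
      rw [deriv_phi hH fun i => (hw i).ne'] at hd
      exact (h.upper_iff w hw).1 hd
    · rintro rfl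
      refine ⟨h.lt_upper, ?_⟩
      rw [deriv_phi hH hup]
      exact (h.upper_iff _ h.lt_upper).2 rfl
  · obtain ⟨o, ho1, ho2, ho3, ho4, ho5, -⟩ := h.lower h1c
    have hneg : ∀ x, x < 0 → ∀ i, x ≠ hH.eigenvalues i := fun x hx i => (hx.trans (ha i)).ne
    have ho0 := ho1.trans ho2
    have hleast : IsLeast {v | mFun R v = 1 / c} o := by
      refine ⟨?_, fun v hv => ?_⟩
      · rw [Set.mem_ofPred_eq, mFun_of_ne hH (hneg o ho0)]
        exact ho3
      · by_contra! hlt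
        have hv' : mFun R v = 1 / c := hv
        rw [mFun_of_ne hH (hneg v (hlt.trans ho0))] at hv'
        exact (ho4 v hlt).ne hv'
    ext w
    rw [Set.mem_singleton_iff]
    constructor
    · rintro ⟨o', hl, h1, h2, h3⟩
      obtain rfl := hl.unique hleast
      rw [deriv_phi hH (hneg w h2)] at h3
      exact (ho5 w h1 h2).2.1 h3
    · rintro rfl
      refine ⟨o, hleast, ho1, ho2, ?_⟩
      rw [deriv_phi hH (hneg _ ho2)]
      exact (ho5 _ ho1 ho2).2.2 rfl
  · obtain ⟨o, ho1, ho2, -, -, -, ho6, -⟩ := h.lower h1c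
    exact (phi_eventuallyEq hH fun i => (ho2.trans (ha i)).ne).isLocalMax_iff.2 ho6

end Labelling

end AutocovarianceSupport
end

open AutocovarianceSupport

theorem mainTheorem3 (M L N : ℕ) (hM : 0 < M) (hL : 0 < L) (hN : 0 < N) (c : ℝ)
    (hc : c = (M : ℝ) * L / N) (R : Matrix (Fin M) (Fin M) ℂ) (hR : R.PosDef) :
    (∀ z : ℂ, 0 < z.im → ∃! t : ℂ, AutocovarianceSupport.IsCanonicalSolution R c z t) ∧
    (∃! μ : MeasureTheory.Measure ℝ, AutocovarianceSupport.IsMu R c μ) ∧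
    (∃! ν : MeasureTheory.Measure ℝ, AutocovarianceSupport.IsNu R c ν) ∧
    ∃ (q : ℕ) (wm wp : ℕ → ℝ), AutocovarianceSupport.IsEdgeLabelling R c q wm wp ∧
      (∀ k, 1 ≤ k → k ≤ q →
        AutocovarianceSupport.leftEdge R c wm k < AutocovarianceSupport.rightEdge R c wp k) ∧
      (∀ k, 1 ≤ k → k < q →
        AutocovarianceSupport.rightEdge R c wp k < AutocovarianceSupport.leftEdge R c wm (k + 1)) ∧
      (1 < c → 0 < AutocovarianceSupport.leftEdge R c wm 1) ∧
      (∀ μ : MeasureTheory.Measure ℝ, AutocovarianceSupport.IsMu R c μ →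
        μ.support = AutocovarianceSupport.bandSet c q
          (AutocovarianceSupport.leftEdge R c wm) (AutocovarianceSupport.rightEdge R c wp)) ∧
      (∀ ν : MeasureTheory.Measure ℝ, AutocovarianceSupport.IsNu R c ν →
        ν.support = AutocovarianceSupport.bandSet c q
          (AutocovarianceSupport.leftEdge R c wm) (AutocovarianceSupport.rightEdge R c wp)) := by
  have hc0 : 0 < c := by rw [hc]; positivity
  have ha : ∀ i, 0 < hR.isHermitian.eigenvalues i := hR.eigenvalues_pos
  -- The support argument uses μ and ν together, so a partner is needed for each.
  obtain ⟨μ₀, hμ₀, -⟩ := existsUnique_isMu hM hR hc0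
  obtain ⟨ν₀, hν₀, -⟩ := existsUnique_isNu hM hR hc0
  obtain ⟨q, wm, wp, h⟩ := exists_isEdgeSystem hM ha hc0
  have hband : bandSet c q (leftEdge R c wm) (rightEdge R c wp) =
      bandSet c q (leftEnd hR.isHermitian.eigenvalues c wm)
        (fun k => phiR hR.isHermitian.eigenvalues c (wp k)) :=
    bandSet_congr (fun k hk1 hk => h.leftEdge_eq hR.isHermitian hk1 hk)
      (fun k hk1 hk => h.rightEdge_eq hR.isHermitian hk1 hk)
  refine ⟨fun z hz => existsUnique_isCanonicalSolution hM hR hc0 hz, existsUnique_isMu hM hR hc0,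
    existsUnique_isNu hM hR hc0, q, wm, wp, h.isEdgeLabelling hR, fun k hk1 hk => ?_,
    fun k hk1 hk => ?_, fun h1c => ?_, fun μ hμ => ?_, fun ν hν => ?_⟩
  · rw [h.leftEdge_eq hR.isHermitian hk1 hk, h.rightEdge_eq hR.isHermitian hk1 hk]
    exact h.leftEnd_lt hM ha hc0 hk1 hk
  · rw [h.leftEdge_eq hR.isHermitian (Nat.le_add_left 1 k) hk,
      h.rightEdge_eq hR.isHermitian hk1 hk.le]
    exact h.lt_leftEnd_succ hM ha hc0 hk1 hk
  · rw [h.leftEdge_eq hR.isHermitian le_rfl h.one_le]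
    exact h.leftEnd_one_pos h1c
  · rw [hband]
    exact (h.support_eq_of_isTransformOf hM ha hc0 (hμ.isTransformOf hM hR hc0)
      (hν₀.isTransformOf hM hR hc0)).1
  · rw [hband]
    exact (h.support_eq_of_isTransformOf hM ha hc0 (hμ₀.isTransformOf hM hR hc0)
      (hν.isTransformOf hM hR hc0)).2
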